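/- Let $V_5$ be a $5$-dimensional complex vector space with a volume form $\mathrm{vol}:\bigwedge^5V_5\xrightarrow{\sim}\mathbb{C}$, let $W\subseteq\bigwedge^2V_5$ be a $7$-dimensional subspace, and let $Q\subset\mathbb{P}(W)$ be the quadric of a symmetric bilinear form $\gamma$ on $W$. Suppose that $S=\mathbb{P}(W)\cap G(2,V_5)\cap Q$ (scheme-theoretic intersection, $G(2,V_5)\subset\mathbb{P}(\bigwedge^2V_5)$ being embedded by Plücker) is a smooth irreducible surface, i.e. a smooth ordinary Gushel–Mukai variety of dimension $2$; such an $S$ is a K3 surface of degree $10$ in $\mathbb{P}(W)\cong\mathbb{P}^6$. Put $V_6=V_5\oplus\mathbb{C}x$, and let $$A(S)=\{\eta+x\wedge w \;:\; \eta\in\textstyle\bigwedge^3V_5,\ w\in W,\ \mathrm{vol}(\eta\wedge w')=-\gamma(w,w')\ \text{for all } w'\in W\}\subset\textstyle\bigwedge^3V_6$$ be the Lagrangian subspace associated to $S$. For $[v]\in\mathbb{P}(V_6)$ let $F_v=v\wedge\bigwedge^2V_6$, and let $Y^3_{A(S)}=\{[v]\in\mathbb{P}(V_6) : \dim(F_v\cap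 A(S))=3\}$. If $Y^3_{A(S)}\setminus\mathbb{P}(V_5)\neq\emptyset$, then $S$ contains a quintic elliptic pencil: there is a morphism $f:S\to\mathbb{P}^1$ such that, for all but finitely many $t\in\mathbb{P}^1$, the fibre $f^{-1}(t)$ is a smooth irreducible curve of genus $1$ and degree $5$ in $\mathbb{P}(W)$. -/

import Mathlib

open Module
open scoped LinearAlgebra.Projectivization

noncomputable section

/-! ### Projective geometry over `ℂ`, without coordinates

A polynomial function on a finite-dimensional complex vector space `V` is an element of the
subalgebra of `V → ℂ` generated by the linear functionals. -/

section Projective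

variable (V : Type*) [AddCommGroup V] [Module ℂ V]

/-- The homogeneous polynomial functions (forms) of degree `d` on `V`: sums of products of `d`
linear functionals, i.e. the `d`-th power of the space of linear functionals in `V → ℂ`. -/
def forms (d : ℕ) : Submodule ℂ (V → ℂ) :=
  LinearMap.range (LinearMap.ltoFun ℂ V ℂ ℂ) ^ d

/-- The Zariski topology on `ℙ(V)`: the sets `{f ≠ 0}`, for `f` a form, are a basis of it. -/
instance zariskiTopology : TopologicalSpace (ℙ ℂ V) :=
  TopologicalSpace.generateFrom
    {U | ∃ d : ℕ, ∃ f ∈ forms V d, U = {p : ℙ ℂ V | f p.rep ≠ 0}}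

variable {V}

/-- The affine cone over `X ⊆ ℙ(V)`, without its vertex. -/
def puncturedCone (X : Set (ℙ ℂ V)) : Set V :=
  {v | ∃ hv : v ≠ 0, Projectivization.mk ℂ v hv ∈ X}

/-- The forms on `V` (of all degrees) vanishing on `X`. They generate the homogeneous ideal of the
reduced closed subscheme `X` of `ℙ(V)`. -/
def vanishingForms (X : Set (ℙ ℂ V)) : Set (V → ℂ) :=
  {f | (∃ d : ℕ, f ∈ forms V d) ∧ ∀ p ∈ X, f p.rep = 0}

/-- The common kernel of the differentials at `v` of the functions in `F`. If `F` is a set of forms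
and `[v]` a common zero of them, this is the tangent space at `v` to the affine cone over the closed
subscheme of `ℙ(V)` cut out by `F`; its dimension is one more than that of the Zariski tangent space
of the subscheme at `[v]`. -/
def coneTangentSpace (F : Set (V → ℂ)) (v : V) : Submodule ℂ V :=
  ⨅ f ∈ F, ⨅ (D : Dual ℂ V) (_ : ∀ w, HasLineDerivAt ℂ f (D w) v w), LinearMap.ker D

/-- The Hilbert function of `X ⊆ ℙ(V)`: the dimension of the degree `d` part of its homogeneous
coordinate ring, i.e. of the space of restrictions to the cone over `X` of the forms of
degree `d`. -/
def hilbertFunction (X : Set (ℙ ℂ V)) (d : ℕ) : ℕ :=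
  finrank ℂ ((forms V d).map
    (LinearMap.funLeft ℂ ℂ (Subtype.val : puncturedCone X → V)))

/-- `E ⊆ ℙ(V)` is a smooth irreducible projective curve of degree `d` and genus `g`: a closed
irreducible subset, with Hilbert polynomial `d n + 1 - g` (so of dimension `1`, as `d > 0`), whose
Zariski tangent spaces all have dimension `1`. -/
structure IsSmoothCurve (E : Set (ℙ ℂ V)) (d g : ℕ) : Prop where
  isClosed : IsClosed E
  isIrreducible : IsIrreducible E
  degree_pos : 0 < d
  hilbertPolynomial :
    ∀ᶠ n : ℕ in Filter.atTop, (hilbertFunction E n : ℤ) = (d : ℤ) * n + 1 - g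
  smooth : ∀ p ∈ E, finrank ℂ (coneTangentSpace (vanishingForms E) p.rep) = 2

/-- A map from `X ⊆ ℙ(V)` to `ℙ(V')` is regular (a morphism of varieties) if near each point of `X`
it is given by forms of the same degree on `V`, without common zeros there. -/
def IsRegularMap {V' : Type*} [AddCommGroup V'] [Module ℂ V']
    (X : Set (ℙ ℂ V)) (f : X → ℙ ℂ V') : Prop :=
  ∀ p : X, ∃ U : Set (ℙ ℂ V), IsOpen U ∧ (p : ℙ ℂ V) ∈ U ∧
    ∃ (d : ℕ) (g : V → V'), (∀ φ : Dual ℂ V', (fun v => φ (g v)) ∈ forms V d) ∧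
      ∀ q : X, (q : ℙ ℂ V) ∈ U →
        ∃ h : g (q : ℙ ℂ V).rep ≠ 0, f q = Projectivization.mk ℂ (g (q : ℙ ℂ V).rep) h

/-- An elliptic pencil of degree `d` on `X ⊆ ℙ(V)`: the family of the fibres of a morphism
`X → ℙ¹` whose general fibre is a smooth irreducible curve of genus `1` and degree `d`. -/
def ContainsEllipticPencil (X : Set (ℙ ℂ V)) (d : ℕ) : Prop :=
  ∃ f : X → ℙ ℂ (Fin 2 → ℂ), IsRegularMap X f ∧
    ∀ᶠ t in Filter.cofinite, IsSmoothCurve (Subtype.val '' (f ⁻¹' {t})) d 1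

end Projective

/-! ### Exterior powers -/

section Exterior

variable {V : Type*} [AddCommGroup V] [Module ℂ V]

/-- The exterior product `⋀ⁱ V × ⋀ʲ V → ⋀ⁱ⁺ʲ V`. -/
def wedge {i j : ℕ} : ⋀[ℂ]^i V →ₗ[ℂ] ⋀[ℂ]^j V →ₗ[ℂ] ⋀[ℂ]^(i + j) V :=
  LinearMap.mk₂ ℂ (fun a b => ⟨(a : ExteriorAlgebra ℂ V) * b, SetLike.mul_mem_graded a.2 b.2⟩)
    (fun _ _ _ => Subtype.ext (add_mul _ _ _)) (fun _ _ _ => Subtype.ext (smul_mul_assoc _ _ _))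
    (fun _ _ _ => Subtype.ext (mul_add _ _ _)) (fun _ _ _ => Subtype.ext (mul_smul_comm _ _ _))

/-- A vector of `V` as an element of `⋀¹ V`. -/
def vec (v : V) : ⋀[ℂ]^1 V :=
  ⟨ExteriorAlgebra.ι ℂ v, by
    rw [ExteriorAlgebra.exteriorPower, pow_one]; exact LinearMap.mem_range_self _ v⟩

/-- `F_v = v ∧ ⋀² V`, as a subspace of the exterior algebra (it lies in `⋀³ V`). -/
def lagrangianFibre (v : V) : Submodule ℂ (ExteriorAlgebra ℂ V) :=
  (⋀[ℂ]^2 V).map (LinearMap.mulLeft ℂ (ExteriorAlgebra.ι ℂ v))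

/-- The stratum `Y^k_A = {[v] ∈ ℙ(V) | dim (F_v ∩ A) = k}`. -/
def epwStratum (A : Submodule ℂ (ExteriorAlgebra ℂ V)) (k : ℕ) : Set (ℙ ℂ V) :=
  {p | finrank ℂ (lagrangianFibre p.rep ⊓ A : Submodule ℂ (ExteriorAlgebra ℂ V)) = k}

end Exterior

/-! ### Ordinary Gushel-Mukai varieties and their Lagrangian subspaces -/

section GushelMukai

variable {V₅ : Type*} [AddCommGroup V₅] [Module ℂ V₅]

/-- The Pfaffian form `P_v(x, y) = vol(v ∧ x ∧ y)` on `⋀² V₅`. -/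
def pfaffian (vol : ⋀[ℂ]^5 V₅ ≃ₗ[ℂ] ℂ) (v : V₅) (x y : ⋀[ℂ]^2 V₅) : ℂ :=
  vol (wedge (wedge (vec v) x) y)

/-- The points of `ℙ(W) ∩ G(2, V₅) ∩ Q`, where `G(2, V₅) ⊆ ℙ(⋀² V₅)` consists of the classes of the
decomposable vectors and `Q ⊆ ℙ(W)` is the quadric of the symmetric bilinear form `γ`. -/
def gmLocus (W : Submodule ℂ (⋀[ℂ]^2 V₅)) (γ : LinearMap.BilinForm ℂ W) : Set (ℙ ℂ W) :=
  {p | (∃ v₁ v₂ : V₅, (p.rep : ⋀[ℂ]^2 V₅) = wedge (vec v₁) (vec v₂)) ∧ γ p.rep p.rep = 0}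

/-- The equations of the scheme `ℙ(W) ∩ G(2, V₅) ∩ Q` in `ℙ(W)`: the Pfaffian quadrics, which
generate the homogeneous ideal of `G(2, V₅)`, restricted to `W`, and the equation of `Q`. -/
def gmEquations (vol : ⋀[ℂ]^5 V₅ ≃ₗ[ℂ] ℂ) (W : Submodule ℂ (⋀[ℂ]^2 V₅))
    (γ : LinearMap.BilinForm ℂ W) : Set (W → ℂ) :=
  insert (fun w => γ w w) (Set.range fun v : V₅ => fun w : W => pfaffian vol v w w)

/-- The scheme `ℙ(W) ∩ G(2, V₅) ∩ Q` is a smooth ordinary Gushel-Mukai variety of dimension `n`: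
`dim W = n + 5`, and the scheme is irreducible, of dimension `n`, and smooth (all its Zariski tangent
spaces have dimension `n`; in particular it is reduced). -/
structure IsSmoothGM (vol : ⋀[ℂ]^5 V₅ ≃ₗ[ℂ] ℂ) (W : Submodule ℂ (⋀[ℂ]^2 V₅))
    (γ : LinearMap.BilinForm ℂ W) (n : ℕ) : Prop where
  finrank_eq : finrank ℂ W = n + 5
  isIrreducible : IsIrreducible (gmLocus W γ)
  dim_eq : topologicalKrullDim (gmLocus W γ) = n
  smooth : ∀ p ∈ gmLocus W γ,
    finrank ℂ (coneTangentSpace (gmEquations vol W γ) p.rep) = n + 1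

/-- The element `η + x ∧ w` of `⋀³ V₆`, where `V₆ = V₅ ⊕ ℂ x` with `x = (0, 1)`, for `η ∈ ⋀³ V₅` and
`w ∈ ⋀² V₅`. It is an element of the exterior algebra of `V₆`. -/
def addWedge : (⋀[ℂ]^3 V₅ × ⋀[ℂ]^2 V₅) →ₗ[ℂ] ExteriorAlgebra ℂ (V₅ × ℂ) :=
  LinearMap.coprod
    ((ExteriorAlgebra.map (LinearMap.inl ℂ V₅ ℂ)).toLinearMap ∘ₗ (⋀[ℂ]^3 V₅).subtype)
    (LinearMap.mulLeft ℂ (ExteriorAlgebra.ι ℂ ((0, 1) : V₅ × ℂ)) ∘ₗ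
      (ExteriorAlgebra.map (LinearMap.inl ℂ V₅ ℂ)).toLinearMap ∘ₗ (⋀[ℂ]^2 V₅).subtype)

/-- The Lagrangian subspace of `⋀³ V₆` associated to `ℙ(W) ∩ G(2, V₅) ∩ Q`. Here
`V₆ = V₅ ⊕ ℂ x` is the space of quadrics through the Gushel-Mukai variety, with `v ∈ V₅`
corresponding to `P_v` and `x` to `γ`, and
`A = {η + x ∧ w | η ∈ ⋀³ V₅, w ∈ W, vol(η ∧ w') = -γ(w, w') for all w' ∈ W}`. -/
def gmLagrangian (vol : ⋀[ℂ]^5 V₅ ≃ₗ[ℂ] ℂ) (W : Submodule ℂ (⋀[ℂ]^2 V₅))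
    (γ : LinearMap.BilinForm ℂ W) : Submodule ℂ (ExteriorAlgebra ℂ (V₅ × ℂ)) :=
  Submodule.map (addWedge ∘ₗ LinearMap.prodMap LinearMap.id W.subtype)
    ({ carrier := {a : ⋀[ℂ]^3 V₅ × W | ∀ w' : W, vol (wedge a.1 (w' : ⋀[ℂ]^2 V₅)) = -γ a.2 w'}
       add_mem' := by
        intro a b ha hb w'
        have h1 := ha w'
        have h2 := hb w'
        simp only [Prod.fst_add, Prod.snd_add, map_add, LinearMap.add_apply, h1, h2]
        ring
       zero_mem' := by
        intro w'
        simp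
       smul_mem' := by
        intro c a ha w'
        have h1 := ha w'
        simp only [Prod.smul_fst, Prod.smul_snd, map_smul, LinearMap.smul_apply, h1, smul_neg] } :
      Submodule ℂ (⋀[ℂ]^3 V₅ × W))

variable (V₅) in
/-- The hyperplane `ℙ(V₅)` of `ℙ(V₆)`, for `V₆ = V₅ ⊕ ℂ`. -/
def pluckerHyperplane : Set (ℙ ℂ (V₅ × ℂ)) :=
  {p | p.rep ∈ LinearMap.range (LinearMap.inl ℂ V₅ ℂ)}

end GushelMukai

end

/-! Write a point of the stratum off `ℙ(V₅)` as `[(u, c)]` with `c ≠ 0` and put `v₀ = u / c`. The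
fibre `F_v` is parametrized by `w ↦ (u, c) ∧ w`, `w ∈ ⋀² V₅`, and this vector lies in `A(S)` exactly
when `w` lies in `W` and in the kernel of `B = γ + P_{v₀}` (`finrank_ker_gmForm`). So `B` has a
kernel of dimension three on the seven-dimensional `W`: it has rank four. The Pfaffian forms vanish
on the Grassmannian, hence `S` is also the section of `G(2, V₅)` by the quadric `B = 0`. The vertex
`ℙ(ker B)` misses the Grassmannian, since at a common point the equation of `Q` would be redundant
to first order and the tangent space of `S` too large (`eq_zero_of_mem_ker_gmForm`).

Over `ℂ` one has `B = L₀ L₃ - L₁ L₂`, so the quadric is swept out by the spaces `{L₀ = t L₁, L₂ = t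
L₃} ≅ ℙ⁴` through the vertex, and `[L₀ : L₁] = [L₂ : L₃]` is a morphism on all of `S`. As `B`
vanishes on these spaces, the fibre over `[t : 1]` is a section of `G(2, V₅)` by a `ℙ⁴`. If its
tangent space is too large at some point, then `t` is a critical value of `L₀ / L₁` or `L₂ / L₃` on
`S`. Critical values are finite in number by an algebraic form of Sard's theorem: a function with
zero differential is algebraic over `ℂ` (`finite_critical_values`).

It remains to see that the other fibres are smooth elliptic quintics. Such a fibre is cut out by the
Pfaffians of an alternating `5 × 5` matrix of linear forms, without common zero on the vertex plane.
On that plane the Pfaffian (Buchsbaum-Eisenbud) complex is exact and the quotient ring has Hilbert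
function `1, 3, 1`. Since syzygies lift, the homogeneous coordinate ring of the fibre is free over
the polynomial ring in the two remaining variables, on generators of degrees `0, 1, 1, 1, 2`
(`exists_basis_quotient_pfaffianIdeal`). This gives the Hilbert function `5 n` for `n ≥ 2`, hence
degree `5` and genus `1`, and supplies regular sequences of length two. Together with the tangent
space bound these make the local rings off the origin domains; depth two and the absence of
idempotents then make the whole ring a domain, by a Hartshorne-style connectedness argument
(`noZeroDivisors_of_annihilators`). So the Pfaffian ideal is prime and is the full vanishing ideal
of the fibre, which yields irreducibility and smoothness. -/

section CriticalValues

/-! ### Algebraic Sard: finiteness of critical values. -/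

open Polynomial TensorProduct

/-- In a finite extension `F` of `k(X)`, in characteristic zero, the differential of `X` over `k` is
not zero. -/
theorem KaehlerDifferential.D_algebraMap_X_ne_zero {k F : Type*} [Field k] [CharZero k] [Field F]
    [Algebra k F] [Algebra k[X] F] [IsScalarTower k k[X] F] [Algebra (FractionRing k[X]) F]
    [IsScalarTower k[X] (FractionRing k[X]) F] [FiniteDimensional (FractionRing k[X]) F] :
    KaehlerDifferential.D k F (algebraMap k[X] F X) ≠ 0 := by
  have : CharZero (FractionRing k[X]) := charZero_of_injective_algebraMap
    (FaithfulSMul.algebraMap_injective k[X] (FractionRing k[X]))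
  have : Algebra.FormallyEtale k[X] (FractionRing k[X]) :=
    Algebra.FormallyEtale.of_isLocalization (nonZeroDivisors k[X])
  have : Algebra.FormallyEtale (FractionRing k[X]) F := Algebra.FormallyEtale.of_isSeparable _ _
  have : Algebra.FormallyEtale k[X] F :=
    Algebra.FormallyEtale.comp k[X] (FractionRing k[X]) F
  intro h
  have h1 := KaehlerDifferential.tensorKaehlerEquivOfFormallyEtale_symm_D_algebraMap k k[X] F X
  rw [h, map_zero] at h1
  have h2 := congrArg (LinearMap.liftBaseChange F
    ((Algebra.linearMap k[X] F) ∘ₗ (KaehlerDifferential.polynomialEquiv k).toLinearMap)) h1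
  simp at h2

/-- In an algebra of finite type over a field of characteristic zero, an element with zero
differential is algebraic over the field. -/
theorem exists_aeval_eq_zero_of_D_eq_zero {k Q : Type*} [Field k] [CharZero k] [CommRing Q]
    [Algebra k Q] [Algebra.FiniteType k Q] (h : Q) (hD : KaehlerDifferential.D k Q h = 0) :
    ∃ G : k[X], G ≠ 0 ∧ aeval h G = 0 := by
  by_contra! hG
  let _ : Algebra k[X] Q := (aeval h).toRingHom.toAlgebra
  have hmap : ∀ G : k[X], algebraMap k[X] Q G = aeval h G := fun _ => rfl
  have : IsScalarTower k k[X] Q := IsScalarTower.of_algebraMap_eq fun r => by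
    rw [hmap, Polynomial.algebraMap_apply, aeval_C]; rfl
  -- Let `X` act as `h`. Without algebraic relations `k[X]` embeds in `Q`, so by flatness the
  -- generic fibre is nonzero. The residue field of one of its maximal ideals is finite over `k(X)`
  -- (Nullstellensatz), and there the zero differential of `h` becomes that of `X`, which is
  -- nonzero.
  have hinj : Function.Injective (algebraMap k[X] Q) :=
    (injective_iff_map_eq_zero _).2 fun G hG0 => by_contra fun hne => hG G hne hG0
  let K := FractionRing k[X]
  have : Algebra.FiniteType k[X] Q := Algebra.FiniteType.of_restrictScalars_finiteType k k[X] Q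
  have hnt : Nontrivial (K ⊗[k[X]] Q) := by
    have h1 : Function.Injective ((Algebra.linearMap k[X] Q).lTensor K) :=
      Module.Flat.lTensor_preserves_injective_linearMap _ hinj
    have h2 : Nontrivial (K ⊗[k[X]] k[X]) := (TensorProduct.rid k[X] K).toEquiv.nontrivial
    exact h1.nontrivial
  obtain ⟨m, hm⟩ := Ideal.exists_maximal (K ⊗[k[X]] Q)
  let F := (K ⊗[k[X]] Q) ⧸ m
  let _ : Field F := Ideal.Quotient.field m
  have : Module.Finite K F := finite_of_finite_type_of_isJacobsonRing K F
  let φ : Q →ₐ[k[X]] F := (IsScalarTower.toAlgHom k[X] (K ⊗[k[X]] Q) F).comp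
    Algebra.TensorProduct.includeRight
  refine KaehlerDifferential.D_algebraMap_X_ne_zero (k := k) (F := F) ?_
  let _ : Algebra Q F := φ.toRingHom.toAlgebra
  have : IsScalarTower k Q F := IsScalarTower.of_algebraMap_eq fun r => 
    ((φ.restrictScalars k).commutes r).symm
  have h3 := KaehlerDifferential.map_D k k Q F h
  rw [hD, map_zero] at h3
  have h4 : algebraMap Q F h = algebraMap k[X] F X := by
    have := φ.commutes X
    rw [hmap, aeval_X] at this
    exact this
  rw [← h4, ← h3]

/-- The computation behind `finite_critical_values`: at a point with values in an algebra `A` where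
`a - h b` is a combination of the differentials of the quadrics, every derivation kills `h`. -/
theorem Derivation.apply_eq_zero_of_critical {m n A N : Type*} [Fintype m] [Fintype n] [CommRing A]
    [Algebra ℂ A] [AddCommGroup N] [Module A N] [Module ℂ N] [IsScalarTower ℂ A N]
    (D : Derivation ℂ A N) (B : m → n → n → ℂ) (hB : ∀ i j l, B i j l = B i l j) (a b : n → ℂ)
    (x : n → A) (c : m → A) (h1 : ∀ i, ∑ j, ∑ l, B i j l • (x j * x l) = 0)
    (h2 : ∑ j, b j • x j = 1)
    (h3 : ∀ l, algebraMap ℂ A (a l) - b l • ∑ j, a j • x j = ∑ i, c i * ∑ j, B i j l • x j) :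
    D (∑ j, a j • x j) = 0 := by
  have e1 : ∀ i, ∑ l, (∑ j, B i j l • x j) • D (x l) = 0 := by
    intro i
    have h := congrArg D (h1 i)
    simp only [map_sum, map_smul, Derivation.leibniz, map_zero, smul_add,
      Finset.sum_add_distrib] at h
    rw [Finset.sum_comm] at h
    have h4 : ∑ j, ∑ l, B i j l • x l • D (x j) = ∑ l, ∑ j, B i j l • x j • D (x l) :=
      Finset.sum_congr rfl fun j _ => Finset.sum_congr rfl fun l _ => by rw [hB]
    rw [h4, ← two_smul ℂ, smul_eq_zero_iff_right two_ne_zero] at h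
    simpa only [Finset.sum_smul, smul_assoc] using h
  have e2 : ∑ j, b j • D (x j) = 0 := by
    have h := congrArg D h2
    simpa using h
  have e3 : D (∑ j, a j • x j)
      = ∑ l, (algebraMap ℂ A (a l) - b l • ∑ j, a j • x j) • D (x l) := by
    have : ∑ l, b l • (∑ j, a j • x j) • D (x l) = (∑ j, a j • x j) • ∑ l, b l • D (x l) := by
      rw [Finset.smul_sum]
      exact Finset.sum_congr rfl fun l _ => (smul_algebra_smul_comm _ _ _).symm
    simp only [sub_smul, Finset.sum_sub_distrib, smul_assoc, algebraMap_smul]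
    rw [this, e2, smul_zero, sub_zero]
    simp
  rw [e3]
  simp only [h3, Finset.sum_smul, mul_smul]
  rw [Finset.sum_comm]
  refine Finset.sum_eq_zero fun i _ => ?_
  rw [← Finset.smul_sum]
  simp only [← Finset.sum_smul, e1, smul_zero]

/-- The critical values of the function `a / b` on a projective variety cut out by quadrics, in the
chart `b = 1`, are finite in number. -/
theorem finite_critical_values {m n : Type*} [Fintype m] [Fintype n] (B : m → n → n → ℂ)
    (hB : ∀ i j l, B i j l = B i l j) (a b : n → ℂ) :
    {t : ℂ | ∃ (p : n → ℂ) (c : m → ℂ), (∀ i, ∑ j, ∑ l, B i j l * (p j * p l) = 0) ∧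
      ∑ j, b j * p j = 1 ∧ ∑ j, a j * p j = t ∧
      ∀ l, a l - b l * t = ∑ i, c i * ∑ j, B i j l * p j}.Finite := by
  let x : n → MvPolynomial (n ⊕ m) ℂ := fun j => MvPolynomial.X (Sum.inl j)
  let c : m → MvPolynomial (n ⊕ m) ℂ := fun j => MvPolynomial.X (Sum.inr j)
  let e1 : m → MvPolynomial (n ⊕ m) ℂ := fun i => ∑ j, ∑ l, B i j l • (x j * x l)
  let e2 : MvPolynomial (n ⊕ m) ℂ := ∑ j, b j • x j - 1
  let e3 : n → MvPolynomial (n ⊕ m) ℂ := fun l =>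
    algebraMap ℂ _ (a l) - b l • ∑ j, a j • x j - ∑ i, c i * ∑ j, B i j l • x j
  -- The ideal of the incidence scheme of critical points and Lagrange multipliers, with the value
  -- `t` replaced by the function `∑ aⱼ xⱼ`. This function has zero differential there, so it is a
  -- root of a single polynomial `G`, and the critical values are among the roots of `G`.
  let J : Ideal (MvPolynomial (n ⊕ m) ℂ) := Ideal.span (Set.range e1 ∪ {e2} ∪ Set.range e3)
  let π := Ideal.Quotient.mkₐ ℂ J
  have hπ : ∀ y ∈ Set.range e1 ∪ {e2} ∪ Set.range e3, π y = 0 := fun y hy =>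
    Ideal.Quotient.eq_zero_iff_mem.2 (Ideal.subset_span hy)
  have hD := (KaehlerDifferential.D ℂ (MvPolynomial (n ⊕ m) ℂ ⧸ J)).apply_eq_zero_of_critical B hB
    a b (fun j => π (x j)) (fun i => π (c i))
    (fun i => by simpa only [e1, map_sum, map_smul, map_mul] using hπ (e1 i) (by simp))
    (by
      have := hπ e2 (by simp)
      simpa only [e2, map_sub, map_sum, map_smul, map_one, sub_eq_zero] using this)
    (fun l => by
      have := hπ (e3 l) (by simp)
      simpa only [e3, map_sub, map_sum, map_smul, map_mul, AlgHom.commutes, sub_eq_zero] using this)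
  obtain ⟨G, hG0, hG⟩ := exists_aeval_eq_zero_of_D_eq_zero _ hD
  refine (G.roots.toFinset.finite_toSet).subset ?_
  rintro t ⟨p, d, hp1, hp2, hp3, hp4⟩
  let ev := MvPolynomial.aeval (R := ℂ) (Sum.elim p d)
  have hx : ∀ j, ev (x j) = p j := fun j => MvPolynomial.aeval_X _ _
  have hc : ∀ j, ev (c j) = d j := fun j => MvPolynomial.aeval_X _ _
  have hJ : ∀ y ∈ J, ev y = 0 := by
    intro y hy
    have : J ≤ RingHom.ker ev := by
      refine Ideal.span_le.2 ?_
      rintro y ((⟨i, rfl⟩ | rfl) | ⟨i, rfl⟩) <;> refine RingHom.mem_ker.2 ?_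
      · simp only [e1, map_sum, map_smul, map_mul, hx, smul_eq_mul, hp1]
      · simp only [e2, map_sub, map_sum, map_smul, map_one, hx, smul_eq_mul, hp2, sub_self]
      · simp only [e3, map_sub, map_sum, map_smul, map_mul, AlgHom.commutes, hx, hc, smul_eq_mul,
          hp3, ← hp4, Algebra.algebraMap_self, RingHom.id_apply, sub_self]
    exact this hy
  let ψ : (MvPolynomial (n ⊕ m) ℂ ⧸ J) →ₐ[ℂ] ℂ := Ideal.Quotient.liftₐ J ev hJ
  have hψ : ∀ j, ψ (π (x j)) = p j := hx
  have := congrArg ψ hG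
  rw [← aeval_algHom_apply, map_zero] at this
  simp only [map_sum, map_smul, hψ, smul_eq_mul, hp3] at this
  simpa [hG0, IsRoot, coe_aeval_eq_eval] using this

end CriticalValues

/-! ### Exactness of the Pfaffian complex of an alternating 5 × 5 matrix. -/

section Pfaffians

open Matrix

variable {A : Type*} [CommRing A]

/-- A matrix is alternating: skew-symmetric with zero diagonal. -/
def Matrix.IsAlternating {n : Type*} (M : Matrix n n A) : Prop :=
  (∀ i, M i i = 0) ∧ ∀ i j, M j i = -M i j

/-- The bilinear map whose diagonal is twice the vector of the signed `4 × 4` Pfaffians of an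
alternating `5 × 5` matrix. -/
def Matrix.pfaffianPolar (M N : Matrix (Fin 5) (Fin 5) A) : Fin 5 → A :=
  ![M 1 2 * N 3 4 - M 1 3 * N 2 4 + M 1 4 * N 2 3 + M 3 4 * N 1 2 - M 2 4 * N 1 3 + M 2 3 * N 1 4,
    -(M 0 2 * N 3 4 - M 0 3 * N 2 4 + M 0 4 * N 2 3 + M 3 4 * N 0 2 - M 2 4 * N 0 3
      + M 2 3 * N 0 4),
    M 0 1 * N 3 4 - M 0 3 * N 1 4 + M 0 4 * N 1 3 + M 3 4 * N 0 1 - M 1 4 * N 0 3 + M 1 3 * N 0 4,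
    -(M 0 1 * N 2 4 - M 0 2 * N 1 4 + M 0 4 * N 1 2 + M 2 4 * N 0 1 - M 1 4 * N 0 2
      + M 1 2 * N 0 4),
    M 0 1 * N 2 3 - M 0 2 * N 1 3 + M 0 3 * N 1 2 + M 2 3 * N 0 1 - M 1 3 * N 0 2 + M 1 2 * N 0 3]

/-- The signed `4 × 4` Pfaffians of an alternating `5 × 5` matrix. -/
def Matrix.pfaffians (M : Matrix (Fin 5) (Fin 5) A) : Fin 5 → A :=
  ![M 1 2 * M 3 4 - M 1 3 * M 2 4 + M 1 4 * M 2 3,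
    -(M 0 2 * M 3 4 - M 0 3 * M 2 4 + M 0 4 * M 2 3),
    M 0 1 * M 3 4 - M 0 3 * M 1 4 + M 0 4 * M 1 3,
    -(M 0 1 * M 2 4 - M 0 2 * M 1 4 + M 0 4 * M 1 2),
    M 0 1 * M 2 3 - M 0 2 * M 1 3 + M 0 3 * M 1 2]

/-- The Pfaffian adjoint of the `4 × 4` alternating matrix obtained by deleting the row and column
`j`, with zeros put back there. -/
def Matrix.pfaffianAdjugate (M : Matrix (Fin 5) (Fin 5) A) :
    Fin 5 → Matrix (Fin 5) (Fin 5) A :=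
  ![!![0, 0, 0, 0, 0;
      0, 0, -M 3 4, M 2 4, -M 2 3;
      0, M 3 4, 0, -M 1 4, M 1 3;
      0, -M 2 4, M 1 4, 0, -M 1 2;
      0, M 2 3, -M 1 3, M 1 2, 0],
    -!![0, 0, -M 3 4, M 2 4, -M 2 3;
      0, 0, 0, 0, 0;
      M 3 4, 0, 0, -M 0 4, M 0 3;
      -M 2 4, 0, M 0 4, 0, -M 0 2;
      M 2 3, 0, -M 0 3, M 0 2, 0],
    !![0, -M 3 4, 0, M 1 4, -M 1 3;
      M 3 4, 0, 0, -M 0 4, M 0 3;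
      0, 0, 0, 0, 0;
      -M 1 4, M 0 4, 0, 0, -M 0 1;
      M 1 3, -M 0 3, 0, M 0 1, 0],
    -!![0, -M 2 4, M 1 4, 0, -M 1 2;
      M 2 4, 0, -M 0 4, 0, M 0 2;
      -M 1 4, M 0 4, 0, 0, -M 0 1;
      0, 0, 0, 0, 0;
      M 1 2, -M 0 2, M 0 1, 0, 0],
    !![0, -M 2 3, M 1 3, -M 1 2, 0;
      M 2 3, 0, -M 0 3, M 0 2, 0;
      -M 1 3, M 0 3, 0, -M 0 1, 0;
      M 1 2, -M 0 2, M 0 1, 0, 0;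
      0, 0, 0, 0, 0]]

theorem Matrix.pfaffianPolar_self (M : Matrix (Fin 5) (Fin 5) A) :
    pfaffianPolar M M = 2 • pfaffians M := by
  ext i; fin_cases i <;> simp [pfaffianPolar, pfaffians] <;> ring

theorem Matrix.pfaffians_add (M N : Matrix (Fin 5) (Fin 5) A) :
    pfaffians (M + N) = pfaffians M + pfaffianPolar M N + pfaffians N := by
  ext i; fin_cases i <;> simp [pfaffianPolar, pfaffians] <;> ring

theorem Matrix.pfaffians_smul (c : A) (M : Matrix (Fin 5) (Fin 5) A) :
    pfaffians (c • M) = c ^ 2 • pfaffians M := by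
  ext i; fin_cases i <;> simp [pfaffians] <;> ring

theorem Matrix.pfaffians_map {B : Type*} [CommRing B] (f : A →+* B)
    (M : Matrix (Fin 5) (Fin 5) A) (i : Fin 5) :
    pfaffians (M.map f) i = f (pfaffians M i) := by
  fin_cases i <;> simp [pfaffians]

theorem Matrix.pfaffianPolar_map {B : Type*} [CommRing B] (f : A →+* B)
    (M N : Matrix (Fin 5) (Fin 5) A) (i : Fin 5) :
    pfaffianPolar (M.map f) (N.map f) i = f (pfaffianPolar M N i) := by
  fin_cases i <;> simp [pfaffianPolar]

theorem Matrix.mulVec_pfaffians {M : Matrix (Fin 5) (Fin 5) A} (hM : M.IsAlternating) :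
    M *ᵥ pfaffians M = 0 := by
  obtain ⟨h0, h⟩ := hM
  ext i; fin_cases i <;>
    simp [pfaffians, mulVec, dotProduct, Fin.sum_univ_five, h0, h 0 1, h 0 2, h 0 3, h 0 4, h 1 2,
      h 1 3, h 1 4, h 2 3, h 2 4, h 3 4] <;> ring

/-- A contracting homotopy up to the factor `pfaffians M j`: when `z` is a syzygy of the Pfaffians,
it exhibits `pfaffians M j • z` in the image of `M`. -/
theorem Matrix.mulVec_pfaffianAdjugate_mulVec {M : Matrix (Fin 5) (Fin 5) A}
    (hM : M.IsAlternating) (j : Fin 5) (z : Fin 5 → A) :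
    M *ᵥ (pfaffianAdjugate M j *ᵥ z)
      = pfaffians M j • z - (pfaffians M ⬝ᵥ z) • Pi.single j 1 := by
  obtain ⟨h0, h⟩ := hM
  fin_cases j <;> ext a <;> fin_cases a <;>
    simp [pfaffians, pfaffianAdjugate, mulVec, dotProduct, Fin.sum_univ_five, h0, h 0 1, h 0 2,
      h 0 3, h 0 4, h 1 2, h 1 3, h 1 4, h 2 3, h 2 4, h 3 4] <;> ring

/-- Pairing the homotopy identity with `u` kills its left side, because `M` is skew. Thus a kernel
vector is proportional to the vector of Pfaffians. -/
theorem Matrix.pfaffians_mul_of_mulVec_eq_zero {M : Matrix (Fin 5) (Fin 5) A}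
    (hM : M.IsAlternating) {u : Fin 5 → A} (hu : M *ᵥ u = 0) (i j : Fin 5) :
    pfaffians M i * u j = pfaffians M j * u i := by
  have hT : Mᵀ = -M := by ext a b; simp [hM.2 a b]
  have h1 : u ᵥ* M = 0 := by rw [← mulVec_transpose, hT, neg_mulVec, hu, neg_zero]
  have h2 := congrArg (fun v => u ⬝ᵥ v) (mulVec_pfaffianAdjugate_mulVec hM j (Pi.single i 1))
  simp only [dotProduct_mulVec, h1, zero_vecMul, dotProduct_sub, dotProduct_smul,
    dotProduct_single, mul_one, smul_eq_mul, Pi.zero_apply] at h2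
  linear_combination h2

/-- Exactness of the Pfaffian complex at its left end. -/
theorem Matrix.exists_eq_smul_pfaffians [IsDomain A] {M : Matrix (Fin 5) (Fin 5) A}
    (hM : M.IsAlternating) {f₁ f₂ : A} (h0 : f₁ ≠ 0)
    (hf₁ : f₁ ∈ Ideal.span (Set.range (pfaffians M)))
    (hf₂ : f₂ ∈ Ideal.span (Set.range (pfaffians M)))
    (h12 : ∀ g, f₁ ∣ f₂ * g → f₁ ∣ g) {u : Fin 5 → A} (hu : M *ᵥ u = 0) :
    ∃ g : A, u = g • pfaffians M := by
  have key : ∀ f ∈ Ideal.span (Set.range (pfaffians M)), ∃ g : A, f • u = g • pfaffians M := by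
    intro f hf
    obtain ⟨a, rfl⟩ := Ideal.mem_span_range_iff_exists_fun.1 hf
    refine ⟨∑ i, a i * u i, ?_⟩
    ext j
    simp only [Pi.smul_apply, smul_eq_mul, Finset.sum_mul]
    refine Finset.sum_congr rfl fun i _ => ?_
    rw [mul_assoc, mul_assoc, pfaffians_mul_of_mulVec_eq_zero hM hu i j, mul_comm (u i)]
  obtain ⟨g₁, h1⟩ := key f₁ hf₁
  obtain ⟨g₂, h2⟩ := key f₂ hf₂
  obtain ⟨i, hi⟩ : ∃ i, pfaffians M i ≠ 0 := by
    by_contra! h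
    refine h0 ?_
    have : pfaffians M = 0 := funext h
    -- Next, `f₁ u = g₁ Pf` and `f₂ u = g₂ Pf` force `f₂ g₁ = f₁ g₂`, so `f₁` divides `g₁`, and the
    -- quotient is the required factor.
    simpa [this] using hf₁
  have h3 : f₂ * g₁ = f₁ * g₂ := by
    have e1 := congrFun h1 i
    have e2 := congrFun h2 i
    simp only [Pi.smul_apply, smul_eq_mul] at e1 e2
    refine mul_right_cancel₀ hi ?_
    linear_combination f₁ * e2 - f₂ * e1
  obtain ⟨g, rfl⟩ := h12 g₁ ⟨g₂, h3⟩
  refine ⟨g, ?_⟩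
  rw [mul_smul] at h1
  exact smul_right_injective _ h0 h1

/-- Exactness of the Pfaffian complex in the middle: the syzygies of the Pfaffians are generated by
the rows of the matrix, if the ideal of Pfaffians contains a regular sequence of length three. -/
theorem Matrix.exists_eq_mulVec_of_dotProduct_eq_zero [IsDomain A] {M : Matrix (Fin 5) (Fin 5) A}
    (hM : M.IsAlternating) {f₁ f₂ f₃ : A} (h0 : f₁ ≠ 0)
    (hf₁ : f₁ ∈ Ideal.span (Set.range (pfaffians M)))
    (hf₂ : f₂ ∈ Ideal.span (Set.range (pfaffians M)))
    (hf₃ : f₃ ∈ Ideal.span (Set.range (pfaffians M)))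
    (h12 : ∀ g, f₁ ∣ f₂ * g → f₁ ∣ g)
    (h123 : ∀ g, f₃ * g ∈ Ideal.span {f₁, f₂} → g ∈ Ideal.span {f₁, f₂}) {z : Fin 5 → A}
    (hz : pfaffians M ⬝ᵥ z = 0) : ∃ w, z = M *ᵥ w := by
  have key : ∀ f ∈ Ideal.span (Set.range (pfaffians M)), ∃ w, f • z = M *ᵥ w := by
    intro f hf
    obtain ⟨a, rfl⟩ := Ideal.mem_span_range_iff_exists_fun.1 hf
    refine ⟨∑ i, a i • (pfaffianAdjugate M i *ᵥ z), ?_⟩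
    simp only [mulVec_sum, mulVec_smul, mulVec_pfaffianAdjugate_mulVec hM, hz, zero_smul, sub_zero,
      Finset.sum_smul, mul_smul]
  obtain ⟨u₁, h1⟩ := key f₁ hf₁
  obtain ⟨u₂, h2⟩ := key f₂ hf₂
  -- Dividing `f₁ z = M u₁` by `f₁` requires changing `u₁` by a kernel vector of `M`. The defect `f₂
  -- u₁ - f₁ u₂` is `g Pf`, and all `Pfᵢ g` lie in `(f₁, f₂)`; regularity of `f₃` modulo `(f₁, f₂)`
  -- gives `g = b f₁ + c f₂`, whence `f₁ ∣ u₁ - c Pf`.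
  have h3 : M *ᵥ (f₂ • u₁ - f₁ • u₂) = 0 := by
    rw [mulVec_sub, mulVec_smul, mulVec_smul, ← h1, ← h2, smul_comm, sub_self]
  obtain ⟨g, hg⟩ := exists_eq_smul_pfaffians hM h0 hf₁ hf₂ h12 h3
  have h4 : ∀ i, pfaffians M i * g ∈ Ideal.span {f₁, f₂} := by
    intro i
    have e := congrFun hg i
    simp only [Pi.sub_apply, Pi.smul_apply, smul_eq_mul] at e
    rw [mul_comm, ← e]
    exact sub_mem (Ideal.mul_mem_right _ _ (Ideal.subset_span (by simp)))
      (Ideal.mul_mem_right _ _ (Ideal.subset_span (by simp)))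
  have h5 : f₃ * g ∈ Ideal.span {f₁, f₂} := by
    obtain ⟨a, rfl⟩ := Ideal.mem_span_range_iff_exists_fun.1 hf₃
    rw [Finset.sum_mul]
    refine Ideal.sum_mem _ fun i _ => ?_
    rw [mul_assoc]
    exact Ideal.mul_mem_left _ _ (h4 i)
  obtain ⟨b, c, hbc⟩ := Ideal.mem_span_pair.1 (h123 g h5)
  have h6 : ∀ i, f₁ ∣ u₁ i - c * pfaffians M i := by
    intro i
    refine h12 _ ⟨u₂ i + b * pfaffians M i, ?_⟩
    have e := congrFun hg i
    simp only [Pi.sub_apply, Pi.smul_apply, smul_eq_mul] at e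
    linear_combination e - pfaffians M i * hbc
  choose w hw using h6
  refine ⟨w, smul_right_injective _ h0 ?_⟩
  have h7 : u₁ - c • pfaffians M = f₁ • w := funext hw
  simp only
  rw [h1, ← mulVec_smul, ← h7, mulVec_sub, mulVec_smul, mulVec_pfaffians hM, smul_zero, sub_zero]

end Pfaffians

/-! ### Powers of variables form regular sequences. -/

section RegularSequence

open MvPolynomial

theorem MvPolynomial.X_pow_dvd_of_dvd_X_pow_mul {σ k : Type*} [Field k] {i j : σ} (hij : i ≠ j)
    (n : ℕ) (g : MvPolynomial σ k) (h : (X i : MvPolynomial σ k) ^ n ∣ X j ^ n * g) :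
    (X i : MvPolynomial σ k) ^ n ∣ g := by
  refine IsRelPrime.dvd_of_dvd_mul_left (IsRelPrime.pow ?_) h
  refine (Prime.irreducible (X_prime (i := i))).isRelPrime_iff_not_dvd.2 ?_
  rw [X_dvd_X]
  simpa using hij

/-- Membership in a monomial ideal is tested on exponents, and multiplication by a power of `X l`
leaves the exponents of `X i` and `X j` unchanged. -/
theorem MvPolynomial.mem_span_X_pow_of_X_pow_mul_mem {σ k : Type*} [Field k] {i j l : σ}
    (hi : l ≠ i) (hj : l ≠ j) (n : ℕ) (g : MvPolynomial σ k)
    (h : X l ^ n * g ∈ Ideal.span {(X i : MvPolynomial σ k) ^ n, X j ^ n}) :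
    g ∈ Ideal.span {(X i : MvPolynomial σ k) ^ n, X j ^ n} := by
  have e : ({(X i : MvPolynomial σ k) ^ n, X j ^ n} : Set _)
      = (fun s => monomial s (1 : k)) '' {Finsupp.single i n, Finsupp.single j n} := by
    simp [Set.image_pair, X_pow_eq_monomial]
  rw [e, mem_ideal_span_monomial_image] at h ⊢
  intro d hd
  obtain ⟨s, hs, hsd⟩ := h (Finsupp.single l n + d) (by
    rw [mem_support_iff, X_pow_eq_monomial, coeff_monomial_mul, one_mul]
    exact mem_support_iff.1 hd)
  refine ⟨s, hs, ?_⟩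
  rcases hs with rfl | rfl <;> rw [Finsupp.single_le_iff] at hsd ⊢ <;>
    simpa [Finsupp.single_apply, hi, hj] using hsd

end RegularSequence

/-! ### Homogeneous components and dimensions of spaces of forms. -/

section HomogeneousPolynomials

open MvPolynomial

theorem MvPolynomial.homogeneousComponent_add_mul {σ k : Type*} [CommRing k]
    {φ : MvPolynomial σ k} {m : ℕ} (hφ : φ.IsHomogeneous m) (n : ℕ) (ψ : MvPolynomial σ k) :
    homogeneousComponent (m + n) (φ * ψ) = φ * homogeneousComponent n ψ := by
  conv_lhs => rw [← sum_homogeneousComponent ψ]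
  rw [Finset.mul_sum, map_sum]
  have h : ∀ i, homogeneousComponent (m + n) (φ * homogeneousComponent i ψ)
      = if n = i then φ * homogeneousComponent i ψ else 0 := by
    intro i
    rw [homogeneousComponent_of_mem
      ((mem_homogeneousSubmodule _ _).2 (hφ.mul (homogeneousComponent_isHomogeneous i ψ)))]
    simp
  simp only [h, Finset.sum_ite_eq, Finset.mem_range]
  split_ifs with hn
  · rfl
  · rw [homogeneousComponent_eq_zero _ _ (by omega), mul_zero]

theorem MvPolynomial.homogeneousComponent_mul_eq_zero {σ k : Type*} [CommRing k]
    {φ : MvPolynomial σ k} {m : ℕ} (hφ : φ.IsHomogeneous m) {n : ℕ} (hn : n < m)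
    (ψ : MvPolynomial σ k) : homogeneousComponent n (φ * ψ) = 0 := by
  conv_lhs => rw [← sum_homogeneousComponent ψ]
  rw [Finset.mul_sum, map_sum]
  refine Finset.sum_eq_zero fun i _ => ?_
  rw [homogeneousComponent_of_mem
    ((mem_homogeneousSubmodule _ _).2 (hφ.mul (homogeneousComponent_isHomogeneous i ψ)))]
  rw [if_neg (by omega)]

instance MvPolynomial.finite_homogeneousSubmodule {σ k : Type*} [CommRing k] [Finite σ] (n : ℕ) :
    Module.Finite k (homogeneousSubmodule σ k n) :=
  Module.Finite.iff_fg.2 (homogeneousSubmodule_fg σ k n)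

theorem MvPolynomial.finrank_homogeneousSubmodule (k : Type*) [Field k] (r n : ℕ) :
    finrank k (homogeneousSubmodule (Fin r) k n) = (Finset.Nat.antidiagonalTuple r n).card := by
  have e : homogeneousSubmodule (Fin r) k n = restrictSupport k {d | d.degree = n} :=
    homogeneousSubmodule_eq_finsupp_supported _ _ n
  rw [e, finrank_eq_nat_card_basis (basisRestrictSupport k _), ← Nat.card_eq_finsetCard]
  refine Nat.card_congr (Finsupp.equivFunOnFinite.subtypeEquiv fun d => ?_)
  simp [Finset.Nat.mem_antidiagonalTuple, Finsupp.degree_eq_sum]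

end HomogeneousPolynomials

/-! ### Alternating matrices of linear forms and their Pfaffian ideals. -/

section LinearMatrices

open MvPolynomial Matrix

variable {σ : Type*} [Fintype σ]

/-- The matrix of linear forms `∑ Xₗ Nₗ`. -/
noncomputable def linearMatrix (N : σ → Matrix (Fin 5) (Fin 5) ℂ) :
    Matrix (Fin 5) (Fin 5) (MvPolynomial σ ℂ) :=
  ∑ l, (X l : MvPolynomial σ ℂ) • (N l).map C

/-- The matrix `∑ xₗ Nₗ`. -/
noncomputable def evalMatrix (N : σ → Matrix (Fin 5) (Fin 5) ℂ) (x : σ → ℂ) : Matrix (Fin 5) (Fin 5)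
    ℂ :=
  ∑ l, x l • N l

/-- The ideal of the Pfaffians of `∑ Xₗ Nₗ`. -/
noncomputable def pfaffianIdeal (N : σ → Matrix (Fin 5) (Fin 5) ℂ) : Ideal (MvPolynomial σ ℂ) :=
  Ideal.span (Set.range (pfaffians (linearMatrix N)))

theorem linearMatrix_apply (N : σ → Matrix (Fin 5) (Fin 5) ℂ) (i j : Fin 5) :
    linearMatrix N i j = ∑ l, X l * C (N l i j) := by
  simp [linearMatrix, Matrix.sum_apply]

theorem isHomogeneous_linearMatrix (N : σ → Matrix (Fin 5) (Fin 5) ℂ) (i j : Fin 5) :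
    (linearMatrix N i j).IsHomogeneous 1 := by
  rw [linearMatrix_apply]
  refine IsHomogeneous.sum _ _ _ fun l _ => ?_
  rw [mul_comm]
  exact (isHomogeneous_X ℂ l).C_mul _

theorem isAlternating_linearMatrix {N : σ → Matrix (Fin 5) (Fin 5) ℂ}
    (hN : ∀ l, (N l).IsAlternating) : (linearMatrix N).IsAlternating := by
  refine ⟨fun i => ?_, fun i j => ?_⟩
  · simp [linearMatrix_apply, (hN _).1]
  · simp [linearMatrix_apply, (hN _).2 i j]

theorem isHomogeneous_pfaffians_linearMatrix (N : σ → Matrix (Fin 5) (Fin 5) ℂ) (i : Fin 5) :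
    (pfaffians (linearMatrix N) i).IsHomogeneous 2 := by
  have h : ∀ a b c d, (linearMatrix N a b * linearMatrix N c d).IsHomogeneous 2 := fun a b c d =>
    (isHomogeneous_linearMatrix N a b).mul (isHomogeneous_linearMatrix N c d)
  fin_cases i
  · exact ((h _ _ _ _).sub (h _ _ _ _)).add (h _ _ _ _)
  · exact (((h _ _ _ _).sub (h _ _ _ _)).add (h _ _ _ _)).neg
  · exact ((h _ _ _ _).sub (h _ _ _ _)).add (h _ _ _ _)
  · exact (((h _ _ _ _).sub (h _ _ _ _)).add (h _ _ _ _)).neg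
  · exact ((h _ _ _ _).sub (h _ _ _ _)).add (h _ _ _ _)

theorem map_eval_linearMatrix (N : σ → Matrix (Fin 5) (Fin 5) ℂ) (x : σ → ℂ) :
    (linearMatrix N).map (eval x) = evalMatrix N x := by
  ext i j
  simp [linearMatrix_apply, evalMatrix, Matrix.sum_apply]

theorem eval_pfaffians_linearMatrix (N : σ → Matrix (Fin 5) (Fin 5) ℂ) (x : σ → ℂ) (i : Fin 5) :
    eval x (pfaffians (linearMatrix N) i) = pfaffians (evalMatrix N x) i := by
  rw [← map_eval_linearMatrix, pfaffians_map]

/-- Nullstellensatz: the hypothesis says that the linear space misses the Grassmannian, so the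
origin is the only zero. The powers of variables obtained here are the regular sequence fed to the
Pfaffian complex. -/
theorem exists_X_pow_mem_pfaffianIdeal {N : σ → Matrix (Fin 5) (Fin 5) ℂ}
    (hbpf : ∀ x, pfaffians (evalMatrix N x) = 0 → x = 0) :
    ∃ n ≠ 0, ∀ l, (X l : MvPolynomial σ ℂ) ^ n ∈ pfaffianIdeal N := by
  have h : ∀ l, (X l : MvPolynomial σ ℂ) ∈ (pfaffianIdeal N).radical := by
    intro l
    rw [← vanishingIdeal_zeroLocus_eq_radical (K := ℂ), mem_vanishingIdeal_iff]
    intro x hx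
    have : x = 0 := hbpf x (funext fun i => by
      rw [← eval_pfaffians_linearMatrix, Pi.zero_apply]
      exact hx _ (Ideal.subset_span ⟨i, rfl⟩))
    simp [this]
  choose n hn using h
  refine ⟨∑ l, n l + 1, by omega, fun l => Ideal.pow_mem_of_pow_mem _ (hn l) ?_⟩
  have := Finset.single_le_sum (f := n) (fun i _ => Nat.zero_le _) (Finset.mem_univ l)
  omega

end LinearMatrices

/-! ### Nets of alternating forms without decomposable member: Hilbert function 1, 3, 1. -/

section PfaffianNets

open MvPolynomial Matrix

variable {N : Fin 3 → Matrix (Fin 5) (Fin 5) ℂ}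

theorem exists_eq_linearMatrix_mulVec (hN : ∀ l, (N l).IsAlternating)
    (hbpf : ∀ x, pfaffians (evalMatrix N x) = 0 → x = 0) {z : Fin 5 → MvPolynomial (Fin 3) ℂ}
    (hz : pfaffians (linearMatrix N) ⬝ᵥ z = 0) : ∃ w, z = linearMatrix N *ᵥ w := by
  obtain ⟨n, -, h⟩ := exists_X_pow_mem_pfaffianIdeal hbpf
  exact exists_eq_mulVec_of_dotProduct_eq_zero (isAlternating_linearMatrix hN)
    (f₁ := X 0 ^ n) (f₂ := X 1 ^ n) (f₃ := X 2 ^ n) (pow_ne_zero _ (X_ne_zero _))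
    (h 0) (h 1) (h 2) (X_pow_dvd_of_dvd_X_pow_mul (by decide) n)
    (mem_span_X_pow_of_X_pow_mul_mem (by decide) (by decide) n) hz

theorem homogeneousComponent_linearMatrix_mulVec {σ : Type*} [Fintype σ]
    (N : σ → Matrix (Fin 5) (Fin 5) ℂ) (w : Fin 5 → MvPolynomial σ ℂ) (n : ℕ) (i : Fin 5) :
    homogeneousComponent (n + 1) ((linearMatrix N *ᵥ w) i)
      = (linearMatrix N *ᵥ fun j => homogeneousComponent n (w j)) i := by
  simp only [mulVec, dotProduct, map_sum]
  refine Finset.sum_congr rfl fun j _ => ?_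
  rw [add_comm, homogeneousComponent_add_mul (isHomogeneous_linearMatrix N i j)]

/-- A constant syzygy lies in the image of a matrix of linear forms, whose values have no constant
term. -/
theorem linearIndependent_pfaffians (hN : ∀ l, (N l).IsAlternating)
    (hbpf : ∀ x, pfaffians (evalMatrix N x) = 0 → x = 0) :
    LinearIndependent ℂ (pfaffians (linearMatrix N)) := by
  rw [Fintype.linearIndependent_iff]
  intro c hc i
  obtain ⟨w, hw⟩ := exists_eq_linearMatrix_mulVec hN hbpf (z := fun i => C (c i)) (by
    rw [← hc]
    exact Finset.sum_congr rfl fun i _ => by rw [mul_comm, C_mul'])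
  have h := congrArg (homogeneousComponent 0) (congrFun hw i)
  simp only [mulVec, dotProduct, map_sum,
    homogeneousComponent_mul_eq_zero (isHomogeneous_linearMatrix N i _) zero_lt_one] at h
  simpa using h

/-- Multiplication by the Pfaffians, from vectors of forms of degree `n`. -/
noncomputable def pfaffianMul (N : Fin 3 → Matrix (Fin 5) (Fin 5) ℂ) (n : ℕ) :
    (Fin 5 → homogeneousSubmodule (Fin 3) ℂ n) →ₗ[ℂ] homogeneousSubmodule (Fin 3) ℂ (n + 2) where
  toFun z := ⟨∑ i, z i * pfaffians (linearMatrix N) i, Submodule.sum_mem _ fun i _ =>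
    IsHomogeneous.mul (z i).2 (isHomogeneous_pfaffians_linearMatrix N i)⟩
  map_add' z z' := Subtype.ext (by simp [add_mul, Finset.sum_add_distrib])
  map_smul' c z := Subtype.ext (by simp [Finset.smul_sum])

/-- Multiplication of a constant vector by a matrix of linear forms. -/
noncomputable def linearMatrixMul (N : Fin 3 → Matrix (Fin 5) (Fin 5) ℂ) :
    (Fin 5 → ℂ) →ₗ[ℂ] (Fin 5 → homogeneousSubmodule (Fin 3) ℂ 1) where
  toFun c i := ⟨∑ j, c j • linearMatrix N i j, Submodule.sum_mem _ fun j _ =>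
    Submodule.smul_mem _ _ (isHomogeneous_linearMatrix N i j)⟩
  map_add' z z' := by ext1 i; exact Subtype.ext (by simp [add_smul, Finset.sum_add_distrib])
  map_smul' c z := by ext1 i; exact Subtype.ext (by simp [Finset.smul_sum, mul_smul])

/-- Linear syzygies come from constant vectors, so they span at most five dimensions; the image has
dimension at least `5 · 3 - 5 = 10`, which is that of all ternary cubics. Hence the quotient by the
Pfaffians vanishes in degree three. -/
theorem pfaffianMul_one_surjective (hN : ∀ l, (N l).IsAlternating)
    (hbpf : ∀ x, pfaffians (evalMatrix N x) = 0 → x = 0) :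
    Function.Surjective (pfaffianMul N 1) := by
  have h1 : finrank ℂ (homogeneousSubmodule (Fin 3) ℂ 1) = 3 := by
    rw [MvPolynomial.finrank_homogeneousSubmodule]; decide
  have h3 : finrank ℂ (homogeneousSubmodule (Fin 3) ℂ (1 + 2)) = 10 := by
    rw [MvPolynomial.finrank_homogeneousSubmodule]; decide
  have hk : LinearMap.ker (pfaffianMul N 1) ≤ LinearMap.range (linearMatrixMul N) := by
    intro z hz
    have hz' := congrArg Subtype.val (LinearMap.mem_ker.1 hz)
    obtain ⟨w, hw⟩ := exists_eq_linearMatrix_mulVec hN hbpf (z := fun i => (z i : _)) (by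
      rw [dotProduct_comm]; exact hz')
    refine ⟨fun j => coeff 0 (w j), ?_⟩
    ext1 i
    refine Subtype.ext ?_
    have e := congrArg (homogeneousComponent (0 + 1)) (congrFun hw i)
    rw [homogeneousComponent_linearMatrix_mulVec] at e
    simp only [zero_add, homogeneousComponent_eq_self (z i).2, homogeneousComponent_zero] at e
    rw [e]
    simp [linearMatrixMul, mulVec, dotProduct, smul_eq_C_mul, mul_comm]
  have hk' : finrank ℂ (LinearMap.ker (pfaffianMul N 1)) ≤ 5 := by
    refine (Submodule.finrank_mono hk).trans ((LinearMap.finrank_range_le _).trans ?_)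
    simp
  have hr := LinearMap.finrank_range_add_finrank_ker (pfaffianMul N 1)
  rw [Module.finrank_pi_fintype] at hr
  simp only [h1, Finset.sum_const, Finset.card_univ, Fintype.card_fin, smul_eq_mul] at hr
  rw [← LinearMap.range_eq_top]
  refine Submodule.eq_top_of_finrank_eq (le_antisymm (Submodule.finrank_le _) ?_)
  omega

/-- The five independent Pfaffians form a hyperplane in the six-dimensional space of ternary
quadratic forms; `q` represents the socle of the quotient ring. -/
theorem exists_quadric_complement (hN : ∀ l, (N l).IsAlternating)
    (hbpf : ∀ x, pfaffians (evalMatrix N x) = 0 → x = 0) :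
    ∃ q : MvPolynomial (Fin 3) ℂ, q.IsHomogeneous 2 ∧
      q ∉ Submodule.span ℂ (Set.range (pfaffians (linearMatrix N))) ∧
      ∀ f : MvPolynomial (Fin 3) ℂ, f.IsHomogeneous 2 →
        ∃ c : ℂ, f - c • q ∈ Submodule.span ℂ (Set.range (pfaffians (linearMatrix N))) := by
  set P := Submodule.span ℂ (Set.range (pfaffians (linearMatrix N)))
  set H := homogeneousSubmodule (Fin 3) ℂ 2
  have h2 : finrank ℂ H = 6 := by
    rw [MvPolynomial.finrank_homogeneousSubmodule]; decide
  have hP : finrank ℂ P = 5 := by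
    rw [finrank_span_eq_card (linearIndependent_pfaffians hN hbpf)]; simp
  have hPH : P ≤ H := Submodule.span_le.2 (by
    rintro _ ⟨i, rfl⟩; exact isHomogeneous_pfaffians_linearMatrix N i)
  have hlt : P < H := lt_of_le_of_ne hPH fun h => by rw [h, h2] at hP; omega
  obtain ⟨q, hqH, hqP⟩ := SetLike.exists_of_lt hlt
  refine ⟨q, hqH, hqP, ?_⟩
  have hsup : P ⊔ Submodule.span ℂ {q} = H := by
    have hle : P ⊔ Submodule.span ℂ {q} ≤ H :=
      sup_le hPH ((Submodule.span_singleton_le_iff_mem _ _).2 hqH)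
    refine Submodule.eq_of_le_of_finrank_le hle ?_
    have hlt' : P < P ⊔ Submodule.span ℂ {q} := lt_of_le_of_ne le_sup_left fun h =>
      hqP (h ▸ Submodule.mem_sup_right (Submodule.mem_span_singleton_self q))
    have : Module.Finite ℂ ↥(P ⊔ Submodule.span ℂ {q}) :=
      Submodule.finiteDimensional_of_le hle
    have := Submodule.finrank_lt_finrank_of_lt hlt'
    omega
  intro f hf
  have hf' : f ∈ P ⊔ Submodule.span ℂ {q} := hsup ▸ hf
  obtain ⟨a, ha, b, hb, rfl⟩ := Submodule.mem_sup.1 hf'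
  obtain ⟨c, rfl⟩ := Submodule.mem_span_singleton.1 hb
  exact ⟨c, by simpa using ha⟩

/-- The ideal is generated in degree two and meets that degree exactly in the span of the Pfaffians,
so each graded piece can be compared separately. -/
theorem eq_zero_of_mem_pfaffianIdeal {q : MvPolynomial (Fin 3) ℂ} (hq : q.IsHomogeneous 2)
    (hqP : q ∉ Submodule.span ℂ (Set.range (pfaffians (linearMatrix N)))) {r : Fin 5 → ℂ}
    (h : C (r 0) + C (r 1) * X 0 + C (r 2) * X 1 + C (r 3) * X 2 + C (r 4) * q
      ∈ pfaffianIdeal N) : r = 0 := by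
  obtain ⟨z, hz⟩ := Ideal.mem_span_range_iff_exists_fun.1 h
  have hX : ∀ (c : ℂ) (i : Fin 3), (C c * X i : MvPolynomial (Fin 3) ℂ).IsHomogeneous 1 :=
    fun c i => (isHomogeneous_X ℂ i).C_mul c
  have hc : ∀ (n : ℕ), homogeneousComponent n (∑ i, z i * pfaffians (linearMatrix N) i)
      = (if n = 0 then C (r 0) else 0) + (if n = 1 then C (r 1) * X 0 else 0)
        + (if n = 1 then C (r 2) * X 1 else 0) + (if n = 1 then C (r 3) * X 2 else 0)
        + (if n = 2 then C (r 4) * q else 0) := by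
    intro n
    rw [hz]
    simp only [map_add]
    rw [homogeneousComponent_of_mem ((mem_homogeneousSubmodule _ _).2 (isHomogeneous_C _ _)),
      homogeneousComponent_of_mem ((mem_homogeneousSubmodule _ _).2 (hX _ _)),
      homogeneousComponent_of_mem ((mem_homogeneousSubmodule _ _).2 (hX _ _)),
      homogeneousComponent_of_mem ((mem_homogeneousSubmodule _ _).2 (hX _ _)),
      homogeneousComponent_of_mem ((mem_homogeneousSubmodule _ _).2 (hq.C_mul _))]
  have hlow : ∀ n < 2, homogeneousComponent n (∑ i, z i * pfaffians (linearMatrix N) i) = 0 := by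
    intro n hn
    rw [map_sum]
    refine Finset.sum_eq_zero fun i _ => ?_
    rw [mul_comm, homogeneousComponent_mul_eq_zero (isHomogeneous_pfaffians_linearMatrix N i) hn]
  have c0 := hc 0
  have c1 := hc 1
  have c2 := hc 2
  rw [hlow 0 (by norm_num)] at c0
  rw [hlow 1 (by norm_num)] at c1
  simp only [if_true, zero_ne_one, one_ne_zero, if_false, zero_add, add_zero,
    show (0 : ℕ) ≠ 2 by norm_num, show (1 : ℕ) ≠ 2 by norm_num, show (2 : ℕ) ≠ 0 by norm_num,
    show (2 : ℕ) ≠ 1 by norm_num] at c0 c1 c2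
  have r0 : r 0 = 0 := by simpa using c0.symm
  have hr : ∀ x : Fin 3 → ℂ, 0 = r 1 * x 0 + r 2 * x 1 + r 3 * x 2 := fun x => by
    simpa using congrArg (eval x) c1
  have r1 : r 1 = 0 := by simpa using (hr ![1, 0, 0]).symm
  have r2 : r 2 = 0 := by simpa using (hr ![0, 1, 0]).symm
  have r3 : r 3 = 0 := by simpa using (hr ![0, 0, 1]).symm
  have r4 : r 4 = 0 := by
    by_contra hne
    refine hqP ?_
    have e : C (r 4) * q ∈ Submodule.span ℂ (Set.range (pfaffians (linearMatrix N))) := by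
      rw [← c2, map_sum]
      refine Submodule.sum_mem _ fun i _ => ?_
      have : homogeneousComponent (2 + 0) (z i * pfaffians (linearMatrix N) i)
          = coeff 0 (z i) • pfaffians (linearMatrix N) i := by
        rw [mul_comm, homogeneousComponent_add_mul (isHomogeneous_pfaffians_linearMatrix N i),
          homogeneousComponent_zero, mul_comm, C_mul']
      rw [add_zero] at this
      rw [this]
      exact Submodule.smul_mem _ _ (Submodule.subset_span ⟨i, rfl⟩)
    rw [C_mul'] at e
    exact (Submodule.smul_mem_iff _ hne).1 e
  ext i
  fin_cases i
  exacts [r0, r1, r2, r3, r4]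

end PfaffianNets

/-! ### The coordinate ring of a ℙ⁴-section as a free module of rank five. -/

section Freeness

open MvPolynomial Matrix

/-- If the algebra `S` is generated over `R` by
    `x`, and modulo an ideal `I` the products `xᵢ xⱼ` and
`xᵢ q` are combinations of `1, x₀, x₁, x₂, q`, up to lower order terms, then these span `S / I`. -/
theorem span_sup_eq_top_of_quadratic_relations {R S ι : Type*} [CommRing R] [CommRing S]
    [Algebra R S] [Fintype ι] (I : Ideal S) (x : Fin 3 → S) (q : S) (p p₀ : ι → S)
    (hp : ∀ i, p i ∈ I) (hdiff : ∀ i, p i - p₀ i ∈ Submodule.span R (insert 1 (Set.range x)))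
    (h2 : ∀ i j, ∃ (c : R) (d : ι → R), x i * x j = c • q + ∑ l, d l • p₀ l)
    (h3 : ∀ i, ∃ l : ι → S, (∀ j, l j ∈ Submodule.span R (Set.range x)) ∧
      x i * q = ∑ j, l j * p₀ j)
    (hgen : Algebra.adjoin R (Set.range x) = ⊤) :
    Submodule.span R (Set.range ![1, x 0, x 1, x 2, q]) ⊔ I.restrictScalars R = ⊤ := by
  set L := Submodule.span R (insert 1 (Set.range x)) with hL
  set V := Submodule.span R (Set.range ![1, x 0, x 1, x 2, q]) ⊔ I.restrictScalars R with hV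
  have h1V : (1 : S) ∈ V := Submodule.mem_sup_left (Submodule.subset_span ⟨0, rfl⟩)
  have hxV : ∀ i, x i ∈ V := fun i => Submodule.mem_sup_left (Submodule.subset_span (by
    fin_cases i
    exacts [⟨1, rfl⟩, ⟨2, rfl⟩, ⟨3, rfl⟩]))
  have hqV : q ∈ V := Submodule.mem_sup_left (Submodule.subset_span ⟨4, rfl⟩)
  have hIV : ∀ s ∈ I, s ∈ V := fun s hs => Submodule.mem_sup_right hs
  have hLV : L ≤ V := Submodule.span_le.2 (by
    rintro s (rfl | ⟨i, rfl⟩)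
    exacts [h1V, hxV i])
  -- In the application `p` are the Pfaffians of the full matrix and `p₀` those of the net.
  -- Replacing `p₀` by `p`, which is zero modulo `I`, costs only a term of lower order in `x`.
  have hLL : L * L ≤ V := by
    rw [hL, Submodule.span_mul_span, Submodule.span_le]
    rintro _ ⟨a, (rfl | ⟨i, rfl⟩), b, (rfl | ⟨j, rfl⟩), rfl⟩
    · simpa using h1V
    · simpa using hxV j
    · simpa using hxV i
    · obtain ⟨c, d, h⟩ := h2 i j
      simp only [SetLike.mem_coe, h]
      refine V.add_mem (V.smul_mem _ hqV) (V.sum_mem fun l _ => V.smul_mem _ ?_)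
      rw [← sub_sub_cancel (p l) (p₀ l)]
      exact V.sub_mem (hIV _ (hp l)) (hLV (hdiff l))
  have hxL : Submodule.span R (Set.range x) ≤ L := Submodule.span_mono (Set.subset_insert _ _)
  have hmul : ∀ i, ∀ v ∈ V, x i * v ∈ V := by
    intro i v hv
    have hle : V ≤ V.comap (LinearMap.mulLeft R (x i)) := by
      refine sup_le (Submodule.span_le.2 ?_) fun s hs => hIV _ (I.mul_mem_left _ hs)
      have hxx : ∀ j, x i * x j ∈ V := fun j => hLL (Submodule.mul_mem_mul
        (hxL (Submodule.subset_span ⟨i, rfl⟩)) (hxL (Submodule.subset_span ⟨j, rfl⟩)))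
      rintro _ ⟨j, rfl⟩
      fin_cases j
      · simpa using hxV i
      · exact hxx 0
      · exact hxx 1
      · exact hxx 2
      · obtain ⟨l, hl, h⟩ := h3 i
        change x i * q ∈ V
        rw [h]
        refine V.sum_mem fun j _ => ?_
        rw [← sub_sub_cancel (p j) (p₀ j), mul_sub]
        exact V.sub_mem (hIV _ (I.mul_mem_left _ (hp j)))
          (hLL (Submodule.mul_mem_mul (hxL (hl j)) (hdiff j)))
    exact hle hv
  refine Submodule.eq_top_iff'.2 fun s => ?_
  have hs : s ∈ Algebra.adjoin R (Set.range x) := hgen ▸ Algebra.mem_top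
  have key : ∀ v ∈ V, s * v ∈ V := by
    induction hs using Algebra.adjoin_induction with
    | mem y hy => obtain ⟨i, rfl⟩ := hy; exact hmul i
    | algebraMap r => intro v hv; rw [← Algebra.smul_def]; exact V.smul_mem _ hv
    | add a b _ _ ha hb => intro v hv; rw [add_mul]; exact V.add_mem (ha v hv) (hb v hv)
    | mul a b _ _ ha hb => intro v hv; rw [mul_assoc]; exact ha _ (hb v hv)
  simpa using key 1 h1V

/-- One-parameter deformations of a net of alternating forms: the classes of `1, X₀, X₁, X₂, q` stay
independent over the parameter ring. -/
theorem X_pow_dvd_of_mem_span_pfaffians {N : Fin 3 → Matrix (Fin 5) (Fin 5) ℂ}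
    (hN : ∀ l, (N l).IsAlternating) (hbpf : ∀ x, pfaffians (evalMatrix N x) = 0 → x = 0)
    {q : MvPolynomial (Fin 3) ℂ} (hq : q.IsHomogeneous 2)
    (hqP : q ∉ Submodule.span ℂ (Set.range (pfaffians (linearMatrix N))))
    {M : Matrix (Fin 5) (Fin 5) (Polynomial (MvPolynomial (Fin 3) ℂ))} (hM : M.IsAlternating)
    (hM0 : M.map Polynomial.constantCoeff = linearMatrix N) (n : ℕ) (r : Fin 5 → Polynomial ℂ)
    (h : (r 0).map C + (r 1).map C * Polynomial.C (X 0) + (r 2).map C * Polynomial.C (X 1)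
      + (r 3).map C * Polynomial.C (X 2) + (r 4).map C * Polynomial.C q
      ∈ Ideal.span (Set.range (pfaffians M))) (b : Fin 5) : Polynomial.X ^ n ∣ r b := by
  induction n generalizing r with
  | zero => simp
  | succ n ih =>
    obtain ⟨z, hz⟩ := Ideal.mem_span_range_iff_exists_fun.1 h
    have h0 := congrArg Polynomial.constantCoeff hz
    simp only [map_sum, map_mul, map_add, ← pfaffians_map, hM0, Polynomial.constantCoeff_apply,
      Polynomial.coeff_map, Polynomial.coeff_C_zero] at h0
    have hr : (fun b => (r b).coeff 0) = 0 := eq_zero_of_mem_pfaffianIdeal (N := N) hq hqP (by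
      rw [← h0]
      exact Ideal.sum_mem _ fun i _ => Ideal.mul_mem_left _ _ (Ideal.subset_span ⟨i, rfl⟩))
    -- At parameter zero the relation lies in the Pfaffian ideal of the net, so all constant
    -- coefficients of `r` vanish. The coefficients `z` then reduce to a syzygy of the undeformed
    -- Pfaffians, of the form `N w`.
    have hr' : ∀ b, ∃ r', r b = Polynomial.X * r' := fun b =>
      Polynomial.X_dvd_iff.2 (congrFun hr b)
    choose r' hr' using hr'
    obtain ⟨w, hw⟩ := exists_eq_linearMatrix_mulVec hN hbpf (z := fun i => (z i).coeff 0) (by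
      rw [dotProduct_comm]
      have hrb : ∀ b, (r b).coeff 0 = 0 := congrFun hr
      simpa [dotProduct, hrb] using h0)
    have hz' : ∀ i, ∃ z', z i - (M *ᵥ fun j => Polynomial.C (w j)) i = Polynomial.X * z' := by
      intro i
      refine Polynomial.X_dvd_iff.2 ?_
      have := congrFun hw i
      simp only [← hM0] at this
      simp [Polynomial.coeff_sub, mulVec, dotProduct, this]
    choose z' hz' using hz'
    -- The syzygy `N w` lifts to `M w`, which is a syzygy of the deformed Pfaffians. Subtracting it
    -- from `z` leaves a multiple of the parameter, so the whole relation can be divided by the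
    -- parameter.
    have hskew : ∑ i, (M *ᵥ fun j => Polynomial.C (w j)) i * pfaffians M i = 0 := by
      have hT : Mᵀ = -M := by ext1 a b; simp [hM.2 a b]
      change (M *ᵥ fun j => Polynomial.C (w j)) ⬝ᵥ pfaffians M = 0
      rw [dotProduct_comm, dotProduct_mulVec, ← mulVec_transpose, hT, neg_mulVec,
        mulVec_pfaffians hM, neg_zero, zero_dotProduct]
    rw [hr' b, pow_succ']
    refine mul_dvd_mul_left _ (ih r' ?_)
    refine Ideal.mem_span_range_iff_exists_fun.2 ⟨z', ?_⟩
    refine mul_left_cancel₀ (Polynomial.X_ne_zero (R := MvPolynomial (Fin 3) ℂ)) ?_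
    have e : ∑ i, Polynomial.X * z' i * pfaffians M i = ∑ i, z i * pfaffians M i := by
      simp only [← hz', sub_mul, Finset.sum_sub_distrib, hskew, sub_zero]
    rw [Finset.mul_sum]
    simp only [← mul_assoc, e, hz, hr', Polynomial.map_mul, Polynomial.map_X]
    ring

/-- The polynomial ring in the last two variables acts on the polynomial ring in five variables. -/
noncomputable def lastVariablesAlgebra :
    Algebra (MvPolynomial (Fin 2) ℂ) (MvPolynomial (Fin 3 ⊕ Fin 2) ℂ) :=
  (rename Sum.inr).toRingHom.toAlgebra

attribute [local instance] lastVariablesAlgebra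

theorem lastVariables_algebraMap (r : MvPolynomial (Fin 2) ℂ) :
    algebraMap (MvPolynomial (Fin 2) ℂ) (MvPolynomial (Fin 3 ⊕ Fin 2) ℂ) r = rename Sum.inr r :=
  rfl

variable {N : Fin 3 ⊕ Fin 2 → Matrix (Fin 5) (Fin 5) ℂ}

/-- The generators `1, X₀, X₁, X₂, q` of the homogeneous coordinate ring over the polynomial ring in
the last two variables. -/
noncomputable def moduleGenerators (q : MvPolynomial (Fin 3) ℂ) :
    Fin 5 → MvPolynomial (Fin 3 ⊕ Fin 2) ℂ :=
  ![1, X (Sum.inl 0), X (Sum.inl 1), X (Sum.inl 2), rename Sum.inl q]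

/-- Restricting the last two variables to the line `t ↦ t α` gives a one-parameter deformation of
the net. The restricted coefficients are divisible by every power of `t`, hence zero; the value at
`t = 1` is `r(α)`. -/
theorem eq_zero_of_sum_smul_moduleGenerators_mem (hN : ∀ l, (N l).IsAlternating)
    (hbpf : ∀ x, pfaffians (evalMatrix (N ∘ Sum.inl) x) = 0 → x = 0)
    {q : MvPolynomial (Fin 3) ℂ} (hq : q.IsHomogeneous 2)
    (hqP : q ∉ Submodule.span ℂ (Set.range (pfaffians (linearMatrix (N ∘ Sum.inl)))))
    {r : Fin 5 → MvPolynomial (Fin 2) ℂ}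
    (h : ∑ b, r b • moduleGenerators q b ∈ pfaffianIdeal N) : r = 0 := by
  suffices ∀ (α : Fin 2 → ℂ) (b : Fin 5), eval α (r b) = 0 from
    funext fun b => MvPolynomial.funext fun α => by simpa using this α b
  intro α b
  let Φ : MvPolynomial (Fin 3 ⊕ Fin 2) ℂ →ₐ[ℂ] Polynomial (MvPolynomial (Fin 3) ℂ) :=
    aeval (Sum.elim (fun i => Polynomial.C (X i)) fun j => Polynomial.C (C (α j)) * Polynomial.X)
  let ρ : MvPolynomial (Fin 2) ℂ →ₐ[ℂ] Polynomial ℂ :=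
    aeval fun j => Polynomial.C (α j) * Polynomial.X
  let κ : Polynomial ℂ →ₐ[ℂ] Polynomial (MvPolynomial (Fin 3) ℂ) :=
    Polynomial.mapAlgHom (Algebra.ofId ℂ (MvPolynomial (Fin 3) ℂ))
  have hκ : ∀ s : Polynomial ℂ, κ s = s.map C := fun s => rfl
  have hρ : ∀ s, Φ (rename Sum.inr s) = (ρ s).map C := by
    intro s
    rw [← hκ, ← AlgHom.comp_apply, ← AlgHom.comp_apply]
    congr 1
    ext j : 1
    simp [Φ, ρ, hκ]
  have hι : ∀ s, Φ (rename Sum.inl s) = Polynomial.C s := by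
    intro s
    induction s using MvPolynomial.induction_on with
    | C a => rw [rename_C, ← algebraMap_eq, AlgHom.commutes]; rfl
    | add a b ha hb => simp only [map_add, ha, hb]
    | mul_X a i ha => simp only [map_mul, ha, rename_X]; simp [Φ]
  have hC : ∀ c, Φ (C c) = Polynomial.C (C c) := fun c => by
    rw [← algebraMap_eq, AlgHom.commutes]; rfl
  let M := (linearMatrix N).map Φ.toRingHom
  have hM : M.IsAlternating := by
    have := isAlternating_linearMatrix hN
    exact ⟨fun i => by simp [M, this.1], fun i j => by simp [M, this.2 i j]⟩
  have hM0 : M.map Polynomial.constantCoeff = linearMatrix (N ∘ Sum.inl) := by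
    ext1 i j
    simp [M, linearMatrix_apply, Φ]
  have h1 : Φ (∑ b, r b • moduleGenerators q b) ∈ Ideal.span (Set.range (pfaffians M)) := by
    have := Ideal.mem_map_of_mem Φ.toRingHom h
    rw [pfaffianIdeal, Ideal.map_span] at this
    have e : Φ.toRingHom '' Set.range (pfaffians (linearMatrix N)) = Set.range (pfaffians M) := by
      rw [← Set.range_comp]
      congr 1
      ext1 i
      exact (pfaffians_map _ _ _).symm
    rw [e] at this
    exact this
  have h2 : ∀ n b, Polynomial.X ^ n ∣ ρ (r b) := fun n b => by
    refine X_pow_dvd_of_mem_span_pfaffians (fun l => hN (Sum.inl l)) hbpf hq hqP hM hM0 n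
      (fun b => ρ (r b)) ?_ b
    simpa [Fin.sum_univ_five, moduleGenerators, Algebra.smul_def, lastVariables_algebraMap, hρ, hι,
      Φ] using h1
  have h3 : ρ (r b) = 0 := by
    by_contra hne
    have := Polynomial.natDegree_le_of_dvd (h2 ((ρ (r b)).natDegree + 1) b) hne
    simp at this
  have h4 : Polynomial.eval 1 (ρ (r b)) = eval α (r b) := by
    have : (Polynomial.aeval (1 : ℂ)).comp ρ = aeval α := by
      ext j; simp [ρ]
    have := DFunLike.congr_fun this (r b)
    simpa [Polynomial.coe_aeval_eq_eval] using this
  rw [← h4, h3, Polynomial.eval_zero]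

theorem linearMatrix_eq_add (N : Fin 3 ⊕ Fin 2 → Matrix (Fin 5) (Fin 5) ℂ) :
    linearMatrix N = (linearMatrix (N ∘ Sum.inl)).map (rename Sum.inl : _ →ₐ[ℂ] _).toRingHom
      + (linearMatrix (N ∘ Sum.inr)).map (rename Sum.inr : _ →ₐ[ℂ] _).toRingHom := by
  ext1 i j
  simp [linearMatrix_apply, Fintype.sum_sum_type]

/-- In the expansion of the Pfaffians of a sum, the mixed term is linear in the first three
variables and the last term is a scalar of the base ring; so the Pfaffians of the net are the
leading terms, and the relations of the net allow reduction to the five generators. -/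
theorem span_moduleGenerators_sup_eq_top (hN : ∀ l, (N l).IsAlternating)
    (hbpf : ∀ x, pfaffians (evalMatrix (N ∘ Sum.inl) x) = 0 → x = 0)
    {q : MvPolynomial (Fin 3) ℂ} (hq : q.IsHomogeneous 2)
    (hqs : ∀ f : MvPolynomial (Fin 3) ℂ, f.IsHomogeneous 2 → ∃ c : ℂ,
      f - c • q ∈ Submodule.span ℂ (Set.range (pfaffians (linearMatrix (N ∘ Sum.inl))))) :
    Submodule.span (MvPolynomial (Fin 2) ℂ) (Set.range (moduleGenerators q))
      ⊔ (pfaffianIdeal N).restrictScalars (MvPolynomial (Fin 2) ℂ) = ⊤ := by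
  let ι : MvPolynomial (Fin 3) ℂ →ₐ[ℂ] MvPolynomial (Fin 3 ⊕ Fin 2) ℂ := rename Sum.inl
  have hsmul : ∀ (c : ℂ) (s : MvPolynomial (Fin 3 ⊕ Fin 2) ℂ),
      (C c : MvPolynomial (Fin 2) ℂ) • s = c • s := fun c s => by
    rw [Algebra.smul_def, lastVariables_algebraMap, rename_C, C_mul']
  refine span_sup_eq_top_of_quadratic_relations (R := MvPolynomial (Fin 2) ℂ) (pfaffianIdeal N)
    (fun i => X (Sum.inl i)) (ι q) (pfaffians (linearMatrix N))
    (fun i => ι (pfaffians (linearMatrix (N ∘ Sum.inl)) i))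
    (fun i => Ideal.subset_span ⟨i, rfl⟩) (fun i => ?_) (fun i j => ?_) (fun i => ?_) ?_
  · set L := Submodule.span (MvPolynomial (Fin 2) ℂ) (insert 1 (Set.range
      fun i => (X (Sum.inl i) : MvPolynomial (Fin 3 ⊕ Fin 2) ℂ)))
    have hprod : ∀ a b c d, ((linearMatrix (N ∘ Sum.inl)).map ι.toRingHom) a b
        * ((linearMatrix (N ∘ Sum.inr)).map
            (rename Sum.inr : _ →ₐ[ℂ] MvPolynomial (Fin 3 ⊕ Fin 2) ℂ).toRingHom) c d ∈ L := by
      intro a b c d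
      rw [mul_comm]
      refine L.smul_mem (linearMatrix (N ∘ Sum.inr) c d) ?_
      rw [Matrix.map_apply, linearMatrix_apply]
      simp only [map_sum, map_mul]
      refine L.sum_mem fun l _ => ?_
      have : (ι.toRingHom (X l) * ι.toRingHom (C ((N ∘ Sum.inl) l a b)) : _)
          = (C (N (Sum.inl l) a b) : MvPolynomial (Fin 2) ℂ) • X (Sum.inl l) := by
        rw [hsmul, ← C_mul', mul_comm]
        simp [ι]
      rw [this]
      exact L.smul_mem _ (Submodule.subset_span (Set.mem_insert_of_mem _ ⟨l, rfl⟩))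
    rw [linearMatrix_eq_add N, pfaffians_add, Pi.add_apply, Pi.add_apply, pfaffians_map,
      pfaffians_map, add_assoc]
    have e : ∀ y z : MvPolynomial (Fin 3 ⊕ Fin 2) ℂ, y + z - y = z := fun y z => by ring
    refine (e _ _).symm ▸ L.add_mem ?_ ?_
    · fin_cases i
      · exact L.add_mem (L.sub_mem (L.add_mem (L.add_mem (L.sub_mem (hprod _ _ _ _)
          (hprod _ _ _ _)) (hprod _ _ _ _)) (hprod _ _ _ _)) (hprod _ _ _ _)) (hprod _ _ _ _)
      · exact L.neg_mem (L.add_mem (L.sub_mem (L.add_mem (L.add_mem (L.sub_mem (hprod _ _ _ _)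
          (hprod _ _ _ _)) (hprod _ _ _ _)) (hprod _ _ _ _)) (hprod _ _ _ _)) (hprod _ _ _ _))
      · exact L.add_mem (L.sub_mem (L.add_mem (L.add_mem (L.sub_mem (hprod _ _ _ _)
          (hprod _ _ _ _)) (hprod _ _ _ _)) (hprod _ _ _ _)) (hprod _ _ _ _)) (hprod _ _ _ _)
      · exact L.neg_mem (L.add_mem (L.sub_mem (L.add_mem (L.add_mem (L.sub_mem (hprod _ _ _ _)
          (hprod _ _ _ _)) (hprod _ _ _ _)) (hprod _ _ _ _)) (hprod _ _ _ _)) (hprod _ _ _ _))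
      · exact L.add_mem (L.sub_mem (L.add_mem (L.add_mem (L.sub_mem (hprod _ _ _ _)
          (hprod _ _ _ _)) (hprod _ _ _ _)) (hprod _ _ _ _)) (hprod _ _ _ _)) (hprod _ _ _ _)
    · have := L.smul_mem (pfaffians (linearMatrix (N ∘ Sum.inr)) i)
        (Submodule.subset_span (Set.mem_insert _ _))
      rwa [Algebra.smul_def, mul_one] at this
  · obtain ⟨c, hc⟩ := hqs (X i * X j) ((isHomogeneous_X ℂ i).mul (isHomogeneous_X ℂ j))
    obtain ⟨d, hd⟩ := (Submodule.mem_span_range_iff_exists_fun ℂ).1 hc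
    refine ⟨C c, fun l => C (d l), ?_⟩
    have e : (X i * X j : MvPolynomial (Fin 3) ℂ)
        = c • q + ∑ l, d l • pfaffians (linearMatrix (N ∘ Sum.inl)) l := by rw [hd]; ring
    have := congrArg ι e
    simp only [map_mul, map_add, map_sum, map_smul] at this
    simp only [hsmul, ← this]
    simp [ι]
  · obtain ⟨z, hz⟩ := pfaffianMul_one_surjective (N := N ∘ Sum.inl) (fun l => hN (Sum.inl l)) hbpf
      ⟨X i * q, (mem_homogeneousSubmodule _ _).2 ((isHomogeneous_X ℂ i).mul hq)⟩
    have hz' : ∑ j, (z j : MvPolynomial (Fin 3) ℂ) * pfaffians (linearMatrix (N ∘ Sum.inl)) j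
      = X i * q := congrArg Subtype.val hz
    refine ⟨fun j => ι (z j), fun j => ?_, ?_⟩
    · have hj : (z j : MvPolynomial (Fin 3) ℂ) ∈ Submodule.span ℂ (Set.range X) :=
        homogeneousSubmodule_one_eq_span_X (σ := Fin 3) (R := ℂ) ▸ (z j).2
      obtain ⟨d, hd⟩ := (Submodule.mem_span_range_iff_exists_fun ℂ).1 hj
      change ι (z j : MvPolynomial (Fin 3) ℂ) ∈ _
      rw [← hd, map_sum]
      refine Submodule.sum_mem _ fun l _ => ?_
      rw [map_smul, ← hsmul]
      exact Submodule.smul_mem _ _ (Submodule.subset_span ⟨l, by simp [ι]⟩)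
    · simp only [← map_mul, ← map_sum, hz']
      simp [ι]
  · refine eq_top_iff.2 fun s _ => ?_
    induction s using MvPolynomial.induction_on with
    | C a =>
      have : (C a : MvPolynomial (Fin 3 ⊕ Fin 2) ℂ) = algebraMap (MvPolynomial (Fin 2) ℂ) _ (C a) :=
        (rename_C _ _).symm
      rw [this]
      exact Subalgebra.algebraMap_mem _ _
    | add a b ha hb => exact add_mem (ha trivial) (hb trivial)
    | mul_X a i ha =>
      refine mul_mem (ha trivial) ?_
      rcases i with i | i
      · exact Algebra.subset_adjoin ⟨i, rfl⟩
      · have : (X (Sum.inr i) : MvPolynomial (Fin 3 ⊕ Fin 2) ℂ)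
          = algebraMap (MvPolynomial (Fin 2) ℂ) _ (X i) := (rename_X _ _).symm
        rw [this]
        exact Subalgebra.algebraMap_mem _ _

/-- The homogeneous coordinate ring of a linear section of the Grassmannian by
    a `ℙ⁴` is free of rank
five over the last two variables. -/
theorem exists_basis_quotient_pfaffianIdeal (hN : ∀ l, (N l).IsAlternating)
    (hbpf : ∀ x, pfaffians (evalMatrix (N ∘ Sum.inl) x) = 0 → x = 0) :
    ∃ (q : MvPolynomial (Fin 3) ℂ) (b : Basis (Fin 5) (MvPolynomial (Fin 2) ℂ)
      (MvPolynomial (Fin 3 ⊕ Fin 2) ℂ ⧸ pfaffianIdeal N)), q.IsHomogeneous 2 ∧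
      ∀ i, b i = Ideal.Quotient.mk _ (moduleGenerators q i) := by
  obtain ⟨q, hq, hqP, hqs⟩ := exists_quadric_complement (N := N ∘ Sum.inl)
    (fun l => hN (Sum.inl l)) hbpf
  let v : Fin 5 → MvPolynomial (Fin 3 ⊕ Fin 2) ℂ ⧸ pfaffianIdeal N :=
    fun i => Ideal.Quotient.mkₐ (MvPolynomial (Fin 2) ℂ) (pfaffianIdeal N) (moduleGenerators q i)
  have hli : LinearIndependent (MvPolynomial (Fin 2) ℂ) v := by
    rw [Fintype.linearIndependent_iff]
    intro r hr
    refine congrFun (eq_zero_of_sum_smul_moduleGenerators_mem hN hbpf hq hqP ?_)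
    rw [← Ideal.Quotient.eq_zero_iff_mem, ← hr]
    exact (map_sum (Ideal.Quotient.mkₐ (MvPolynomial (Fin 2) ℂ) (pfaffianIdeal N)) _ _).trans
      (Finset.sum_congr rfl fun i _ => map_smul _ _ _)
  have hsp : ⊤ ≤ Submodule.span (MvPolynomial (Fin 2) ℂ) (Set.range v) := by
    rintro s -
    obtain ⟨s, rfl⟩ := Ideal.Quotient.mk_surjective s
    have hs : s ∈ Submodule.span (MvPolynomial (Fin 2) ℂ) (Set.range (moduleGenerators q))
      ⊔ (pfaffianIdeal N).restrictScalars (MvPolynomial (Fin 2) ℂ) := by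
      rw [span_moduleGenerators_sup_eq_top hN hbpf hq hqs]; trivial
    obtain ⟨a, ha, c, hc, rfl⟩ := Submodule.mem_sup.1 hs
    rw [map_add, Ideal.Quotient.eq_zero_iff_mem.2 hc, add_zero]
    have := Submodule.mem_map_of_mem
      (f := (Ideal.Quotient.mkₐ (MvPolynomial (Fin 2) ℂ) (pfaffianIdeal N)).toLinearMap) ha
    rw [Submodule.map_span, ← Set.range_comp] at this
    exact this
  exact ⟨q, Basis.mk hli hsp, hq, fun i => Basis.mk_apply _ _ _⟩

end Freeness

/-! ### Two-dimensional local rings: embedding dimension and depth. -/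

section LocalDomains

open IsLocalRing

/-- An element outside some power of an ideal generated by `a` is a power of `a` times an element
which is not a multiple of `a`. -/
theorem exists_eq_pow_mul_of_iInf_eq_bot {O : Type*} [CommRing O] {a : O}
    (h : ⨅ n : ℕ, Ideal.span {a} ^ n = ⊥) {x : O} (hx : x ≠ 0) :
    ∃ (n : ℕ) (y : O), x = a ^ n * y ∧ ¬ a ∣ y := by
  classical
  have h1 : ∃ n : ℕ, ¬ a ^ n ∣ x := by
    by_contra! hc
    refine hx ?_
    rw [← Ideal.mem_bot, ← h, Ideal.mem_iInf]
    intro n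
    rw [Ideal.span_singleton_pow, Ideal.mem_span_singleton]
    exact hc n
  obtain ⟨n, hn⟩ : ∃ n, Nat.find h1 = n + 1 := Nat.exists_eq_succ_of_ne_zero fun h0 => by
    have := Nat.find_spec h1
    rw [h0] at this
    simp at this
  obtain ⟨y, rfl⟩ := not_not.1 (Nat.find_min h1 (m := n) (by omega))
  refine ⟨n, y, rfl, ?_⟩
  rintro ⟨z, rfl⟩
  refine Nat.find_spec h1 ?_
  rw [hn, pow_succ, ← mul_assoc]
  exact dvd_mul_right _ _

/-- By Krull's intersection theorem every nonzero element is a power of `b` times a unit, so a zero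
product would make `b` nilpotent. -/
theorem noZeroDivisors_of_maximalIdeal_eq_span {Q : Type*} [CommRing Q] [IsLocalRing Q]
    [IsNoetherianRing Q] {b : Q} (hb : maximalIdeal Q = Ideal.span {b}) (hnil : ¬ IsNilpotent b) :
    NoZeroDivisors Q := by
  refine ⟨fun {x y} hxy => ?_⟩
  by_contra! hne
  have hbot : ⨅ n : ℕ, Ideal.span {b} ^ n = ⊥ :=
    Ideal.iInf_pow_eq_bot_of_isLocalRing _ (hb ▸ Ideal.IsPrime.ne_top')
  have hunit : ∀ z, ¬ b ∣ z → IsUnit z := fun z hz => by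
    by_contra hu
    exact hz (Ideal.mem_span_singleton.1 (hb ▸ (mem_maximalIdeal z).2 hu))
  obtain ⟨n, u, rfl, hu⟩ := exists_eq_pow_mul_of_iInf_eq_bot hbot hne.1
  obtain ⟨k, v, rfl, hv⟩ := exists_eq_pow_mul_of_iInf_eq_bot hbot hne.2
  refine hnil ⟨n + k, ?_⟩
  have h1 : b ^ (n + k) * (u * v) = 0 := by rw [← hxy]; ring
  exact ((hunit u hu).mul (hunit v hv)).mul_left_eq_zero.1 h1

/-- A Noetherian local ring whose maximal ideal is generated by two elements `a`, `b`, with `a` a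
nonzerodivisor and some element of the maximal ideal a nonzerodivisor modulo `a`, has no zero
divisors. -/
theorem noZeroDivisors_of_maximalIdeal_eq_span_pair {O : Type*} [CommRing O] [IsLocalRing O]
    [IsNoetherianRing O] {a b c : O} (hab : maximalIdeal O = Ideal.span {a, b})
    (ha : ∀ x, a * x = 0 → x = 0) (hc : c ∈ maximalIdeal O) (hac : ∀ x, a ∣ c * x → a ∣ x) :
    NoZeroDivisors O := by
  have ham : a ∈ maximalIdeal O := hab ▸ Ideal.subset_span (by simp)
  have hatop : Ideal.span {a} ≠ ⊤ := fun h =>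
    (mem_maximalIdeal a).1 ham (Ideal.span_singleton_eq_top.1 h)
  have hnt : Nontrivial (O ⧸ Ideal.span {a}) := Ideal.Quotient.nontrivial_iff.2 hatop
  let π := Ideal.Quotient.mk (Ideal.span {a})
  have hloc : IsLocalRing (O ⧸ Ideal.span {a}) :=
    IsLocalRing.of_surjective' π Ideal.Quotient.mk_surjective
  have hπ0 : ∀ x, π x = 0 ↔ a ∣ x := fun x => by
    rw [Ideal.Quotient.eq_zero_iff_mem, Ideal.mem_span_singleton]
  have hmax : maximalIdeal (O ⧸ Ideal.span {a}) = Ideal.span {π b} := by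
    have h1 : (maximalIdeal O).map π = maximalIdeal (O ⧸ Ideal.span {a}) := by
      have : IsLocalHom π := IsLocalHom.of_surjective _ Ideal.Quotient.mk_surjective
      exact IsLocalRing.map_maximalIdeal_of_surjective _ Ideal.Quotient.mk_surjective
    rw [← h1, hab, Ideal.map_span, Set.image_pair, (hπ0 a).2 dvd_rfl]
    exact Ideal.span_insert_zero
  -- Modulo `a` the element `c` is a multiple of `b`. If `b` were nilpotent there, `a` would divide
  -- a power of `c`, and regularity of `c` modulo `a` would make `a` a unit.
  have hnil : ¬ IsNilpotent (π b) := by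
    rintro ⟨n, hn⟩
    have h1 : π c ∈ maximalIdeal (O ⧸ Ideal.span {a}) := by
      rw [hmax]
      have : c ∈ Ideal.span {a, b} := hab ▸ hc
      obtain ⟨r, s, rfl⟩ := Ideal.mem_span_pair.1 this
      rw [map_add, map_mul, map_mul, (hπ0 a).2 dvd_rfl, mul_zero, zero_add]
      exact Ideal.mul_mem_left _ _ (Ideal.mem_span_singleton_self _)
    rw [hmax] at h1
    obtain ⟨d, hd⟩ := Ideal.mem_span_singleton.1 h1
    have h2 : a ∣ c ^ n := by rw [← hπ0, map_pow, hd, mul_pow, hn, zero_mul]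
    have h3 : ∀ k, a ∣ c ^ k → a ∣ 1 := by
      intro k hk
      induction k with
      | zero => simpa using hk
      | succ k ih => exact ih (hac _ (by rwa [← pow_succ']))
    exact (mem_maximalIdeal a).1 ham (isUnit_of_dvd_one (h3 n h2))
  have hdom := noZeroDivisors_of_maximalIdeal_eq_span hmax hnil
  refine ⟨fun {x y} hxy => ?_⟩
  by_contra! hne
  -- The quotient by the nonzerodivisor `a` is now a domain; stripping powers of `a` from both
  -- factors transfers this to the ring itself.
  have hbot : ⨅ n : ℕ, Ideal.span {a} ^ n = ⊥ := Ideal.iInf_pow_eq_bot_of_isLocalRing _ hatop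
  obtain ⟨n, u, rfl, hu⟩ := exists_eq_pow_mul_of_iInf_eq_bot hbot hne.1
  obtain ⟨k, v, rfl, hv⟩ := exists_eq_pow_mul_of_iInf_eq_bot hbot hne.2
  have ha' : ∀ j x, a ^ j * x = 0 → x = 0 := by
    intro j
    induction j with
    | zero => simp
    | succ j ih => intro x hx; exact ih _ (ha _ (by rw [← mul_assoc, ← pow_succ', hx]))
  have h1 : u * v = 0 := ha' (n + k) _ (by rw [← hxy]; ring)
  have h2 : π u * π v = 0 := by rw [← map_mul, h1, map_zero]
  rcases mul_eq_zero.1 h2 with h | h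
  exacts [hu ((hπ0 u).1 h), hv ((hπ0 v).1 h)]

variable {A : Type*} [CommRing A] {m : Ideal A} [hm : m.IsPrime] {a b c : A}

/-- Nakayama's lemma turns generators of the cotangent space into generators of the maximal ideal.
-/
theorem maximalIdeal_atPrime_eq_span_pair [IsNoetherianRing A] (ha : a ∈ m) (hb : b ∈ m)
    (hab : m ≤ Ideal.span {a, b} ⊔ m ^ 2) :
    maximalIdeal (Localization.AtPrime m)
      = Ideal.span {algebraMap A (Localization.AtPrime m) a, algebraMap A _ b} := by
  have h1 := Ideal.map_mono (f := algebraMap A (Localization.AtPrime m)) hab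
  rw [Ideal.map_sup, Ideal.map_pow, Ideal.map_span, Set.image_pair,
    Localization.AtPrime.map_eq_maximalIdeal, pow_two] at h1
  refine le_antisymm ?_ ?_
  · exact Submodule.le_of_le_smul_of_le_jacobson_bot (IsNoetherian.noetherian _)
      (IsLocalRing.maximalIdeal_le_jacobson _) h1
  · rw [← Localization.AtPrime.map_eq_maximalIdeal, Ideal.span_le]
    rintro _ (rfl | rfl)
    exacts [Ideal.mem_map_of_mem _ ha, Ideal.mem_map_of_mem _ hb]

theorem dvd_localization_of_dvd_mul (hac : ∀ x, a ∣ c * x → a ∣ x)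
    (x : Localization.AtPrime m)
    (h : algebraMap A (Localization.AtPrime m) a ∣ algebraMap A _ c * x) :
    algebraMap A (Localization.AtPrime m) a ∣ x := by
  obtain ⟨y, s, rfl⟩ := IsLocalization.exists_mk'_eq m.primeCompl x
  obtain ⟨z, hz⟩ := h
  obtain ⟨w, t, rfl⟩ := IsLocalization.exists_mk'_eq m.primeCompl z
  rw [IsLocalization.mul_mk'_eq_mk'_of_mul, IsLocalization.mul_mk'_eq_mk'_of_mul,
    IsLocalization.mk'_eq_iff_eq, IsLocalization.eq_iff_exists m.primeCompl] at hz
  obtain ⟨u, hu⟩ := hz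
  obtain ⟨d, hd⟩ := hac (u * t * y) ⟨u * s * w, by linear_combination hu⟩
  rw [IsLocalization.mk'_eq_mul_mk'_one]
  refine Dvd.dvd.mul_right ?_ _
  have h1 := congrArg (algebraMap A (Localization.AtPrime m)) hd
  rw [map_mul, map_mul, map_mul] at h1
  have hut : IsUnit (algebraMap A (Localization.AtPrime m) u * algebraMap A _ t) :=
    (IsLocalization.map_units _ u).mul (IsLocalization.map_units _ t)
  rw [← hut.dvd_mul_left, h1]
  exact dvd_mul_right _ _

theorem noZeroDivisors_atPrime [IsNoetherianRing A] (ha : a ∈ m) (hb : b ∈ m) (hc : c ∈ m)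
    (hab : m ≤ Ideal.span {a, b} ⊔ m ^ 2) (ha0 : ∀ x, a * x = 0 → x = 0)
    (hac : ∀ x, a ∣ c * x → a ∣ x) : NoZeroDivisors (Localization.AtPrime m) := by
  refine noZeroDivisors_of_maximalIdeal_eq_span_pair (maximalIdeal_atPrime_eq_span_pair ha hb hab)
    (fun x hx => ?_) ?_ (dvd_localization_of_dvd_mul hac)
  · obtain ⟨y, s, rfl⟩ := IsLocalization.exists_mk'_eq m.primeCompl x
    rw [IsLocalization.mul_mk'_eq_mk'_of_mul, IsLocalization.mk'_eq_zero_iff] at hx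
    obtain ⟨t, ht⟩ := hx
    rw [IsLocalization.mk'_eq_zero_iff]
    exact ⟨t, ha0 _ (by linear_combination ht)⟩
  · rw [← Localization.AtPrime.map_eq_maximalIdeal]
    exact Ideal.mem_map_of_mem _ hc

/-- If `a` generated the maximal ideal locally it would divide `c`, and regularity would make it
divide `1`. This later bounds tangent spaces from below. -/
theorem not_le_span_singleton_sup_sq [IsNoetherianRing A] (ha : a ∈ m) (hc : c ∈ m) (hac : ∀ x, a ∣
    c * x → a ∣ x) :
    ¬ m ≤ Ideal.span {a} ⊔ m ^ 2 := by
  intro h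
  have h1 := maximalIdeal_atPrime_eq_span_pair (b := 0) ha m.zero_mem (by
    rwa [Set.pair_comm, Ideal.span_insert_zero])
  rw [map_zero, Set.pair_comm, Ideal.span_insert_zero] at h1
  have hcm : algebraMap A (Localization.AtPrime m) c ∈ maximalIdeal (Localization.AtPrime m) := by
    rw [← Localization.AtPrime.map_eq_maximalIdeal]
    exact Ideal.mem_map_of_mem _ hc
  have ham : algebraMap A (Localization.AtPrime m) a ∈ maximalIdeal (Localization.AtPrime m) := by
    rw [← Localization.AtPrime.map_eq_maximalIdeal]
    exact Ideal.mem_map_of_mem _ ha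
  rw [h1, Ideal.mem_span_singleton, ← mul_one (algebraMap A _ c)] at hcm
  exact (mem_maximalIdeal _).1 ham (isUnit_of_dvd_one (dvd_localization_of_dvd_mul hac 1 hcm))

/-- At a prime where the local ring is a domain, an element or its annihilator vanishes locally. -/
theorem not_annihilator_sup_annihilator_le [IsNoetherianRing A]
    [NoZeroDivisors (Localization.AtPrime m)] (F : A) :
    ¬ (Ideal.span {F}).annihilator ⊔ (Ideal.span {F}).annihilator.annihilator ≤ m := by
  classical
  intro h
  have h1 := le_sup_left.trans h
  have h2 := le_sup_right.trans h
  have hF : algebraMap A (Localization.AtPrime m) F ≠ 0 := by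
    intro h0
    obtain ⟨s, hs⟩ := (IsLocalization.map_eq_zero_iff m.primeCompl _ _).1 h0
    exact s.2 (h1 ((Submodule.mem_annihilator_span_singleton _ _).2 hs))
  have hG : ∀ G ∈ (Ideal.span {F}).annihilator, ∃ s ∉ m, s * G = 0 := by
    intro G hG
    have h3 : G * F = 0 := (Submodule.mem_annihilator_span_singleton _ _).1 hG
    have h4 : algebraMap A (Localization.AtPrime m) G * algebraMap A _ F = 0 := by
      rw [← map_mul, h3, map_zero]
    obtain ⟨s, hs⟩ := (IsLocalization.map_eq_zero_iff m.primeCompl _ _).1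
      ((mul_eq_zero.1 h4).resolve_right hF)
    exact ⟨s, s.2, hs⟩
  obtain ⟨S, hS⟩ := IsNoetherian.noetherian (Ideal.span {F}).annihilator
  have hS' : ∀ G : S, ∃ s ∉ m, s * (G : A) = 0 := fun G =>
    hG G (hS ▸ Submodule.subset_span G.2)
  choose s hs hs0 using hS'
  have hp : ∏ G, s G ∉ m := fun hp => by
    obtain ⟨G, -, hG⟩ := hm.prod_mem_iff.1 hp
    exact hs G hG
  -- If `ann F ⊆ m`, then `F` is nonzero locally, so each of the finitely many generators of `ann F`
  -- dies locally. The product of the denominators kills `ann F` but is not in `m`, against `ann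
  -- (ann F) ⊆ m`.
  refine hp (h2 ?_)
  rw [Submodule.mem_annihilator, ← hS]
  intro G hG
  induction hG using Submodule.span_induction with
  | mem G hG =>
    rw [smul_eq_mul, ← Finset.mul_prod_erase _ _ (Finset.mem_univ (⟨G, hG⟩ : S)), mul_right_comm,
      hs0, zero_mul]
  | zero => simp
  | add x y _ _ hx hy => rw [smul_add, hx, hy, add_zero]
  | smul r x _ hx => rw [smul_comm, hx, smul_zero]

end LocalDomains

/-! ### From local domains to a domain, by depth two and connectedness. -/

section Connectedness

/-- Divisibility properties of two elements of `R` pass to free algebras over `R`. -/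
theorem Module.Basis.algebraMap_dvd_of_dvd_mul {R A ι : Type*} [CommRing R] [CommRing A]
    [Algebra R A] [Finite ι] (b : Basis ι R A) {r s : R} (h : ∀ x, s ∣ r * x → s ∣ x) (z : A)
    (hz : algebraMap R A s ∣ algebraMap R A r * z) : algebraMap R A s ∣ z := by
  have := Fintype.ofFinite ι
  obtain ⟨w, hw⟩ := hz
  have h1 : ∀ i, s ∣ b.repr z i := fun i => h _ ⟨b.repr w i, by
    rw [← Algebra.smul_def, ← Algebra.smul_def] at hw
    simpa using DFunLike.congr_fun (congrArg b.repr hw) i⟩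
  choose d hd using h1
  refine ⟨∑ i, d i • b i, ?_⟩
  rw [← Algebra.smul_def, Finset.smul_sum, ← b.sum_repr z]
  exact Finset.sum_congr rfl fun i _ => by rw [smul_smul, ← hd]

theorem Module.Basis.algebraMap_mul_eq_zero {R A ι : Type*} [CommRing R] [IsDomain R] [CommRing A]
    [Algebra R A] (b : Basis ι R A) {r : R} (hr : r ≠ 0) (z : A)
    (hz : algebraMap R A r * z = 0) : z = 0 := by
  rw [← Algebra.smul_def] at hz
  refine b.repr.injective (Finsupp.ext fun i => ?_)
  have := DFunLike.congr_fun (congrArg b.repr hz) i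
  simpa [hr] using this

/-- A free algebra over `R` without nontrivial idempotents is a domain, if for each `F` the ideal
`ann F + ann (ann F)` contains the images of two coprime elements. -/
theorem noZeroDivisors_of_annihilators {R A ι : Type*} [CommRing R] [IsDomain R] [CommRing A]
    [Algebra R A] [Finite ι] (b : Basis ι R A) (hid : ∀ c : A, c * c = c → c = 0 ∨ c = 1)
    (h : ∀ F : A, ∃ r s : R, r ≠ 0 ∧ (∀ x, r ∣ s * x → r ∣ x) ∧
      algebraMap R A r ∈ (Ideal.span {F}).annihilator ⊔ (Ideal.span {F}).annihilator.annihilator ∧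
      algebraMap R A s ∈ (Ideal.span {F}).annihilator ⊔ (Ideal.span {F}).annihilator.annihilator) :
    NoZeroDivisors A := by
  refine ⟨fun {F G} hFG => ?_⟩
  obtain ⟨r, s, hr, hrs, h1, h2⟩ := h F
  obtain ⟨α, hα, β, hβ, e1⟩ := Submodule.mem_sup.1 h1
  obtain ⟨α', hα', β', hβ', e2⟩ := Submodule.mem_sup.1 h2
  have hprod : ∀ x ∈ (Ideal.span {F}).annihilator,
      ∀ y ∈ (Ideal.span {F}).annihilator.annihilator, y * x = 0 := fun x hx y hy =>
    Submodule.mem_annihilator.1 hy x hx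
  -- With `r = α + β` and `s = α' + β'`, the two annihilators multiply to zero, so the fraction `α /
  -- r = α' / s` is a section off the common zeros of `r` and `s`. Coprimality and freeness extend
  -- it to an element `c`, which is idempotent: it kills `F`, and `1 - c` kills `ann F`.
  have e3 : algebraMap R A s * α = algebraMap R A r * α' := by
    rw [← e1, ← e2]
    linear_combination hprod α hα β' hβ' - hprod α' hα' β hβ
  obtain ⟨c, rfl⟩ := b.algebraMap_dvd_of_dvd_mul hrs α ⟨α', e3⟩
  have hcF : c * F = 0 := b.algebraMap_mul_eq_zero hr _ (by
    rw [← mul_assoc]; exact (Submodule.mem_annihilator_span_singleton _ _).1 hα)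
  have hcG : ∀ x, x * F = 0 → (1 - c) * x = 0 := fun x hx => b.algebraMap_mul_eq_zero hr _ (by
    have h3 := hprod x ((Submodule.mem_annihilator_span_singleton _ _).2 hx) β hβ
    linear_combination h3 - x * e1)
  rcases hid c (by linear_combination -hcG c hcF) with rfl | rfl
  · right
    have := hcG G (by rw [mul_comm, hFG])
    simpa using this
  · left
    simpa using hcF

end Connectedness

/-! ### Points, translated variables and idempotents in polynomial rings. -/

section PolynomialLemmas

open MvPolynomial

theorem MvPolynomial.mem_span_X_sub_C_of_eval_eq_zero {σ k : Type*} [CommRing k] (x : σ → k)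
    {P : MvPolynomial σ k} (hP : eval x P = 0) :
    P ∈ Ideal.span (Set.range fun l => (X l - C (x l) : MvPolynomial σ k)) := by
  set J := Ideal.span (Set.range fun l => (X l - C (x l) : MvPolynomial σ k))
  have h : ∀ Q : MvPolynomial σ k, Q - C (eval x Q) ∈ J := by
    intro Q
    induction Q using MvPolynomial.induction_on with
    | C a => simp
    | add a b ha hb =>
      rw [map_add, C_add, add_sub_add_comm]
      exact J.add_mem ha hb
    | mul_X a l ha =>
      have e : a * X l - C (eval x (a * X l))
          = X l * (a - C (eval x a)) + C (eval x a) * (X l - C (x l)) := by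
        rw [map_mul, eval_X, C_mul]; ring
      rw [e]
      exact J.add_mem (J.mul_mem_left _ ha) (J.mul_mem_left _ (Ideal.subset_span ⟨l, rfl⟩))
  simpa [hP] using h P

theorem MvPolynomial.X_sub_C_dvd_of_dvd_mul {σ k : Type*} [Field k] {i j : σ} (hij : i ≠ j)
    (a b : k) (g : MvPolynomial σ k)
    (h : (X i - C a : MvPolynomial σ k) ∣ (X j - C b) * g) : (X i - C a : MvPolynomial σ k) ∣ g :=
        by
  classical
  have hdeg : (X i - C a : MvPolynomial σ k).totalDegree = 1 := by
    rw [sub_eq_add_neg, ← C_neg, totalDegree_add_eq_left_of_totalDegree_lt, totalDegree_X]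
    rw [totalDegree_X, totalDegree_C]
    exact zero_lt_one
  have hirr : Irreducible (X i - C a : MvPolynomial σ k) := by
    refine irreducible_of_totalDegree_eq_one hdeg fun x hx => ?_
    have h1 := hx (Finsupp.single i 1)
    have h2 : (0 : σ →₀ ℕ) ≠ Finsupp.single i 1 := by simp [eq_comm]
    rw [coeff_sub, coeff_X, coeff_C, if_neg h2, if_pos rfl, sub_zero] at h1
    exact isUnit_of_dvd_one h1
  refine (hirr.prime.dvd_or_dvd h).resolve_left ?_
  rintro ⟨c, hc⟩
  have := congrArg (eval (Function.update (fun _ => a) j (b + 1))) hc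
  simp [Function.update_of_ne hij] at this

/-- A quotient of a polynomial ring by a homogeneous ideal has no nontrivial idempotents. -/
theorem MvPolynomial.eq_zero_or_one_of_isIdempotent {σ k : Type*} [Finite σ] [Field k]
    {I : Ideal (MvPolynomial σ k)} (hI : ∀ p ∈ I, ∀ n, homogeneousComponent n p ∈ I)
    (hI0 : ∀ p ∈ I, eval 0 p = 0) (c : MvPolynomial σ k ⧸ I) (hc : c * c = c) : c = 0 ∨ c = 1 := by
  -- Modulo `I` one has `P = P ^ (j + 1)`, and the right side has no component of degree `j` when
  -- `P` has no constant term. So every homogeneous component of `P` lies in `I`.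
  have key : ∀ P : MvPolynomial σ k, P * P - P ∈ I → eval 0 P = 0 → P ∈ I := by
    intro P hP hP0
    have hpow : ∀ n, P ^ (n + 1) - P ∈ I := by
      intro n
      induction n with
      | zero => simp
      | succ n ih =>
        have : P ^ (n + 1 + 1) - P = P * (P ^ (n + 1) - P) + (P * P - P) := by ring
        rw [this]
        exact I.add_mem (I.mul_mem_left _ ih) hP
    have hPv : P ∈ idealOfVars σ k := by
      rw [← pow_one (idealOfVars σ k), mem_pow_idealOfVars_iff']
      intro d hd
      have : d = 0 := (Finsupp.degree_eq_zero_iff d).1 (by omega)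
      rw [this]
      simpa [← constantCoeff_eq, eval_zero] using hP0
    rw [← sum_homogeneousComponent P]
    refine Ideal.sum_mem _ fun j _ => ?_
    have h1 : homogeneousComponent j (P ^ (j + 1)) = 0 := by
      have h2 := (mem_pow_idealOfVars_iff' _ _).1 (Ideal.pow_mem_pow hPv (j + 1))
      ext d
      rw [coeff_homogeneousComponent, coeff_zero]
      split_ifs with hd
      · exact h2 d (by omega)
      · rfl
    have h2 := hI _ (hpow j) j
    rw [map_sub, h1, zero_sub] at h2
    exact neg_mem_iff.1 h2
  obtain ⟨P, rfl⟩ := Ideal.Quotient.mk_surjective c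
  have hP : P * P - P ∈ I := by
    rw [← Ideal.Quotient.eq_zero_iff_mem, map_sub, map_mul, hc, sub_self]
  have h0 := hI0 _ hP
  rw [map_sub, map_mul] at h0
  have h0' : eval 0 P * (eval 0 P - 1) = 0 := by linear_combination h0
  rcases mul_eq_zero.1 h0' with h | h
  · exact Or.inl (Ideal.Quotient.eq_zero_iff_mem.2 (key P hP h))
  · right
    have h1 := key (1 - P) (by
      have : (1 - P) * (1 - P) - (1 - P) = P * P - P := by ring
      rwa [this]) (by rw [map_sub, map_one, ← neg_sub, h, neg_zero])
    have h2 := Ideal.Quotient.eq_zero_iff_mem.2 h1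
    rw [map_sub, map_one, sub_eq_zero] at h2
    exact h2.symm

end PolynomialLemmas

/-! ### Tangent and cotangent spaces of cones over linear sections. -/

section LinearSections

open MvPolynomial Matrix

theorem Matrix.pfaffianPolar_sum_smul {A σ : Type*} [CommRing A] (s : Finset σ) (u : σ → A)
    (M : Matrix (Fin 5) (Fin 5) A) (N : σ → Matrix (Fin 5) (Fin 5) A) (i : Fin 5) :
    pfaffianPolar M (∑ l ∈ s, u l • N l) i = ∑ l ∈ s, u l * pfaffianPolar M (N l) i := by
  classical
  induction s using Finset.induction_on with
  | empty => fin_cases i <;> simp [pfaffianPolar]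
  | insert a s ha ih =>
    rw [Finset.sum_insert ha, Finset.sum_insert ha, ← ih]
    fin_cases i <;> simp [pfaffianPolar] <;> ring

section General

variable {σ : Type*} [Fintype σ] (N : σ → Matrix (Fin 5) (Fin 5) ℂ)

/-- The differential at `x` of the map `x ↦ pfaffians (∑ xₗ Nₗ)`. -/
noncomputable def pfaffianDifferential (x : σ → ℂ) : (σ → ℂ) →ₗ[ℂ] (Fin 5 → ℂ) where
  toFun u := pfaffianPolar (evalMatrix N x) (evalMatrix N u)
  map_add' u v := by
    ext i
    simp [evalMatrix, pfaffianPolar_sum_smul, add_mul, Finset.sum_add_distrib]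
  map_smul' c u := by
    ext i
    simp [evalMatrix, pfaffianPolar_sum_smul, Finset.mul_sum, mul_assoc]

theorem pfaffianDifferential_apply (x u : σ → ℂ) :
    pfaffianDifferential N x u = pfaffianPolar (evalMatrix N x) (evalMatrix N u) := rfl

theorem pfaffianDifferential_apply_eq_sum (x u : σ → ℂ) (i : Fin 5) :
    pfaffianDifferential N x u i = ∑ l, u l * pfaffianPolar (evalMatrix N x) (N l) i :=
  pfaffianPolar_sum_smul _ _ _ _ _

variable {N}

attribute [local instance] MvPolynomial.gradedAlgebra in
theorem isHomogeneous_pfaffianIdeal {P : MvPolynomial σ ℂ} (hP : P ∈ pfaffianIdeal N) (n : ℕ) :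
    homogeneousComponent n P ∈ pfaffianIdeal N := by
  refine homogeneousComponent_mem_of_mem (Ideal.homogeneous_span _ _ ?_) hP n
  rintro _ ⟨i, rfl⟩
  exact ⟨2, isHomogeneous_pfaffians_linearMatrix N i⟩

theorem eval_eq_zero_of_mem_pfaffianIdeal {x : σ → ℂ} (hx : pfaffians (evalMatrix N x) = 0)
    {P : MvPolynomial σ ℂ} (hP : P ∈ pfaffianIdeal N) : eval x P = 0 := by
  have : pfaffianIdeal N ≤ RingHom.ker (eval x) := Ideal.span_le.2 (by
    rintro _ ⟨i, rfl⟩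
    exact (eval_pfaffians_linearMatrix N x i).trans (congrFun hx i))
  exact this hP

theorem pfaffians_evalMatrix_zero : pfaffians (evalMatrix N 0) = 0 := by
  ext i
  fin_cases i <;> simp [evalMatrix, pfaffians]

/-- Evaluation of elements of the homogeneous coordinate ring at a point of the cone. -/
noncomputable def evalQuotient {x : σ → ℂ} (hx : pfaffians (evalMatrix N x) = 0) :
    MvPolynomial σ ℂ ⧸ pfaffianIdeal N →+* ℂ :=
  Ideal.Quotient.lift _ (eval x) fun _ h => eval_eq_zero_of_mem_pfaffianIdeal hx h

/-- The cotangent space of the cone at `x` is generated by two linear forms if they have no common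
zero on the tangent space. -/
theorem ker_evalQuotient_le_span_pair_sup_sq {x : σ → ℂ}
    (hx : pfaffians (evalMatrix N x) = 0) (e b : σ → ℂ)
    (h : ∀ u, pfaffianDifferential N x u = 0 → ∑ l, e l * u l = 0 → ∑ l, b l * u l = 0 → u = 0) :
    RingHom.ker (evalQuotient hx) ≤ Ideal.span
      {Ideal.Quotient.mk (pfaffianIdeal N) (∑ l, C (e l) * (X l - C (x l))),
        Ideal.Quotient.mk (pfaffianIdeal N) (∑ l, C (b l) * (X l - C (x l)))}
      ⊔ RingHom.ker (evalQuotient hx) ^ 2 := by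
  classical
  set m := RingHom.ker (evalQuotient hx)
  set π := Ideal.Quotient.mk (pfaffianIdeal N)
  set K := Ideal.span {π (∑ l, C (e l) * (X l - C (x l))), π (∑ l, C (b l) * (X l - C (x l)))}
    ⊔ m ^ 2
  have hXm : ∀ l, π (X l - C (x l)) ∈ m := fun l => by
    change evalQuotient hx (π _) = 0
    simp [evalQuotient, π]
  let Δ : Matrix (Fin 5) (Fin 5) (MvPolynomial σ ℂ) :=
    ∑ l, (X l - C (x l) : MvPolynomial σ ℂ) • (N l).map C
  -- Taylor expansion at `x`, with increment `Δ`: the linear part of each Pfaffian is minus its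
  -- quadratic part modulo the ideal, hence lies in the square of the maximal ideal.
  have hdiff : ∀ i, ∑ l, C (pfaffianPolar (evalMatrix N x) (N l) i) * (X l - C (x l))
      = pfaffians (linearMatrix N) i - pfaffians Δ i := by
    intro i
    have h1 : linearMatrix N = (evalMatrix N x).map C + Δ := by
      ext1 a b
      simp [linearMatrix_apply, evalMatrix, Δ, Matrix.sum_apply, sub_mul]
    rw [h1, pfaffians_add, Pi.add_apply, Pi.add_apply, pfaffians_map, hx, Pi.zero_apply, map_zero,
      zero_add, add_sub_cancel_right, pfaffianPolar_sum_smul]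
    exact Finset.sum_congr rfl fun l _ => by rw [pfaffianPolar_map, mul_comm]
  have hΔ : ∀ a b, π (Δ a b) ∈ m := by
    intro a b
    simp only [Δ, Matrix.sum_apply, Matrix.smul_apply, smul_eq_mul, map_sum]
    refine m.sum_mem fun l _ => ?_
    rw [map_mul]
    exact m.mul_mem_right _ (hXm l)
  have hΔ2 : ∀ i, π (pfaffians Δ i) ∈ m ^ 2 := by
    have h2 : ∀ a b c d, π (Δ a b) * π (Δ c d) ∈ m ^ 2 := fun a b c d =>
      pow_two m ▸ Ideal.mul_mem_mul (hΔ a b) (hΔ c d)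
    intro i
    have h3 := fun a b c d a' b' c' d' a'' b'' c'' d'' => (m ^ 2).add_mem ((m ^ 2).sub_mem
      (h2 a b c d) (h2 a' b' c' d')) (h2 a'' b'' c'' d'')
    fin_cases i <;> simp only [pfaffians, Fin.isValue, Fin.zero_eta, Fin.mk_one, Fin.reduceFinMk,
      cons_val_zero, cons_val_one, cons_val, map_neg, map_add, map_sub, map_mul, neg_mem_iff] <;>
      exact h3 _ _ _ _ _ _ _ _ _ _ _ _
  have hgrad : ∀ i, π (∑ l, C (pfaffianPolar (evalMatrix N x) (N l) i) * (X l - C (x l))) ∈ K := by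
    intro i
    have h0 : π (pfaffians (linearMatrix N) i) = 0 :=
      Ideal.Quotient.eq_zero_iff_mem.2 (Ideal.subset_span ⟨i, rfl⟩)
    rw [hdiff, map_sub, h0, zero_sub]
    exact K.neg_mem (Ideal.mem_sup_right (hΔ2 i))
  let L : Option (Option (Fin 5)) → ((σ → ℂ) →ₗ[ℂ] ℂ) := fun o => match o with
    | none => Fintype.linearCombination ℂ e
    | some none => Fintype.linearCombination ℂ b
    | some (some i) => LinearMap.proj i ∘ₗ pfaffianDifferential N x
  have hLe : ∀ u, L none u = ∑ l, e l * u l := fun u => by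
    simp [L, Fintype.linearCombination_apply, mul_comm]
  have hLb : ∀ u, L (some none) u = ∑ l, b l * u l := fun u => by
    simp [L, Fintype.linearCombination_apply, mul_comm]
  have hXK : ∀ l, π (X l - C (x l)) ∈ K := by
    intro l
    -- By duality: the forms `e`, `b` and the differentials of the Pfaffians have no common zero, so
    -- they span all coordinate functionals.
    have h1 : LinearMap.proj l ∈ Submodule.span ℂ (Set.range L) := by
      refine mem_span_of_iInf_ker_le_ker fun u hu => ?_
      rw [Submodule.mem_iInf] at hu
      have : u = 0 := h u (funext fun i => hu (some (some i))) ((hLe u).symm.trans (hu none))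
        ((hLb u).symm.trans (hu (some none)))
      simp [this]
    obtain ⟨c, hc⟩ := (Submodule.mem_span_range_iff_exists_fun ℂ).1 h1
    have h2 : ∀ l', (if l = l' then 1 else 0 : ℂ) = c none * e l' + c (some none) * b l'
        + ∑ i, c (some (some i)) * pfaffianPolar (evalMatrix N x) (N l') i := by
      intro l'
      have := LinearMap.congr_fun hc (Pi.single l' 1)
      simp only [Fintype.sum_option, LinearMap.add_apply, LinearMap.smul_apply, hLe, hLb,
        LinearMap.sum_apply, smul_eq_mul] at this
      simp only [L, LinearMap.comp_apply, LinearMap.proj_apply, pfaffianDifferential_apply_eq_sum]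
        at this
      simp only [Pi.single_apply, mul_ite, mul_one, mul_zero, Finset.sum_ite_eq',
        Finset.mem_univ, if_true, ite_mul, one_mul, zero_mul] at this
      rw [add_assoc, this]
    have h3 : (X l - C (x l) : MvPolynomial σ ℂ)
        = C (c none) * ∑ l', C (e l') * (X l' - C (x l'))
          + C (c (some none)) * ∑ l', C (b l') * (X l' - C (x l'))
          + ∑ i, C (c (some (some i))) *
            ∑ l', C (pfaffianPolar (evalMatrix N x) (N l') i) * (X l' - C (x l')) := by
      have h4 : (X l - C (x l) : MvPolynomial σ ℂ)
          = ∑ l', C (if l = l' then 1 else 0 : ℂ) * (X l' - C (x l')) := by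
        simp [apply_ite C]
      rw [h4]
      simp only [h2, C_add, C_mul, map_sum, add_mul, Finset.sum_add_distrib, Finset.mul_sum,
        Finset.sum_mul, mul_assoc]
      rw [Finset.sum_comm (s := Finset.univ (α := σ)) (t := Finset.univ (α := Fin 5))]
    rw [h3, map_add, map_add, map_mul, map_mul]
    refine K.add_mem (K.add_mem (K.mul_mem_left _ ?_) (K.mul_mem_left _ ?_)) ?_
    · exact Ideal.mem_sup_left (Ideal.subset_span (by simp))
    · exact Ideal.mem_sup_left (Ideal.subset_span (by simp))
    · rw [map_sum]
      refine K.sum_mem fun i _ => ?_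
      rw [map_mul]
      exact K.mul_mem_left _ (hgrad i)
  intro y hy
  obtain ⟨P, rfl⟩ := Ideal.Quotient.mk_surjective y
  have hP : eval x P = 0 := hy
  have h1 := Ideal.mem_map_of_mem π (mem_span_X_sub_C_of_eval_eq_zero x hP)
  rw [Ideal.map_span] at h1
  refine Ideal.span_le.2 ?_ h1
  rintro _ ⟨_, ⟨l, rfl⟩, rfl⟩
  exact hXK l

end General

end LinearSections

/-! ### Primality and Hilbert function of the Pfaffian ideal. -/

section EllipticQuintics

open MvPolynomial Matrix

attribute [local instance] lastVariablesAlgebra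

variable {N : Fin 3 ⊕ Fin 2 → Matrix (Fin 5) (Fin 5) ℂ}

theorem exists_lastVariable_ne_zero (hbpf : ∀ x, pfaffians (evalMatrix (N ∘ Sum.inl) x) = 0 → x = 0)
    {x : Fin 3 ⊕ Fin 2 → ℂ} (hx : pfaffians (evalMatrix N x) = 0) (hx0 : x ≠ 0) :
    ∃ i, x (Sum.inr i) ≠ 0 := by
  by_contra! h
  refine hx0 ?_
  have h1 : evalMatrix (N ∘ Sum.inl) (x ∘ Sum.inl) = evalMatrix N x := by
    simp [evalMatrix, Fintype.sum_sum_type, h]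
  have h2 := hbpf (x ∘ Sum.inl) (by rw [h1, hx])
  ext l
  rcases l with l | l
  exacts [congrFun h2 l, h l]

theorem mk_sum_single (x : Fin 3 ⊕ Fin 2 → ℂ) (i : Fin 2) :
    Ideal.Quotient.mk (pfaffianIdeal N) (∑ l, C ((Pi.single (Sum.inr i) 1 : Fin 3 ⊕ Fin 2 → ℂ) l)
      * (X l - C (x l))) = algebraMap (MvPolynomial (Fin 2) ℂ) _ (X i - C (x (Sum.inr i))) := by
  have h : (∑ l, C ((Pi.single (Sum.inr i) 1 : Fin 3 ⊕ Fin 2 → ℂ) l) * (X l - C (x l)) :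
      MvPolynomial (Fin 3 ⊕ Fin 2) ℂ) = rename Sum.inr (X i - C (x (Sum.inr i))) := by
    rw [Finset.sum_eq_single (Sum.inr i)]
    · simp
    · intro l _ hl
      simp [Pi.single_eq_of_ne hl]
    · simp
  rw [h]
  rfl

theorem evalQuotient_algebraMap {x : Fin 3 ⊕ Fin 2 → ℂ} (hx : pfaffians (evalMatrix N x) = 0)
    (i : Fin 2) : algebraMap (MvPolynomial (Fin 2) ℂ) (MvPolynomial (Fin 3 ⊕ Fin 2) ℂ ⧸
      pfaffianIdeal N) (X i - C (x (Sum.inr i))) ∈ RingHom.ker (evalQuotient hx) := by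
  rw [← mk_sum_single]
  change eval x _ = 0
  simp

theorem exists_other_index (i : Fin 2) : ∃ j : Fin 2, i ≠ j :=
  ⟨i + 1, by fin_cases i <;> decide⟩

theorem finrank_inf_ker_lt {E : Type*} [AddCommGroup E] [Module ℂ E] [FiniteDimensional ℂ E]
    (T : Submodule ℂ E) (f : Dual ℂ E) {x : E} (hx : x ∈ T) (hf : f x ≠ 0) :
    finrank ℂ (T ⊓ LinearMap.ker f : Submodule ℂ E) < finrank ℂ T :=
  Submodule.finrank_lt_finrank_of_lt (lt_of_le_of_ne inf_le_left fun h =>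
    hf (h.symm ▸ hx : x ∈ T ⊓ LinearMap.ker f).2)

theorem mem_ker_pfaffianDifferential_self {σ : Type*} [Fintype σ]
    {N : σ → Matrix (Fin 5) (Fin 5) ℂ} {x : σ → ℂ} (hx : pfaffians (evalMatrix N x) = 0) :
    x ∈ LinearMap.ker (pfaffianDifferential N x) := by
  rw [LinearMap.mem_ker, pfaffianDifferential_apply, pfaffianPolar_self, hx, smul_zero]

/-- Some last coordinate `xᵢ` is nonzero. Homogeneity puts `x` itself in the tangent space, so the
form `uᵢ` cuts its dimension to at most one, and one more form `b` cuts it to zero: two elements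
generate the maximal ideal. By freeness the two translated last variables form a regular sequence,
the first of them being one of these generators. -/
theorem noZeroDivisors_atPrime_ker_evalQuotient (hN : ∀ l, (N l).IsAlternating)
    (hbpf : ∀ x, pfaffians (evalMatrix (N ∘ Sum.inl) x) = 0 → x = 0)
    {x : Fin 3 ⊕ Fin 2 → ℂ} (hx : pfaffians (evalMatrix N x) = 0) (hx0 : x ≠ 0)
    (htan : finrank ℂ (LinearMap.ker (pfaffianDifferential N x)) ≤ 2) :
    have := RingHom.ker_isPrime (evalQuotient hx)
    NoZeroDivisors (Localization.AtPrime (RingHom.ker (evalQuotient hx))) := by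
  have := RingHom.ker_isPrime (evalQuotient hx)
  obtain ⟨q, β, -, -⟩ := exists_basis_quotient_pfaffianIdeal hN hbpf
  obtain ⟨i, hi⟩ := exists_lastVariable_ne_zero hbpf hx hx0
  obtain ⟨j, hij⟩ := exists_other_index i
  set T := LinearMap.ker (pfaffianDifferential N x)
  have h1 := finrank_inf_ker_lt T (LinearMap.proj (Sum.inr i))
    (mem_ker_pfaffianDifferential_self hx) hi
  obtain ⟨b, hb⟩ : ∃ b : Fin 3 ⊕ Fin 2 → ℂ, ∀ u ∈ T ⊓ LinearMap.ker (LinearMap.proj (Sum.inr i)),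
      ∑ l, b l * u l = 0 → u = 0 := by
    obtain ⟨v, hv⟩ := finrank_le_one_iff.1 (show finrank ℂ
      (T ⊓ LinearMap.ker (LinearMap.proj (Sum.inr i)) : Submodule ℂ _) ≤ 1 by omega)
    by_cases hv0 : (v : Fin 3 ⊕ Fin 2 → ℂ) = 0
    · refine ⟨0, fun u hu _ => ?_⟩
      obtain ⟨c, hc⟩ := hv ⟨u, hu⟩
      have := congrArg Subtype.val hc
      simpa [hv0] using this.symm
    · obtain ⟨l, hl⟩ := Function.ne_iff.1 hv0
      refine ⟨Pi.single l 1, fun u hu h0 => ?_⟩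
      obtain ⟨c, hc⟩ := hv ⟨u, hu⟩
      have h2 : c • (v : Fin 3 ⊕ Fin 2 → ℂ) = u := congrArg Subtype.val hc
      have h3 : u l = 0 := by
        simpa [Pi.single_apply] using h0
      rw [← h2] at h3 ⊢
      have : c = 0 := (mul_eq_zero.1 h3).resolve_right hl
      rw [this, zero_smul]
  have hle := ker_evalQuotient_le_span_pair_sup_sq hx (Pi.single (Sum.inr i) 1) b
    fun u hu he hb' => hb u ⟨hu, by simpa [Pi.single_apply] using he⟩ hb'
  rw [mk_sum_single] at hle
  refine noZeroDivisors_atPrime (evalQuotient_algebraMap hx i) ?_ (evalQuotient_algebraMap hx j) hle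
    (fun z hz => β.algebraMap_mul_eq_zero ?_ z hz)
    (fun z hz => β.algebraMap_dvd_of_dvd_mul (X_sub_C_dvd_of_dvd_mul hij _ _) z hz)
  · change eval x _ = 0
    simp
  · intro h0
    have := congrArg (eval fun _ => x (Sum.inr i) + 1) h0
    simp at this

/-- Otherwise the single function `Xᵢ - xᵢ` would generate the cotangent space, although the
translated last variables form a regular sequence of length two. -/
theorem two_le_finrank_ker_pfaffianDifferential (hN : ∀ l, (N l).IsAlternating)
    (hbpf : ∀ x, pfaffians (evalMatrix (N ∘ Sum.inl) x) = 0 → x = 0)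
    {x : Fin 3 ⊕ Fin 2 → ℂ} (hx : pfaffians (evalMatrix N x) = 0) (hx0 : x ≠ 0) :
    2 ≤ finrank ℂ (LinearMap.ker (pfaffianDifferential N x)) := by
  by_contra! hlt
  have := RingHom.ker_isPrime (evalQuotient hx)
  obtain ⟨q, β, -, -⟩ := exists_basis_quotient_pfaffianIdeal hN hbpf
  obtain ⟨i, hi⟩ := exists_lastVariable_ne_zero hbpf hx hx0
  obtain ⟨j, hij⟩ := exists_other_index i
  set T := LinearMap.ker (pfaffianDifferential N x)
  have h1 := finrank_inf_ker_lt T (LinearMap.proj (Sum.inr i))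
    (mem_ker_pfaffianDifferential_self hx) hi
  have h2 : T ⊓ LinearMap.ker (LinearMap.proj (Sum.inr i)) = ⊥ :=
    Submodule.finrank_eq_zero.1 (by omega)
  have hle := ker_evalQuotient_le_span_pair_sup_sq hx (Pi.single (Sum.inr i) 1) 0
    fun u hu he _ => by
      have : u ∈ T ⊓ LinearMap.ker (LinearMap.proj (Sum.inr i)) :=
        ⟨hu, by simpa [Pi.single_apply] using he⟩
      rwa [h2, Submodule.mem_bot] at this
  rw [mk_sum_single] at hle
  refine not_le_span_singleton_sup_sq (evalQuotient_algebraMap hx i)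
    (evalQuotient_algebraMap hx j)
    (fun z hz => β.algebraMap_dvd_of_dvd_mul (X_sub_C_dvd_of_dvd_mul hij _ _) z hz) (hle.trans ?_)
  simp [Set.pair_comm _ (0 : MvPolynomial (Fin 3 ⊕ Fin 2) ℂ ⧸ pfaffianIdeal N)]

theorem noZeroDivisors_quotient_pfaffianIdeal (hN : ∀ l, (N l).IsAlternating)
    (hbpf : ∀ x, pfaffians (evalMatrix (N ∘ Sum.inl) x) = 0 → x = 0)
    (htan : ∀ x, pfaffians (evalMatrix N x) = 0 → x ≠ 0 →
      finrank ℂ (LinearMap.ker (pfaffianDifferential N x)) ≤ 2) :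
    NoZeroDivisors (MvPolynomial (Fin 3 ⊕ Fin 2) ℂ ⧸ pfaffianIdeal N) := by
  obtain ⟨q, β, -, -⟩ := exists_basis_quotient_pfaffianIdeal hN hbpf
  refine noZeroDivisors_of_annihilators β (eq_zero_or_one_of_isIdempotent
    (fun p hp n => isHomogeneous_pfaffianIdeal hp n)
    fun p hp => eval_eq_zero_of_mem_pfaffianIdeal pfaffians_evalMatrix_zero hp) fun F => ?_
  set J := (Ideal.span {F}).annihilator ⊔ (Ideal.span {F}).annihilator.annihilator
  -- The local rings off the origin are domains, so `ann F + ann (ann F)` has no zero there. By the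
  -- Nullstellensatz it contains powers of both last variables, which are the required coprime
  -- elements.
  have hX : ∀ i, (X (Sum.inr i) : MvPolynomial (Fin 3 ⊕ Fin 2) ℂ)
      ∈ (J.comap (Ideal.Quotient.mk (pfaffianIdeal N))).radical := by
    intro i
    rw [← vanishingIdeal_zeroLocus_eq_radical (K := ℂ), mem_vanishingIdeal_iff]
    intro x hx
    have hx1 : pfaffians (evalMatrix N x) = 0 := funext fun l => by
      rw [← eval_pfaffians_linearMatrix]
      refine hx _ (Ideal.mem_comap.2 ?_)
      have h0 : Ideal.Quotient.mk (pfaffianIdeal N) (pfaffians (linearMatrix N) l) = 0 :=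
        Ideal.Quotient.eq_zero_iff_mem.2 (Ideal.subset_span ⟨l, rfl⟩)
      rw [h0]
      exact J.zero_mem
    by_contra hne
    have hx0 : x ≠ 0 := by
      rintro rfl
      simp at hne
    have := RingHom.ker_isPrime (evalQuotient hx1)
    have := noZeroDivisors_atPrime_ker_evalQuotient hN hbpf hx1 hx0 (htan x hx1 hx0)
    refine not_annihilator_sup_annihilator_le (m := RingHom.ker (evalQuotient hx1)) F ?_
    intro y hy
    obtain ⟨P, rfl⟩ := Ideal.Quotient.mk_surjective y
    exact hx P (Ideal.mem_comap.2 hy)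
  choose n hn using hX
  refine ⟨X 0 ^ (n 0 + n 1), X 1 ^ (n 0 + n 1), pow_ne_zero _ (X_ne_zero _),
    X_pow_dvd_of_dvd_X_pow_mul (by decide) _, ?_, ?_⟩
  · have := Ideal.mem_comap.1 (Ideal.pow_mem_of_pow_mem _ (hn 0) (Nat.le_add_right _ (n 1)))
    rw [← rename_X, ← map_pow] at this
    exact this
  · have := Ideal.mem_comap.1 (Ideal.pow_mem_of_pow_mem _ (hn 1) (Nat.le_add_left _ (n 0)))
    rw [← rename_X, ← map_pow] at this
    exact this

theorem isPrime_pfaffianIdeal (hN : ∀ l, (N l).IsAlternating)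
    (hbpf : ∀ x, pfaffians (evalMatrix (N ∘ Sum.inl) x) = 0 → x = 0)
    (htan : ∀ x, pfaffians (evalMatrix N x) = 0 → x ≠ 0 →
      finrank ℂ (LinearMap.ker (pfaffianDifferential N x)) ≤ 2) :
    (pfaffianIdeal N).IsPrime := by
  have := noZeroDivisors_quotient_pfaffianIdeal hN hbpf htan
  have hne : pfaffianIdeal N ≠ ⊤ := fun h => by
    have h1 := eval_eq_zero_of_mem_pfaffianIdeal (N := N) (P := 1) pfaffians_evalMatrix_zero
      (h ▸ Submodule.mem_top)
    simp at h1
  have : Nontrivial (MvPolynomial (Fin 3 ⊕ Fin 2) ℂ ⧸ pfaffianIdeal N) :=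
    Ideal.Quotient.nontrivial_iff.2 hne
  exact (Ideal.Quotient.isDomain_iff_prime _).1 (NoZeroDivisors.to_isDomain _)

/-- A prime ideal is radical, so the Nullstellensatz identifies it with the vanishing ideal of the
cone. -/
theorem mem_pfaffianIdeal_iff (hN : ∀ l, (N l).IsAlternating)
    (hbpf : ∀ x, pfaffians (evalMatrix (N ∘ Sum.inl) x) = 0 → x = 0)
    (htan : ∀ x, pfaffians (evalMatrix N x) = 0 → x ≠ 0 →
      finrank ℂ (LinearMap.ker (pfaffianDifferential N x)) ≤ 2)
    (P : MvPolynomial (Fin 3 ⊕ Fin 2) ℂ) :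
    P ∈ pfaffianIdeal N ↔ ∀ x, pfaffians (evalMatrix N x) = 0 → eval x P = 0 := by
  refine ⟨fun hP x hx => eval_eq_zero_of_mem_pfaffianIdeal hx hP, fun h => ?_⟩
  have := isPrime_pfaffianIdeal hN hbpf htan
  rw [← IsPrime.vanishingIdeal_zeroLocus (K := ℂ) (pfaffianIdeal N), mem_vanishingIdeal_iff]
  intro x hx
  refine h x (funext fun l => ?_)
  rw [← eval_pfaffians_linearMatrix]
  exact hx _ (Ideal.subset_span ⟨l, rfl⟩)

theorem X_inr_notMem_pfaffianIdeal (hN : ∀ l, (N l).IsAlternating)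
    (hbpf : ∀ x, pfaffians (evalMatrix (N ∘ Sum.inl) x) = 0 → x = 0) (i : Fin 2) :
    (X (Sum.inr i) : MvPolynomial (Fin 3 ⊕ Fin 2) ℂ) ∉ pfaffianIdeal N := by
  obtain ⟨q, β, -, hβ⟩ := exists_basis_quotient_pfaffianIdeal hN hbpf
  intro h
  have h1 : algebraMap (MvPolynomial (Fin 2) ℂ) (MvPolynomial (Fin 3 ⊕ Fin 2) ℂ ⧸ pfaffianIdeal N)
      (X i) = 0 := by
    rw [← Ideal.Quotient.eq_zero_iff_mem, ← rename_X] at h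
    exact h
  have h2 := β.algebraMap_mul_eq_zero (X_ne_zero i) (β 0) (by rw [h1, zero_mul])
  exact β.ne_zero 0 h2

/-- The Hilbert function of an elliptic quintic curve in `ℙ⁴`. -/
theorem finrank_map_homogeneousSubmodule (hN : ∀ l, (N l).IsAlternating)
    (hbpf : ∀ x, pfaffians (evalMatrix (N ∘ Sum.inl) x) = 0 → x = 0) (k : ℕ) :
    finrank ℂ ((homogeneousSubmodule (Fin 3 ⊕ Fin 2) ℂ (k + 2)).map
      (Ideal.Quotient.mkₐ ℂ (pfaffianIdeal N)).toLinearMap) = 5 * (k + 2) := by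
  obtain ⟨q, β, hq, hβ⟩ := exists_basis_quotient_pfaffianIdeal hN hbpf
  -- Degrees of the coefficients complementary to the degrees `0, 1, 1, 1, 2` of the generators.
  -- Binary forms of degree `d` have dimension `d + 1`, so the total is `(k + 3) + 3 (k + 2) + (k +
  -- 1) = 5 (k + 2)`.
  let d : Fin 5 → ℕ := ![k + 2, k + 1, k + 1, k + 1, k]
  let e : Fin 5 → ℕ := ![0, 1, 1, 1, 2]
  have hde : ∀ i, e i + d i = k + 2 := by intro i; fin_cases i <;> simp [d, e] <;> omega
  have hgen : ∀ i, (moduleGenerators q i).IsHomogeneous (e i) := by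
    intro i
    fin_cases i
    · exact isHomogeneous_one _ _
    · exact isHomogeneous_X _ _
    · exact isHomogeneous_X _ _
    · exact isHomogeneous_X _ _
    · exact hq.rename_isHomogeneous
  let Ψ : (∀ i, homogeneousSubmodule (Fin 2) ℂ (d i)) →ₗ[ℂ] MvPolynomial (Fin 3 ⊕ Fin 2) ℂ :=
    ∑ i, LinearMap.mulRight ℂ (moduleGenerators q i) ∘ₗ
      (rename Sum.inr : MvPolynomial (Fin 2) ℂ →ₐ[ℂ] _).toLinearMap ∘ₗ
        (homogeneousSubmodule (Fin 2) ℂ (d i)).subtype ∘ₗ LinearMap.proj i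
  have hΨ : ∀ r, Ψ r = ∑ i, rename Sum.inr (r i : MvPolynomial (Fin 2) ℂ)
      * moduleGenerators q i := fun r => by simp [Ψ, LinearMap.sum_apply]
  let π := (Ideal.Quotient.mkₐ ℂ (pfaffianIdeal N)).toLinearMap
  have hπΨ : ∀ r : Fin 5 → MvPolynomial (Fin 2) ℂ,
      Ideal.Quotient.mk (pfaffianIdeal N) (∑ i, rename Sum.inr (r i) * moduleGenerators q i)
        = ∑ i, r i • β i := by
    intro r
    rw [map_sum]
    refine Finset.sum_congr rfl fun i _ => ?_
    rw [map_mul, hβ]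
    exact (Algebra.smul_def (A := MvPolynomial (Fin 3 ⊕ Fin 2) ℂ ⧸ pfaffianIdeal N) (r i) _).symm
  have hinj : Function.Injective (π ∘ₗ Ψ) := by
    rw [← LinearMap.ker_eq_bot, LinearMap.ker_eq_bot']
    intro r hr
    have h1 : ∑ i, (r i : MvPolynomial (Fin 2) ℂ) • β i = 0 := by
      rw [← hπΨ, ← hΨ]; exact hr
    have h2 := Fintype.linearIndependent_iff.1 β.linearIndependent _ h1
    exact funext fun i => Subtype.ext (h2 i)
  have hrange : (homogeneousSubmodule (Fin 3 ⊕ Fin 2) ℂ (k + 2)).map π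
      = LinearMap.range (π ∘ₗ Ψ) := by
    apply le_antisymm
    · rintro _ ⟨P, hP, rfl⟩
      let r := fun i => β.repr (Ideal.Quotient.mk _ P) i
      have h1 : P - ∑ i, rename Sum.inr (r i) * moduleGenerators q i ∈ pfaffianIdeal N := by
        rw [← Ideal.Quotient.eq_zero_iff_mem, map_sub, hπΨ, β.sum_repr, sub_self]
      refine ⟨fun i => ⟨homogeneousComponent (d i) (r i), homogeneousComponent_mem _ _⟩, ?_⟩
      have h2 := isHomogeneous_pfaffianIdeal h1 (k + 2)
      have h3 : ∀ i, homogeneousComponent (k + 2) (rename Sum.inr (r i) * moduleGenerators q i)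
          = rename Sum.inr (homogeneousComponent (d i) (r i)) * moduleGenerators q i := by
        intro i
        rw [mul_comm, ← hde i, homogeneousComponent_add_mul (hgen i), rename_homogeneousComponent,
          mul_comm]
      rw [map_sub, map_sum, homogeneousComponent_eq_self hP] at h2
      simp only [h3] at h2
      rw [← Ideal.Quotient.eq_zero_iff_mem, map_sub, sub_eq_zero] at h2
      rw [LinearMap.comp_apply, hΨ]
      exact h2.symm
    · rintro _ ⟨r, rfl⟩
      refine ⟨Ψ r, ?_, rfl⟩
      rw [hΨ]
      refine Submodule.sum_mem _ fun i _ => ?_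
      have h1 : (rename Sum.inr (r i : MvPolynomial (Fin 2) ℂ) :
        MvPolynomial (Fin 3 ⊕ Fin 2) ℂ).IsHomogeneous (d i) :=
        IsHomogeneous.rename_isHomogeneous (r i).2
      have h2 := (hgen i).mul h1
      rw [hde, mul_comm] at h2
      exact h2
  change finrank ℂ ((homogeneousSubmodule (Fin 3 ⊕ Fin 2) ℂ (k + 2)).map π) = _
  rw [hrange, LinearMap.finrank_range_of_inj hinj, Module.finrank_pi_fintype]
  simp only [MvPolynomial.finrank_homogeneousSubmodule, Finset.Nat.antidiagonalTuple_two,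
    Finset.card_map, Finset.Nat.card_antidiagonal, Fin.sum_univ_five, d]
  simp
  ring

end EllipticQuintics

/-! ### Plücker coordinates: bivectors as alternating matrices. -/

section PluckerCoordinates

open Matrix

/-- Expansion of `v ∧ (a ∧ b) ∧ (c ∧ d)` along `v`: the cofactors are bilinear in the two bivectors.
-/
theorem Matrix.det_fin_five_eq_sum_pfaffianPolar (A : Matrix (Fin 5) (Fin 5) ℂ) :
    A.det = ∑ i, A i 0 * pfaffianPolar (of fun i j => A i 1 * A j 2 - A j 1 * A i 2)
      (of fun i j => A i 3 * A j 4 - A j 3 * A i 4) i := by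
  have h4 (B : Matrix (Fin 4) (Fin 4) ℂ) : B.det = 
      B 0 0 * (B 1 1 * (B 2 2 * B 3 3 - B 2 3 * B 3 2) - B 1 2 * (B 2 1 * B 3 3 - B 2 3 * B 3 1)
        + B 1 3 * (B 2 1 * B 3 2 - B 2 2 * B 3 1))
      - B 0 1 * (B 1 0 * (B 2 2 * B 3 3 - B 2 3 * B 3 2) - B 1 2 * (B 2 0 * B 3 3 - B 2 3 * B 3 0)
        + B 1 3 * (B 2 0 * B 3 2 - B 2 2 * B 3 0))
      + B 0 2 * (B 1 0 * (B 2 1 * B 3 3 - B 2 3 * B 3 1) - B 1 1 * (B 2 0 * B 3 3 - B 2 3 * B 3 0)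
        + B 1 3 * (B 2 0 * B 3 1 - B 2 1 * B 3 0))
      - B 0 3 * (B 1 0 * (B 2 1 * B 3 2 - B 2 2 * B 3 1) - B 1 1 * (B 2 0 * B 3 2 - B 2 2 * B 3 0)
        + B 1 2 * (B 2 0 * B 3 1 - B 2 1 * B 3 0)) := by
    rw [det_succ_row_zero, Fin.sum_univ_four]
    simp only [det_fin_three, submatrix_apply, Fin.succAbove, Fin.reduceSucc, Fin.reduceCastSucc,
        Fin.reduceLT, if_true, if_false, Fin.isValue]
    simp
    ring
  rw [det_succ_column_zero, Fin.sum_univ_five, Fin.sum_univ_five]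
  simp only [h4, submatrix_apply, pfaffianPolar, of_apply, cons_val]
  congr 1
  · congr 1
    · congr 1
      · congr 1
        all_goals simp [Fin.succAbove, -mul_eq_mul_left_iff]; ring
      all_goals simp [Fin.succAbove, -mul_eq_mul_left_iff]; ring
    all_goals simp [Fin.succAbove, -mul_eq_mul_left_iff]; ring
  all_goals simp [Fin.succAbove, -mul_eq_mul_left_iff]; ring

set_option maxHeartbeats 1000000 in
-- The Plücker relations. If `M a b ≠ 0` they present `M`, up to this factor, as the exterior
-- product of its rows `a` and `b`.
theorem Matrix.IsAlternating.mul_eq_of_pfaffians_eq_zero {M : Matrix (Fin 5) (Fin 5) ℂ}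
    (hM : M.IsAlternating) (h : pfaffians M = 0) (a b i j : Fin 5) :
    M a b * M i j = M a i * M b j - M a j * M b i := by
  obtain ⟨h0, hs⟩ := hM
  have e0 := congrFun h 0
  have e1 := congrFun h 1
  have e2 := congrFun h 2
  have e3 := congrFun h 3
  have e4 := congrFun h 4
  simp only [pfaffians, cons_val_zero, cons_val_one, cons_val, Pi.zero_apply] at e0 e1 e2 e3 e4
  fin_cases a <;> fin_cases b <;> fin_cases i <;> fin_cases j <;>
    simp only [Fin.zero_eta, Fin.mk_one, Fin.reduceFinMk, h0, hs 0 1, hs 0 2, hs 0 3, hs 0 4, hs 1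
        2,
      hs 1 3, hs 1 4, hs 2 3, hs 2 4, hs 3 4] <;> 
    first
    | ring1
    | linear_combination e0
    | linear_combination e1
    | linear_combination e2
    | linear_combination e3
    | linear_combination e4
    | linear_combination -e0
    | linear_combination -e1
    | linear_combination -e2
    | linear_combination -e3
    | linear_combination -e4
end PluckerCoordinates

section PluckerCoordinates

open Matrix

/-- The bilinear map `Matrix.pfaffianPolar`. -/
noncomputable def Matrix.pfaffianPolarₗ : Matrix (Fin 5) (Fin 5) ℂ →ₗ[ℂ] Matrix (Fin 5) (Fin 5) ℂ
    →ₗ[ℂ] Fin 5 → ℂ :=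
  LinearMap.mk₂ ℂ pfaffianPolar
    (by intro M M' N; ext i; fin_cases i <;> simp [pfaffianPolar] <;> ring)
    (by intro c M N; ext i; fin_cases i <;> simp [pfaffianPolar] <;> ring)
    (by intro M M' N; ext i; fin_cases i <;> simp [pfaffianPolar] <;> ring)
    (by intro c M N; ext i; fin_cases i <;> simp [pfaffianPolar] <;> ring)

@[simp]
theorem Matrix.pfaffianPolarₗ_apply (M N : Matrix (Fin 5) (Fin 5) ℂ) :
    pfaffianPolarₗ M N = pfaffianPolar M N := rfl

theorem Matrix.pfaffianPolar_comm (M N : Matrix (Fin 5) (Fin 5) ℂ) :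
    pfaffianPolar M N = pfaffianPolar N M := by
  ext i; fin_cases i <;> simp [pfaffianPolar] <;> ring

variable {V : Type*} [AddCommGroup V] [Module ℂ V]

theorem wedge_vec_vec (a b : V) : wedge (vec a) (vec b) = exteriorPower.ιMulti ℂ 2 ![a, b] := by
  apply Subtype.ext
  simp [wedge, _root_.vec, ExteriorAlgebra.ιMulti_apply]

theorem pfaffian_wedge_vec_vec (vol : ⋀[ℂ]^5 V ≃ₗ[ℂ] ℂ) (v a b c d : V) :
    pfaffian vol v (wedge (vec a) (vec b)) (wedge (vec c) (vec d)) =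
      vol (exteriorPower.ιMulti ℂ 5 ![v, a, b, c, d]) := by
  unfold pfaffian
  congr 1
  apply Subtype.ext
  simp [wedge, _root_.vec, ExteriorAlgebra.ιMulti_apply, mul_assoc]

variable (e : Basis (Fin 5) ℂ V)

/-- The Plücker coordinates of a bivector, with respect to a basis. -/
noncomputable def plucker : ⋀[ℂ]^2 V →ₗ[ℂ] Matrix (Fin 5) (Fin 5) ℂ :=
  LinearMap.pi fun i => LinearMap.pi fun j => exteriorPower.alternatingMapLinearEquiv
    (detRowAlternating.compLinearMap (LinearMap.pi ![e.coord i, e.coord j]))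

theorem plucker_wedge (a b : V) (i j : Fin 5) :
    plucker e (wedge (vec a) (vec b)) i j =
      e.repr a i * e.repr b j - e.repr a j * e.repr b i := by
  rw [wedge_vec_vec]
  change exteriorPower.alternatingMapLinearEquiv _ _ = _
  rw [exteriorPower.alternatingMapLinearEquiv_apply_ιMulti]
  simp only [AlternatingMap.compLinearMap_apply]
  refine (det_fin_two (of fun k => LinearMap.pi ![e.coord i, e.coord j] (![a, b] k))).trans ?_
  simp

theorem ext_wedge_vec {N : Type*} [AddCommGroup N] [Module ℂ N] {f g : ⋀[ℂ]^2 V →ₗ[ℂ] N}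
    (h : ∀ a b, f (wedge (vec a) (vec b)) = g (wedge (vec a) (vec b))) : f = g := by
  apply exteriorPower.linearMap_ext
  ext v
  have := h (v 0) (v 1)
  rw [wedge_vec_vec] at this
  have hv : ![v 0, v 1] = v := by ext i; fin_cases i <;> rfl
  rw [hv] at this
  simpa using this

theorem isAlternating_plucker (x : ⋀[ℂ]^2 V) : (plucker e x).IsAlternating := by
  constructor
  · intro i
    have : (LinearMap.proj i ∘ₗ LinearMap.proj i ∘ₗ plucker e : ⋀[ℂ]^2 V →ₗ[ℂ] ℂ) = 0 := by
      apply ext_wedge_vec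
      intro a b
      change plucker e _ i i = 0
      rw [plucker_wedge]
      ring
    exact LinearMap.congr_fun this x
  · intro i j
    have : (LinearMap.proj i ∘ₗ LinearMap.proj j ∘ₗ plucker e : ⋀[ℂ]^2 V →ₗ[ℂ] ℂ) = 
       -(LinearMap.proj j ∘ₗ LinearMap.proj i ∘ₗ plucker e) := by
      apply ext_wedge_vec
      intro a b
      change plucker e _ j i = -plucker e _ i j
      rw [plucker_wedge, plucker_wedge]
      ring
    exact LinearMap.congr_fun this x

/-- The vector `v` of `V` as an element of `⋀¹ V`, linearly in `v`. -/
noncomputable def vecₗ : V →ₗ[ℂ] ⋀[ℂ]^1 V where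
  toFun := vec
  map_add' _ _ := Subtype.ext (map_add _ _ _)
  map_smul' _ _ := Subtype.ext (map_smul _ _ _)

@[simp] theorem vecₗ_apply (v : V) : vecₗ v = vec v := rfl

theorem wedge_vec_comm (a b : V) : wedge (vec b) (vec a) = -wedge (vec a) (vec b) := by
  apply Subtype.ext
  have := CliffordAlgebra.ι_mul_ι_add_swap_of_isOrtho (R := ℂ) (Q := (0 : QuadraticForm ℂ V)) (a :=
      b) (b := a) (by simp [QuadraticMap.IsOrtho])
  exact eq_neg_of_add_eq_zero_left this

/-- The factor two appears because each pair of basis vectors occurs in both orders. -/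
theorem sum_plucker_smul_wedge (x : ⋀[ℂ]^2 V) :
    ∑ i, ∑ j, plucker e x i j • wedge (vec (e i)) (vec (e j)) = (2 : ℂ) • x := by
  let F : ⋀[ℂ]^2 V →ₗ[ℂ] ⋀[ℂ]^2 V :=
    ∑ i, ∑ j, (LinearMap.proj j ∘ₗ LinearMap.proj i ∘ₗ plucker e : ⋀[ℂ]^2 V →ₗ[ℂ] ℂ).smulRight
      (wedge (vec (e i)) (vec (e j)))
  have hF : F = (2 : ℂ) • LinearMap.id := by
    apply ext_wedge_vec
    intro a b
    have key (a b : V) : ∑ i, ∑ j, (e.repr a i * e.repr b j) • wedge (vec (e i)) (vec (e j)) =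
        wedge (vec a) (vec b) := by
      conv_rhs => rw [← vecₗ_apply, ← vecₗ_apply, ← e.sum_repr a, ← e.sum_repr b]
      simp only [map_sum, map_smul, LinearMap.sum_apply, LinearMap.smul_apply, Finset.smul_sum,
        smul_smul, vecₗ_apply]
      rw [Finset.sum_comm]
      simp only [mul_comm]
    have h1 : F (wedge (vec a) (vec b)) = ∑ i, ∑ j, (e.repr a i * e.repr b j - e.repr a j * e.repr b
        i) • wedge (vec (e i)) (vec (e j)) := by
      simp only [← plucker_wedge e a b, F, LinearMap.sum_apply]
      rfl
    rw [h1]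
    have h3 : ∀ i j, (e.repr a i * e.repr b j - e.repr a j * e.repr b i) •
        wedge (vec (e i)) (vec (e j)) = (e.repr a i * e.repr b j) • wedge (vec (e i)) (vec (e j)) +
          (e.repr b i * e.repr (-a) j) • wedge (vec (e i)) (vec (e j)) := fun i j => by
      rw [← add_smul, map_neg, Finsupp.neg_apply]
      congr 1
      ring
    have h2 : wedge (vec b) (vec (-a)) = wedge (vec a) (vec b) := by
      rw [wedge_vec_comm, ← vecₗ_apply (-a), map_neg, map_neg, LinearMap.neg_apply, neg_neg,
        vecₗ_apply]
    simp only [h3, Finset.sum_add_distrib]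
    rw [key, key, h2, LinearMap.smul_apply, two_smul, LinearMap.id_apply]
  have := LinearMap.congr_fun hF x
  simp only [F, LinearMap.sum_apply] at this
  exact this

theorem plucker_injective : Function.Injective (plucker e) := by
  rw [← LinearMap.ker_eq_bot, LinearMap.ker_eq_bot']
  intro x hx
  have := sum_plucker_smul_wedge e x
  rw [hx] at this
  simpa using this.symm

/-- Both sides are bilinear in `x` and `y`, so decomposable bivectors suffice; there it is the
column expansion of a determinant. It translates statements about `vol` into matrix Pfaffians. -/
theorem pfaffian_eq (vol : ⋀[ℂ]^5 V ≃ₗ[ℂ] ℂ) (v : V) (x y : ⋀[ℂ]^2 V) :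
    pfaffian vol v x y = vol (exteriorPower.ιMulti ℂ 5 e) *
      ∑ i, e.repr v i * pfaffianPolar (plucker e x) (plucker e y) i := by
  let F : ⋀[ℂ]^2 V →ₗ[ℂ] ⋀[ℂ]^2 V →ₗ[ℂ] ℂ :=
    (wedge (i := 3) (j := 2)).compr₂ vol.toLinearMap ∘ₗ (wedge (i := 1) (j := 2) (vec v))
  let G : ⋀[ℂ]^2 V →ₗ[ℂ] ⋀[ℂ]^2 V →ₗ[ℂ] ℂ :=
    (pfaffianPolarₗ.compl₁₂ (plucker e) (plucker e)).compr₂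
      (vol (exteriorPower.ιMulti ℂ 5 e) • ∑ i, e.repr v i • LinearMap.proj i)
  have hFG : F = G := by
    apply ext_wedge_vec
    intro a b
    apply ext_wedge_vec
    intro c d
    change pfaffian vol v _ _ = _
    rw [pfaffian_wedge_vec_vec]
    have h1 := (vol.toLinearMap.compAlternatingMap (exteriorPower.ιMulti ℂ 5)).eq_smul_basis_det e
    have h2 := congrArg (fun f => f ![v, a, b, c, d]) h1
    simp only [LinearMap.compAlternatingMap_apply, AlternatingMap.smul_apply] at h2
    have h3 : G (wedge (vec a) (vec b)) (wedge (vec c) (vec d)) = vol (exteriorPower.ιMulti ℂ 5 e) *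
      ∑ i, e.repr v i * pfaffianPolar (plucker e (wedge (vec a) (vec b))) (plucker e (wedge (vec c)
          (vec d))) i := by
      simp [G]
    rw [h3]
    refine h2.trans ?_
    rw [smul_eq_mul, Basis.det_apply, det_fin_five_eq_sum_pfaffianPolar]
    congr 1
    refine Finset.sum_congr rfl fun i _ => ?_
    congr 2
    all_goals
      ext i j
      rw [plucker_wedge]
      simp [Basis.toMatrix_apply]
  have h4 := LinearMap.congr_fun (LinearMap.congr_fun hFG x) y
  refine Eq.trans h4 ?_
  simp [G]

theorem vol_basis_ne_zero (vol : ⋀[ℂ]^5 V ≃ₗ[ℂ] ℂ) : vol (exteriorPower.ιMulti ℂ 5 e) ≠ 0 := by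
  intro h
  have h1 := (vol.toLinearMap.compAlternatingMap (exteriorPower.ιMulti ℂ 5)).eq_smul_basis_det e
  have h2 : vol.toLinearMap = 0 := by
    apply exteriorPower.linearMap_ext
    rw [h1]
    simp [h]
  have h3 := LinearMap.congr_fun h2 (vol.symm 1)
  simp at h3

theorem pfaffian_comm (e : Basis (Fin 5) ℂ V) (vol : ⋀[ℂ]^5 V ≃ₗ[ℂ] ℂ) (v : V) (x y : ⋀[ℂ]^2 V) :
    pfaffian vol v x y = pfaffian vol v y x := by
  simp only [pfaffian_eq e, pfaffianPolar_comm (plucker e x)]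

/-- A nonzero entry `(a, b)` provides the factors: row `a`, and row `b` divided by that entry. -/
theorem pfaffians_plucker_eq_zero_iff (x : ⋀[ℂ]^2 V) :
    pfaffians (plucker e x) = 0 ↔ ∃ a b, x = wedge (vec a) (vec b) := by
  constructor
  · intro h
    by_cases h0 : plucker e x = 0
    · have : x = 0 := plucker_injective e (h0.trans (map_zero _).symm)
      exact ⟨0, 0, by rw [this, ← vecₗ_apply, map_zero, map_zero]⟩
    obtain ⟨a, b, hab⟩ : ∃ a b, plucker e x a b ≠ 0 := by
      by_contra! hc
      exact h0 (by ext a b; exact hc a b)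
    refine ⟨e.equivFun.symm fun j => plucker e x a j, e.equivFun.symm fun j => (plucker e x a b)⁻¹ *
        plucker e x b j, ?_⟩
    apply plucker_injective e
    ext i j
    rw [plucker_wedge]
    have := (isAlternating_plucker e x).mul_eq_of_pfaffians_eq_zero h a b i j
    have hr (f : Fin 5 → ℂ) (i : Fin 5) : e.repr (e.equivFun.symm f) i = f i := by
      rw [← e.equivFun_apply, LinearEquiv.apply_symm_apply]
    simp only [hr]
    field_simp
    linear_combination this
  · rintro ⟨a, b, rfl⟩
    have : plucker e (wedge (vec a) (vec b)) = of fun i j => e.repr a i * e.repr b j - e.repr a j *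
        e.repr b i := by
      ext i j; exact plucker_wedge e a b i j
    rw [this]
    ext i; fin_cases i <;> simp [pfaffians] <;> ring

end PluckerCoordinates

/-! ### The Lagrangian subspace and the kernels of the quadrics γ + P_v. -/

section Lagrangian

variable {V₅ : Type*} [AddCommGroup V₅] [Module ℂ V₅]

/-- The Pfaffian form `P_v`, bundled as a bilinear form. -/
noncomputable def pfaffianForm (vol : ⋀[ℂ]^5 V₅ ≃ₗ[ℂ] ℂ) (v : V₅) : LinearMap.BilinForm ℂ (⋀[ℂ]^2
    V₅) :=
  (wedge (i := 3) (j := 2)).compr₂ vol.toLinearMap ∘ₗ wedge (i := 1) (j := 2) (vec v)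

@[simp]
theorem pfaffianForm_apply (vol : ⋀[ℂ]^5 V₅ ≃ₗ[ℂ] ℂ) (v : V₅) (x y : ⋀[ℂ]^2 V₅) :
    pfaffianForm vol v x y = pfaffian vol v x y := rfl

theorem pfaffian_add_left (e : Basis (Fin 5) ℂ V₅) (vol : ⋀[ℂ]^5 V₅ ≃ₗ[ℂ] ℂ) (v v' : V₅)
    (x y : ⋀[ℂ]^2 V₅) :
    pfaffian vol (v + v') x y = pfaffian vol v x y + pfaffian vol v' x y := by
  simp [pfaffian_eq e, add_mul, Finset.sum_add_distrib, mul_add]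

theorem pfaffian_smul_left (e : Basis (Fin 5) ℂ V₅) (vol : ⋀[ℂ]^5 V₅ ≃ₗ[ℂ] ℂ) (a : ℂ) (v : V₅)
    (x y : ⋀[ℂ]^2 V₅) :
    pfaffian vol (a • v) x y = a * pfaffian vol v x y := by
  simp only [pfaffian_eq e, map_smul, Finsupp.smul_apply, smul_eq_mul, Finset.mul_sum]
  exact Finset.sum_congr rfl fun i _ => by ring

theorem eq_zero_of_forall_pfaffian_eq_zero (e : Basis (Fin 5) ℂ V₅)
    (vol : ⋀[ℂ]^5 V₅ ≃ₗ[ℂ] ℂ) (x : ⋀[ℂ]^2 V₅) (h : ∀ v y, pfaffian vol v x y = 0) : x = 0 := by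
  apply plucker_injective e
  rw [map_zero]
  have h1 : ∀ y i, Matrix.pfaffianPolar (plucker e x) (plucker e y) i = 0 := by
    intro y i
    have := h (e i) y
    rw [pfaffian_eq e] at this
    simpa [Finsupp.single_apply] using (mul_eq_zero.mp this).resolve_left (vol_basis_ne_zero e vol)
  have h2 : ∀ a b i j, plucker e (wedge (vec (e a)) (vec (e b))) i j = 
      (if a = i then 1 else 0) * (if b = j then 1 else 0) -
        (if a = j then 1 else 0) * (if b = i then 1 else 0) := by
    intro a b i j
    rw [plucker_wedge]
    simp [Finsupp.single_apply]
  obtain ⟨h0, hs⟩ := isAlternating_plucker e x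
  set M := plucker e x
  have h01 := h1 (wedge (vec (e 0)) (vec (e 1)))
  have h02 := h1 (wedge (vec (e 0)) (vec (e 2)))
  have h03 := h1 (wedge (vec (e 0)) (vec (e 3)))
  have h12 := h1 (wedge (vec (e 1)) (vec (e 2)))
  have h34 := h1 (wedge (vec (e 3)) (vec (e 4)))
  simp [Fin.forall_fin_succ, Matrix.pfaffianPolar, h2] at h01 h02 h03 h12 h34
  ext i j
  fin_cases i <;> fin_cases j <;> 
    simp [h0, hs 0 1, hs 0 2, hs 0 3, hs 0 4, hs 1 2, hs 1 3, hs 1 4, hs 2 3, hs 2 4, hs 3 4, h01,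
        h02, h03, h12, h34]

theorem addWedge_apply (η : ⋀[ℂ]^3 V₅) (w : ⋀[ℂ]^2 V₅) : addWedge (η, w) =
    ExteriorAlgebra.map (LinearMap.inl ℂ V₅ ℂ) η + ExteriorAlgebra.ι ℂ ((0, 1) : V₅ × ℂ) *
      ExteriorAlgebra.map (LinearMap.inl ℂ V₅ ℂ) w := by
  simp [addWedge]

/-- Specializing `x` to `v` detects both components: `v = 0` gives `η`, and the remaining `v`
determine `w`. This is how injectivity of `addWedge` is obtained. -/
theorem map_addWedge (v : V₅) (η : ⋀[ℂ]^3 V₅) (w : ⋀[ℂ]^2 V₅) :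
    ExteriorAlgebra.map (LinearMap.coprod LinearMap.id (LinearMap.toSpanSingleton ℂ V₅ v))
      (addWedge (η, w)) = η + (wedge (vec v) w : ExteriorAlgebra ℂ V₅) := by
  have h : (LinearMap.coprod LinearMap.id (LinearMap.toSpanSingleton ℂ V₅ v)) ∘ₗ
      LinearMap.inl ℂ V₅ ℂ = LinearMap.id := LinearMap.coprod_inl _ _
  have h' (x : ExteriorAlgebra ℂ V₅) : ExteriorAlgebra.map
      (LinearMap.coprod LinearMap.id (LinearMap.toSpanSingleton ℂ V₅ v))
        (ExteriorAlgebra.map (LinearMap.inl ℂ V₅ ℂ) x) = x := by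
    rw [← AlgHom.comp_apply, ExteriorAlgebra.map_comp_map, h, ExteriorAlgebra.map_id]
    rfl
  rw [addWedge_apply, map_add, map_mul, h', h', ExteriorAlgebra.map_apply_ι]
  simp [wedge, vec]

theorem addWedge_injective (e : Basis (Fin 5) ℂ V₅) (vol : ⋀[ℂ]^5 V₅ ≃ₗ[ℂ] ℂ) :
    Function.Injective (addWedge (V₅ := V₅)) := by
  rw [← LinearMap.ker_eq_bot, LinearMap.ker_eq_bot']
  rintro ⟨η, w⟩ h
  have h1 : ∀ v : V₅, (η : ExteriorAlgebra ℂ V₅) + (wedge (vec v) w : ⋀[ℂ]^3 V₅) = 0 := by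
    intro v
    rw [← map_addWedge, h, map_zero]
  have hη : η = 0 := by
    have := h1 0
    rw [← vecₗ_apply, map_zero, map_zero, LinearMap.zero_apply] at this
    simpa using this
  have hw : ∀ v, (wedge (vec v) w : ⋀[ℂ]^3 V₅) = 0 := by
    intro v
    have := h1 v
    rw [hη] at this
    simpa using this
  rw [hη, eq_zero_of_forall_pfaffian_eq_zero e vol w fun v y => by
    unfold pfaffian; rw [hw v, map_zero, LinearMap.zero_apply, map_zero], Prod.mk_zero_zero]

/-- The parametrization of `F_{(u, c)}` by `⋀² V₅`. -/
noncomputable def fibreParam (u : V₅) (c : ℂ) : ⋀[ℂ]^2 V₅ →ₗ[ℂ] ⋀[ℂ]^3 V₅ × ⋀[ℂ]^2 V₅ :=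
  LinearMap.prod (wedge (i := 1) (j := 2) (vec u)) (c • LinearMap.id)

theorem addWedge_fibreParam (u : V₅) (c : ℂ) (w : ⋀[ℂ]^2 V₅) :
    addWedge (fibreParam u c w) = ExteriorAlgebra.ι ℂ ((u, c) : V₅ × ℂ) *
      ExteriorAlgebra.map (LinearMap.inl ℂ V₅ ℂ) w := by
  have h : fibreParam u c w = (wedge (i := 1) (j := 2) (vec u) w, c • w) := rfl
  have h2 : ((u, c) : V₅ × ℂ) = LinearMap.inl ℂ V₅ ℂ u + c • ((0, 1) : V₅ × ℂ) := by
    ext <;> simp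
  rw [h, addWedge_apply, h2, map_add, map_smul, add_mul]
  simp [wedge, vec]

theorem lagrangianFibre_eq_range {u : V₅} {c : ℂ} (hc : c ≠ 0) :
    lagrangianFibre ((u, c) : V₅ × ℂ) = LinearMap.range (addWedge ∘ₗ fibreParam u c) := by
  apply le_antisymm
  · rw [lagrangianFibre, ← ExteriorAlgebra.ιMulti_span_fixedDegree, Submodule.map_span_le]
    rintro _ ⟨v, rfl⟩
    -- As `c ≠ 0`, every vector can be moved into `V₅` by a multiple of `(u, c)`, which disappears
    -- after wedging with `(u, c)`.
    have hr : ∀ z : V₅ × ℂ, ∃ (z' : V₅) (s : ℂ), z = LinearMap.inl ℂ V₅ ℂ z' + s • (u, c) :=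
      fun z => ⟨z.1 - (z.2 / c) • u, z.2 / c, by ext <;> simp [hc]⟩
    obtain ⟨a, s, ha⟩ := hr (v 0)
    obtain ⟨b, t, hb⟩ := hr (v 1)
    refine ⟨wedge (vec a) (vec b), ?_⟩
    rw [LinearMap.comp_apply, addWedge_fibreParam]
    have h0 : ExteriorAlgebra.ι ℂ (u, c) * ExteriorAlgebra.ι ℂ (u, c) = 0 :=
      ExteriorAlgebra.ι_sq_zero _
    have h1 : ∀ z : V₅ × ℂ, ExteriorAlgebra.ι ℂ (u, c) * (ExteriorAlgebra.ι ℂ z * ExteriorAlgebra.ι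
        ℂ (u, c)) = 0 := by
      intro z
      have := ExteriorAlgebra.ι_add_mul_swap (R := ℂ) z (u, c)
      rw [eq_neg_of_add_eq_zero_left this, mul_neg, ← mul_assoc, h0, zero_mul, neg_zero]
    simp only [LinearMap.mulLeft_apply, ExteriorAlgebra.ιMulti_apply, List.ofFn_succ,
        List.ofFn_zero, List.prod_cons, List.prod_nil, mul_one, Fin.succ_zero_eq_one, ha, hb,
        map_add, map_smul, mul_add, add_mul, smul_mul_assoc, mul_smul_comm, h0, h1]
    have h2 : ∀ z, ExteriorAlgebra.ι ℂ (u, c) * (ExteriorAlgebra.ι ℂ (u, c) * z) = 0 := fun z => by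
      rw [← mul_assoc, h0, zero_mul]
    simp [h2, wedge, vec]
  · rintro _ ⟨w, rfl⟩
    rw [LinearMap.comp_apply, addWedge_fibreParam]
    refine Submodule.mem_map_of_mem ?_
    have := (exteriorPower.map 2 (LinearMap.inl ℂ V₅ ℂ) w).2
    have h : (ExteriorAlgebra.map (LinearMap.inl ℂ V₅ ℂ)).toLinearMap ∘ₗ (⋀[ℂ]^2 V₅).subtype =
        (⋀[ℂ]^2 (V₅ × ℂ)).subtype ∘ₗ exteriorPower.map 2 (LinearMap.inl ℂ V₅ ℂ) := by
      apply exteriorPower.linearMap_ext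
      ext v
      simp [ExteriorAlgebra.ιMulti_apply, Matrix.vecTail]
    have h1 := LinearMap.congr_fun h w
    simp only [LinearMap.comp_apply, Submodule.subtype_apply, AlgHom.toLinearMap_apply] at h1
    rw [h1]
    exact this

/-- The quadratic form `γ + P_v` on `W`. -/
noncomputable def gmForm (vol : ⋀[ℂ]^5 V₅ ≃ₗ[ℂ] ℂ) {W : Submodule ℂ (⋀[ℂ]^2 V₅)}
    (γ : LinearMap.BilinForm ℂ W) (v : V₅) : LinearMap.BilinForm ℂ W :=
  γ + (pfaffianForm vol v).compl₁₂ W.subtype W.subtype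

@[simp]
theorem gmForm_apply (vol : ⋀[ℂ]^5 V₅ ≃ₗ[ℂ] ℂ) {W : Submodule ℂ (⋀[ℂ]^2 V₅)}
    (γ : LinearMap.BilinForm ℂ W) (v : V₅) (x y : W) :
    gmForm vol γ v x y = γ x y + pfaffian vol v x y := rfl

/-- The element `(u, c) ∧ w = u ∧ w + x ∧ c w` lies in the Lagrangian exactly when `w ∈ W` and
`vol(u ∧ w ∧ w') = -c γ(w, w')` on `W`; division by `c` gives the kernel condition. -/
theorem finrank_ker_gmForm (e : Basis (Fin 5) ℂ V₅) (vol : ⋀[ℂ]^5 V₅ ≃ₗ[ℂ] ℂ)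
    (W : Submodule ℂ (⋀[ℂ]^2 V₅)) (γ : LinearMap.BilinForm ℂ W) {u : V₅} {c : ℂ} (hc : c ≠ 0) :
    finrank ℂ (LinearMap.ker (gmForm vol γ (c⁻¹ • u))) =
      finrank ℂ (lagrangianFibre ((u, c) : V₅ × ℂ) ⊓ gmLagrangian vol W γ :
        Submodule ℂ (ExteriorAlgebra ℂ (V₅ × ℂ))) := by
  have hinj : Function.Injective (addWedge ∘ₗ fibreParam u c) := by
    refine (addWedge_injective e vol).comp fun x y h => ?_
    have := congrArg Prod.snd h
    exact smul_right_injective _ hc this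
  have hmap : lagrangianFibre ((u, c) : V₅ × ℂ) ⊓ gmLagrangian vol W γ =
      ((LinearMap.ker (gmForm vol γ (c⁻¹ • u))).map W.subtype).map (addWedge ∘ₗ fibreParam u c) :=
          by
    ext z
    rw [lagrangianFibre_eq_range hc]
    constructor
    · rintro ⟨⟨w, rfl⟩, ⟨⟨η, w'⟩, h, h'⟩⟩
      have h2 := addWedge_injective e vol h'
      have h3 : η = wedge (i := 1) (j := 2) (vec u) w := congrArg Prod.fst h2
      have h4 : (w' : ⋀[ℂ]^2 V₅) = c • w := congrArg Prod.snd h2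
      have hw : w = ((c⁻¹ • w' : W) : ⋀[ℂ]^2 V₅) := by
        rw [Submodule.coe_smul, h4, smul_smul, inv_mul_cancel₀ hc, one_smul]
      refine ⟨w, ⟨c⁻¹ • w', ?_, hw.symm⟩, rfl⟩
      rw [SetLike.mem_coe, LinearMap.mem_ker]
      ext y
      have h5 : vol (wedge η (y : ⋀[ℂ]^2 V₅)) = -γ w' y := h y
      rw [gmForm_apply, ← hw, pfaffian_smul_left e]
      have h6 : pfaffian vol u w y = -γ w' y := by rw [← h5, h3]; rfl
      rw [h6]
      simp
    · rintro ⟨_, ⟨w, hw, rfl⟩, rfl⟩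
      refine ⟨⟨w, rfl⟩, ⟨(wedge (i := 1) (j := 2) (vec u) w, c • w), ?_, rfl⟩⟩
      intro y
      have h1 := LinearMap.congr_fun (LinearMap.mem_ker.mp hw) y
      rw [gmForm_apply, pfaffian_smul_left e] at h1
      have h2 : γ w y = -(c⁻¹ * pfaffian vol u w y) := by
        rw [eq_neg_iff_add_eq_zero]; exact h1
      change pfaffian vol u w y = -γ (c • w) y
      rw [map_smul, LinearMap.smul_apply, h2, smul_eq_mul]
      field_simp
  rw [hmap, ← (Submodule.equivMapOfInjective _ hinj _).finrank_eq,
    ← (Submodule.equivMapOfInjective _ W.injective_subtype _).finrank_eq]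

end Lagrangian

/-! ### Differentials of quadratic forms. -/

section ConeTangentSpace

variable {V : Type*} [AddCommGroup V] [Module ℂ V]

theorem mem_coneTangentSpace_iff {F : Set (V → ℂ)} {v u : V} :
    u ∈ coneTangentSpace F v ↔
      ∀ f ∈ F, ∀ D : Dual ℂ V, (∀ w, HasLineDerivAt ℂ f (D w) v w) → D u = 0 := by
  simp [coneTangentSpace, Submodule.mem_iInf]

theorem LinearMap.BilinForm.hasLineDerivAt (B : LinearMap.BilinForm ℂ V) (hB : ∀ x y, B x y = B y x)
    (v w : V) : HasLineDerivAt ℂ (fun x => B x x) (((2 : ℂ) • B v) w) v w := by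
  have h : (fun t : ℂ => B (v + t • w) (v + t • w)) =
      fun t => B v v + t * (2 * B v w) + t ^ 2 * B w w := by
    funext t
    simp only [map_add, map_smul, LinearMap.add_apply, LinearMap.smul_apply, smul_eq_mul, hB w v]
    ring
  rw [HasLineDerivAt, h]
  have h1 := (((hasDerivAt_id (0 : ℂ)).mul_const (2 * B v w)).const_add (B v v)).add
    ((hasDerivAt_pow 2 (0 : ℂ)).mul_const (B w w))
  refine (h1.congr_deriv ?_).congr_of_eventuallyEq (Filter.Eventually.of_forall fun t => rfl)
  simp

end ConeTangentSpace

/-! ### Tangent spaces of the Gushel-Mukai surface and the vertex of the quadric. -/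

section Kernel

variable {V₅ : Type*} [AddCommGroup V₅] [Module ℂ V₅]

theorem pfaffian_self_eq_zero_iff (e : Basis (Fin 5) ℂ V₅) (vol : ⋀[ℂ]^5 V₅ ≃ₗ[ℂ] ℂ)
    (x : ⋀[ℂ]^2 V₅) : (∀ v, pfaffian vol v x x = 0) ↔ ∃ a b, x = wedge (vec a) (vec b) := by
  rw [← pfaffians_plucker_eq_zero_iff e]
  constructor
  · intro h
    ext i
    have h1 := h (e i)
    rw [pfaffian_eq e] at h1
    have h2 := (mul_eq_zero.mp h1).resolve_left (vol_basis_ne_zero e vol)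
    simpa [Finsupp.single_apply, Matrix.pfaffianPolar_self] using h2
  · intro h v
    simp [pfaffian_eq e, Matrix.pfaffianPolar_self, h]

theorem exists_mk_rep_eq_smul {V : Type*} [AddCommGroup V] [Module ℂ V] {w : V} (hw : w ≠ 0) :
    ∃ a : ℂ, a ≠ 0 ∧ (Projectivization.mk ℂ w hw).rep = a • w := by
  obtain ⟨a, ha⟩ := Projectivization.exists_smul_eq_mk_rep ℂ w hw
  exact ⟨a, a.ne_zero, ha.symm⟩

variable (e : Basis (Fin 5) ℂ V₅) (vol : ⋀[ℂ]^5 V₅ ≃ₗ[ℂ] ℂ) {W : Submodule ℂ (⋀[ℂ]^2 V₅)}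
  {γ : LinearMap.BilinForm ℂ W}

include e in
theorem mk_mem_gmLocus_iff {w : W} (hw : w ≠ 0) : Projectivization.mk ℂ w hw ∈ gmLocus W γ ↔
    (∀ v, pfaffian vol v w w = 0) ∧ γ w w = 0 := by
  obtain ⟨a, ha, h⟩ := exists_mk_rep_eq_smul (V := W) hw
  rw [gmLocus, Set.mem_ofPred_eq, ← pfaffian_self_eq_zero_iff e vol, h]
  have h1 : ∀ v, pfaffian vol v (a • w : W) (a • w : W) = a * (a * pfaffian vol v w w) := by
    intro v
    simp only [← pfaffianForm_apply, Submodule.coe_smul, map_smul, LinearMap.smul_apply,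
        smul_eq_mul]
  simp only [h1, map_smul, LinearMap.smul_apply, smul_eq_mul, mul_eq_zero, ha, false_or]

include e in
-- The differential of a quadratic form at `w` is twice its polar form with `w`, and uniqueness of
-- derivatives leaves no other `D` in the definition of the tangent space.
theorem mem_coneTangentSpace_gmEquations_iff (hγ : γ.IsSymm) {w u : W} :
    u ∈ coneTangentSpace (gmEquations vol W γ) w ↔ γ w u = 0 ∧ ∀ v, pfaffian vol v w u = 0 := by
  have hB (v : V₅) : ∃ B : LinearMap.BilinForm ℂ W, (∀ x y, B x y = B y x) ∧
      ∀ x y, B x y = pfaffian vol v x y :=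
    ⟨(pfaffianForm vol v).compl₁₂ W.subtype W.subtype, fun x y => pfaffian_comm e vol v x y,
      fun x y => rfl⟩
  choose B hB hB' using hB
  rw [mem_coneTangentSpace_iff]
  constructor
  · intro h
    constructor
    · have := h _ (Set.mem_insert _ _) _ (γ.hasLineDerivAt (fun x y => hγ.eq x y) w)
      simpa using this
    · intro v
      have := h _ (Set.mem_insert_of_mem _ ⟨v, rfl⟩) ((2 : ℂ) • B v w)
        (by simpa only [hB'] using (B v).hasLineDerivAt (hB v) w)
      simpa [hB'] using this
  · rintro ⟨h1, h2⟩ f hf D hD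
    rcases hf with rfl | ⟨v, rfl⟩
    · rw [(hD u).unique (γ.hasLineDerivAt (fun x y => hγ.eq x y) w u), LinearMap.smul_apply, h1,
        smul_zero]
    · have := (B v).hasLineDerivAt (hB v) w u
      simp only [hB', LinearMap.smul_apply] at this
      rw [(hD u).unique this, h2, smul_zero]

include e in
theorem finrank_coneTangentSpace_gmEquations (hγ : γ.IsSymm) {n : ℕ} (hS : IsSmoothGM vol W γ n)
    {w : W} (hw : w ≠ 0) (h : ∀ v, pfaffian vol v w w = 0) (h' : γ w w = 0) :
    finrank ℂ (coneTangentSpace (gmEquations vol W γ) w) = n + 1 := by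
  have h1 := hS.smooth _ ((mk_mem_gmLocus_iff e vol hw).mpr ⟨h, h'⟩)
  obtain ⟨a, ha, h2⟩ := exists_mk_rep_eq_smul (V := W) hw
  rw [h2] at h1
  have h3 : coneTangentSpace (gmEquations vol W γ) (a • w) =
      coneTangentSpace (gmEquations vol W γ) w := by
    refine Submodule.ext fun u => ?_
    rw [mem_coneTangentSpace_gmEquations_iff e vol hγ, mem_coneTangentSpace_gmEquations_iff e vol
        hγ]
    simp only [← pfaffianForm_apply, Submodule.coe_smul, map_smul, LinearMap.smul_apply,
      smul_eq_mul, mul_eq_zero, ha, false_or]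
  rw [← h3]
  exact h1

include e in
-- The functional `v ↦ vol(v ∧ v₁ ∧ v₂ ∧ u)` kills `v₁` and `v₂`, so it varies in a
-- three-dimensional space: at most three independent conditions are imposed on `u`.
theorem le_finrank_forall_pfaffian_wedge_eq_zero [FiniteDimensional ℂ W] {v₁ v₂ : V₅}
    (hv : wedge (vec v₁) (vec v₂) ≠ 0) (T : Submodule ℂ W)
    (hT : ∀ u : W, (∀ v, pfaffian vol v (wedge (vec v₁) (vec v₂)) u = 0) → u ∈ T) :
    finrank ℂ W ≤ finrank ℂ T + 3 := by
  have := Module.Finite.of_basis e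
  have hli : LinearIndependent ℂ ![v₁, v₂] := by
    by_contra h
    exact hv (by rw [wedge_vec_vec]; exact AlternatingMap.map_linearDependent _ _ h)
  let φ : W →ₗ[ℂ] Dual ℂ V₅ := LinearMap.mk₂ ℂ
    (fun u v => pfaffian vol v (wedge (vec v₁) (vec v₂)) u)
    (fun u u' v => by simp [← pfaffianForm_apply]) (fun a u v => by simp [← pfaffianForm_apply])
    (fun u v v' => pfaffian_add_left e vol _ _ _ _) (fun a u v => pfaffian_smul_left e vol _ _ _ _)
  have hφ : LinearMap.range φ ≤ (Submodule.span ℂ (Set.range ![v₁, v₂])).dualAnnihilator := by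
    rintro _ ⟨u, rfl⟩
    rw [Submodule.mem_dualAnnihilator]
    intro v hv
    change v ∈ LinearMap.ker (φ u)
    refine (Submodule.span_le.mpr ?_ : _ ≤ LinearMap.ker (φ u)) hv
    rintro _ ⟨i, rfl⟩
    have h0 : ∀ i, wedge (i := 1) (j := 2) (vec (![v₁, v₂] i)) (wedge (vec v₁) (vec v₂)) = 0 := by
      have hsq : ∀ v : V₅, ExteriorAlgebra.ι ℂ v * ExteriorAlgebra.ι ℂ v = 0 :=
          ExteriorAlgebra.ι_sq_zero
      intro i
      apply Subtype.ext
      fin_cases i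
      · simp [wedge, vec, ← mul_assoc, hsq]
      · have : ExteriorAlgebra.ι ℂ v₁ * ExteriorAlgebra.ι ℂ v₂ = -(ExteriorAlgebra.ι ℂ v₂ *
          ExteriorAlgebra.ι ℂ v₁) := eq_neg_of_add_eq_zero_left (ExteriorAlgebra.ι_add_mul_swap _ _)
        simp [wedge, vec, this, ← mul_assoc, hsq]
    change pfaffian vol _ _ _ = 0
    unfold pfaffian
    have h1 := h0 i
    rw [show wedge (vec (![v₁, v₂] i)) (wedge (vec v₁) (vec v₂)) = 0 from h1, map_zero,
        LinearMap.zero_apply, map_zero]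
  have h1 := Submodule.finrank_mono hφ
  have h2 := Subspace.finrank_add_finrank_dualAnnihilator_eq (Submodule.span ℂ (Set.range ![v₁,
      v₂]))
  rw [finrank_span_eq_card hli, finrank_eq_card_basis e] at h2
  have h3 := LinearMap.finrank_range_add_finrank_ker (V := W) φ
  have h4 : LinearMap.ker φ ≤ T := fun u hu => hT u fun v => LinearMap.congr_fun hu v
  have h5 := Submodule.finrank_mono (M := W) h4
  simp only [Fintype.card_fin] at h2
  omega

include e in
/-- The vertex of the quadric of `γ + P_v` contains no point of the Grassmannian. -/
theorem eq_zero_of_mem_ker_gmForm (hγ : γ.IsSymm) (hS : IsSmoothGM vol W γ 2) {v₀ : V₅} {w : W}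
    (hw : w ∈ LinearMap.ker (gmForm vol γ v₀)) (h : ∀ v, pfaffian vol v w w = 0) : w = 0 := by
  by_contra hw0
  have : FiniteDimensional ℂ W := by
    have := Module.Finite.of_basis e
    have h1 : Module.Finite ℂ (⋀[ℂ]^2 V₅) := inferInstance
    have h2 : IsNoetherian ℂ (⋀[ℂ]^2 V₅) := isNoetherian_of_isNoetherianRing_of_finite _ _
    exact Module.IsNoetherian.finite _ _
  have hw' : ∀ u, γ w u = -pfaffian vol v₀ w u := fun u =>
    eq_neg_of_add_eq_zero_left (LinearMap.congr_fun hw u)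
  have h1 := finrank_coneTangentSpace_gmEquations e vol hγ hS hw0 h (by rw [hw', h, neg_zero])
  obtain ⟨v₁, v₂, hv⟩ := (pfaffian_self_eq_zero_iff e vol (w : ⋀[ℂ]^2 V₅)).mp h
  -- For `w` in the kernel, `γ(w, ·)` is a Pfaffian differential, so the Pfaffian conditions alone
  -- define the tangent space. Its dimension `3` would give `7 ≤ 3 + 3`.
  have h2 := le_finrank_forall_pfaffian_wedge_eq_zero e vol (W := W) (v₁ := v₁) (v₂ := v₂)
    (by rw [← hv]; simpa using hw0) (coneTangentSpace (gmEquations vol W γ) w) (by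
      intro u hu
      rw [mem_coneTangentSpace_gmEquations_iff e vol hγ, hw', hv]
      exact ⟨by rw [hu, neg_zero], hu⟩)
  rw [hS.finrank_eq] at h2
  omega

end Kernel

/-! ### Rank four quadrics and coordinate-free critical values. -/

section Quadrics

variable {V : Type*} [AddCommGroup V] [Module ℂ V] [FiniteDimensional ℂ V]

/-- A quadratic form of rank four is equivalent to the determinant of a `2 × 2` matrix. -/
theorem LinearMap.BilinForm.exists_eq_mul_sub_mul (B : LinearMap.BilinForm ℂ V) (hB : ∀ x y, B x y =
    B y x)
    (h : finrank ℂ V = finrank ℂ (LinearMap.ker B) + 4) :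
    ∃ L : V →ₗ[ℂ] (Fin 4 → ℂ), Function.Surjective L ∧ LinearMap.ker L = LinearMap.ker B ∧
      ∀ w, B w w = L w 0 * L w 3 - L w 1 * L w 2 := by
  obtain ⟨b, hb⟩ := LinearMap.BilinForm.exists_orthogonal_basis (B := B) ⟨fun x y => hB x y⟩
  have hBb : ∀ x y, B x y = ∑ i, B (b i) (b i) * (b.repr x i * b.repr y i) := by
    intro x y
    conv_lhs => rw [← b.sum_repr x, ← b.sum_repr y]
    simp only [map_sum, map_smul, LinearMap.sum_apply, LinearMap.smul_apply, smul_eq_mul]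
    refine Finset.sum_congr rfl fun i _ => ?_
    rw [Finset.sum_eq_single i]
    · ring
    · intro j _ hj
      have : B (b j) (b i) = 0 := hb hj
      rw [this]; ring
    · simp
  let J := {i // B (b i) (b i) ≠ 0}
  let φ : V →ₗ[ℂ] (J → ℂ) := LinearMap.pi fun j => b.coord j
  have hφ : Function.Surjective φ := by
    intro f
    classical
    refine ⟨b.equivFun.symm fun i => if hi : B (b i) (b i) ≠ 0 then f ⟨i, hi⟩ else 0, ?_⟩
    ext ⟨i, hi⟩
    change b.equivFun (b.equivFun.symm _) i = _
    rw [LinearEquiv.apply_symm_apply, dif_pos hi]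
  have hker : LinearMap.ker φ = LinearMap.ker B := by
    ext x
    simp only [LinearMap.mem_ker]
    constructor
    · intro hx
      ext y
      rw [hBb]
      refine Finset.sum_eq_zero fun i _ => ?_
      by_cases hi : B (b i) (b i) = 0
      · rw [hi, zero_mul]
      · have : b.repr x i = 0 := congrFun hx ⟨i, hi⟩
        rw [this]; ring
    · intro hx
      ext ⟨i, hi⟩
      have h1 := LinearMap.congr_fun hx (b i)
      rw [hBb, Finset.sum_eq_single i] at h1
      · change b.repr x i = 0
        simpa [hi] using h1
      · intro j _ hj
        simp [hj.symm]
      · simp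
  have hcard : Fintype.card J = 4 := by
    have h1 := φ.finrank_range_add_finrank_ker
    rw [LinearMap.range_eq_top.mpr hφ, finrank_top, finrank_fintype_fun_eq_card, hker] at h1
    omega
  let σ : Fin 4 ≃ J := (Fintype.equivFinOfCardEq hcard).symm
  choose s hs using fun i : J => IsAlgClosed.exists_pow_nat_eq (B (b i) (b i)) (n := 2) (by
      norm_num)
  have hs0 : ∀ i, s i ≠ 0 := by
    intro i hi
    have := hs i
    rw [hi] at this
    exact i.2 (by rw [← this]; norm_num)
  let l : Fin 4 → V →ₗ[ℂ] ℂ := fun j => s (σ j) • b.coord (σ j)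
  have hl : ∀ w, B w w = l 0 w ^ 2 + l 1 w ^ 2 + l 2 w ^ 2 + l 3 w ^ 2 := by
    intro w
    rw [hBb, ← Fin.sum_univ_four (fun j => l j w ^ 2), Equiv.sum_comp σ (fun j => (s j • b.coord j)
        w ^ 2)]
    have h1 : ∀ j : J, (s j • b.coord j) w ^ 2 = B (b j) (b j) * (b.repr w j * b.repr w j) := by
      intro j
      rw [← hs j, LinearMap.smul_apply, b.coord_apply, smul_eq_mul]
      ring
    rw [Finset.sum_congr rfl fun j _ => h1 j]
    rw [← Fintype.sum_subtype_add_sum_subtype (fun i => B (b i) (b i) ≠ 0)]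
    refine (congrArg (_ + ·) (Finset.sum_eq_zero fun j _ => ?_)).trans (add_zero _)
    rw [not_not.mp j.2, zero_mul]
  have hI := Complex.I_mul_I
  -- From a sum of four squares: `l₀² + l₁²` factors as `L₀ L₃`, and `l₂² + l₃²` as `-L₁ L₂`.
  let L : V →ₗ[ℂ] (Fin 4 → ℂ) := LinearMap.pi ![l 0 + Complex.I • l 1, Complex.I • l 2 + l 3,
    Complex.I • l 2 - l 3, l 0 - Complex.I • l 1]
  have hL : LinearMap.ker L = LinearMap.ker B := by
    rw [← hker]
    ext w
    simp only [LinearMap.mem_ker]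
    constructor
    · intro h0
      have e0 : l 0 w + Complex.I * l 1 w = 0 := congrFun h0 0
      have e1 : Complex.I * l 2 w + l 3 w = 0 := congrFun h0 1
      have e2 : Complex.I * l 2 w - l 3 w = 0 := congrFun h0 2
      have e3 : l 0 w - Complex.I * l 1 w = 0 := congrFun h0 3
      have hl0 : ∀ k, l k w = 0 := by
        suffices l 0 w = 0 ∧ l 1 w = 0 ∧ l 2 w = 0 ∧ l 3 w = 0 by
          intro k; fin_cases k <;> tauto
        refine ⟨?_, ?_, ?_, ?_⟩
        · linear_combination (1 / 2) * e0 + (1 / 2) * e3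
        · linear_combination (-Complex.I / 2) * e0 + (Complex.I / 2) * e3 + l 1 w * hI
        · linear_combination (-Complex.I / 2) * e1 - (Complex.I / 2) * e2 + l 2 w * hI
        · linear_combination (1 / 2) * e1 - (1 / 2) * e2
      ext j
      obtain ⟨k, rfl⟩ := σ.surjective j
      exact (mul_eq_zero.mp (hl0 k)).resolve_left (hs0 _)
    · intro h0
      have hl0 : ∀ k, l k w = 0 := fun k => by
        change s (σ k) * φ w (σ k) = 0
        rw [h0, Pi.zero_apply, mul_zero]
      ext k
      fin_cases k <;> simp [L, hl0]
  refine ⟨L, ?_, hL, ?_⟩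
  · rw [← LinearMap.range_eq_top]
    apply Submodule.eq_top_of_finrank_eq
    have h1 := L.finrank_range_add_finrank_ker
    rw [hL] at h1
    rw [finrank_fintype_fun_eq_card, Fintype.card_fin]
    omega
  · intro w
    rw [hl]
    simp [L]
    linear_combination ((l 1 w)^2 + (l 2 w)^2) * hI

theorem finite_setOf_critical {m : Type*} [Fintype m] (Q : m → LinearMap.BilinForm ℂ V)
    (hQ : ∀ i x y, Q i x y = Q i y x) (a b : Dual ℂ V) :
    {t : ℂ | ∃ w, (∀ i, Q i w w = 0) ∧ b w ≠ 0 ∧ a w = t * b w ∧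
      ∀ u, (∀ i, Q i w u = 0) → a u = t * b u}.Finite := by
  let e := Module.finBasis ℂ V
  refine (finite_critical_values (fun i j l => Q i (e j) (e l)) (fun i j l => hQ i _ _) (fun j => a
      (e j))
    (fun j => b (e j))).subset ?_
  rintro t ⟨w, h1, h2, h3, h4⟩
  have hlin : ∀ (f : Dual ℂ V) x, f x = ∑ j, f (e j) * e.repr x j := by
    intro f x
    conv_lhs => rw [← e.sum_repr x, map_sum]
    simp only [map_smul, smul_eq_mul, mul_comm]
  -- Lagrange multipliers: `a - t b` vanishes on the common kernel of the differentials. Afterwards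
  -- `w` is rescaled to `b = 1`, which multiplies the multipliers by `b w`.
  have h5 : a - t • b ∈ Submodule.span ℂ (Set.range fun i => Q i w) := by
    apply mem_span_of_iInf_ker_le_ker
    intro u hu
    rw [Submodule.mem_iInf] at hu
    rw [LinearMap.mem_ker, LinearMap.sub_apply, h4 u hu]
    simp
  obtain ⟨c, hc⟩ := (Submodule.mem_span_range_iff_exists_fun ℂ).mp h5
  refine ⟨fun j => e.repr ((b w)⁻¹ • w) j, fun i => b w * c i, ?_, ?_, ?_, ?_⟩
  · intro i
    have : Q i ((b w)⁻¹ • w) ((b w)⁻¹ • w) = 0 := by simp [h1]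
    rw [← this, hlin (Q i _)]
    refine Finset.sum_congr rfl fun j _ => ?_
    rw [hQ i _ (e j), hlin (Q i (e j)), Finset.sum_mul]
    exact Finset.sum_congr rfl fun l _ => by ring
  · rw [← hlin b, map_smul, smul_eq_mul, inv_mul_cancel₀ h2]
  · rw [← hlin a, map_smul, h3, smul_eq_mul]
    field_simp
  · intro l
    have h6 := LinearMap.congr_fun hc (e l)
    simp only [LinearMap.sum_apply, LinearMap.smul_apply, LinearMap.sub_apply, smul_eq_mul] at h6
    rw [mul_comm, ← h6]
    refine Finset.sum_congr rfl fun i _ => ?_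
    have h7 : ∑ j, Q i (e j) (e l) * e.repr ((b w)⁻¹ • w) j = (b w)⁻¹ * Q i w (e l) := by
      simp only [hQ i _ (e l)]
      rw [← hlin (Q i (e l)), map_smul, smul_eq_mul]
    refine Eq.trans ?_ (congrArg (b w * c i * ·) h7.symm)
    field_simp

end Quadrics

/-! ### Forms on a vector space versus homogeneous polynomials. -/

section Forms

variable {V : Type*} [AddCommGroup V] [Module ℂ V]

theorem dual_mem_forms (φ : Dual ℂ V) : (φ : V → ℂ) ∈ forms V 1 := by
  rw [forms, pow_one]
  exact ⟨φ, rfl⟩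

theorem mul_mem_forms {d d' : ℕ} {f g : V → ℂ} (hf : f ∈ forms V d) (hg : g ∈ forms V d') :
    f * g ∈ forms V (d + d') := by
  rw [forms, pow_add]
  exact Submodule.mul_mem_mul hf hg

theorem one_mem_forms : (1 : V → ℂ) ∈ forms V 0 := by
  rw [forms, pow_zero]
  exact Submodule.one_le.mp le_rfl

theorem bilinForm_mem_forms [FiniteDimensional ℂ V] (B : LinearMap.BilinForm ℂ V) :
    (fun v => B v v) ∈ forms V 2 := by
  let e := Module.finBasis ℂ V
  have : (fun v => B v v) = ∑ i, ((e.coord i : V → ℂ) * (B (e i) : V → ℂ)) := by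
    funext v
    have h (x : V) : B v x = ∑ i, e.repr v i * B (e i) x := by
      conv_lhs => rw [← e.sum_repr v, map_sum, LinearMap.sum_apply]
      simp only [map_smul, LinearMap.smul_apply, smul_eq_mul]
    simp [h v]
  rw [this]
  exact Submodule.sum_mem _ fun i _ => mul_mem_forms (dual_mem_forms _) (dual_mem_forms _)

theorem forms_smul {d : ℕ} {f : V → ℂ} (hf : f ∈ forms V d) (a : ℂ) (v : V) :
    f (a • v) = a ^ d * f v := by
  induction d generalizing f with
  | zero =>
    rw [forms, pow_zero, Submodule.mem_one] at hf
    obtain ⟨c, rfl⟩ := hf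
    simp
  | succ d ih =>
    rw [forms, pow_succ] at hf
    induction hf using Submodule.mul_induction_on' with
    | mem_mul_mem f hf l hl =>
      obtain ⟨φ, rfl⟩ := hl
      rw [Pi.mul_apply, Pi.mul_apply, ih hf]
      change _ * φ (a • v) = _ * (_ * φ v)
      rw [map_smul, smul_eq_mul]
      ring
    | add f _ g _ hf hg => rw [Pi.add_apply, Pi.add_apply, hf, hg, mul_add]

theorem exists_isHomogeneous_eval_eq {σ : Type*} [Fintype σ] (g : (σ → ℂ) →ₗ[ℂ] V) {d : ℕ} {f : V →
    ℂ}
    (hf : f ∈ forms V d) :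
    ∃ P : MvPolynomial σ ℂ, P.IsHomogeneous d ∧ ∀ y, f (g y) = MvPolynomial.eval y P := by
  classical
  induction d generalizing f with
  | zero =>
    rw [forms, pow_zero, Submodule.mem_one] at hf
    obtain ⟨c, rfl⟩ := hf
    exact ⟨MvPolynomial.C c, MvPolynomial.isHomogeneous_C _ _, fun y => by simp⟩
  | succ d ih =>
    rw [forms, pow_succ] at hf
    induction hf using Submodule.mul_induction_on' with
    | mem_mul_mem f hf l hl =>
      obtain ⟨φ, rfl⟩ := hl
      obtain ⟨P, hP, hP'⟩ := ih hf
      refine ⟨P * ∑ i, MvPolynomial.C (φ (g (Pi.single i 1))) * MvPolynomial.X i, hP.mul ?_, fun y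
          => ?_⟩
      · refine MvPolynomial.IsHomogeneous.sum _ _ _ fun i _ => ?_
        simpa using (MvPolynomial.isHomogeneous_C σ _).mul (MvPolynomial.isHomogeneous_X ℂ i)
      · rw [Pi.mul_apply, hP', map_mul]
        congr 1
        change φ (g y) = _
        have h1 : y = ∑ i, y i • Pi.single i (1 : ℂ) := by
          ext j; simp [Pi.single_apply]
        conv_lhs => rw [h1]
        simp [mul_comm]
    | add f _ g _ hf hg =>
      obtain ⟨P, hP, hP'⟩ := hf
      obtain ⟨Q, hQ, hQ'⟩ := hg
      exact ⟨P + Q, hP.add hQ, fun y => by rw [Pi.add_apply, hP', hQ', map_add]⟩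

theorem eval_comp_mem_forms {σ : Type*} [Fintype σ] (r : V →ₗ[ℂ] (σ → ℂ)) {d : ℕ} {P : MvPolynomial
    σ ℂ}
    (hP : P.IsHomogeneous d) : (fun v => MvPolynomial.eval (r v) P) ∈ forms V d := by
  have h1 : (fun v => MvPolynomial.eval (r v) P) = ∑ m ∈ P.support, P.coeff m • ∏ i,
      (((LinearMap.proj i ∘ₗ r : V →ₗ[ℂ] ℂ) : V → ℂ) ^ m i) := by
    funext v
    rw [MvPolynomial.eval_eq']
    simp
  rw [h1]
  refine Submodule.sum_mem _ fun m hm => Submodule.smul_mem _ _ ?_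
  have h2 : d = ∑ i, m i := by
    have := hP (MvPolynomial.mem_support_iff.mp hm)
    rw [← this, Finsupp.weight_apply, Finsupp.sum_fintype] <;> simp
  rw [h2]
  induction (Finset.univ : Finset σ) using Finset.cons_induction with
  | empty => exact one_mem_forms
  | cons a s ha ih =>
    rw [Finset.prod_cons, Finset.sum_cons]
    refine mul_mem_forms ?_ ih
    have h3 := Submodule.pow_mem_pow _ (dual_mem_forms (LinearMap.proj a ∘ₗ r)) (m a)
    rwa [forms, pow_one] at h3

end Forms

/-! ### Basic open sets of the Zariski topology. -/

section Zariski

variable {V : Type*} [AddCommGroup V] [Module ℂ V]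

theorem isClosed_setOf_form_eq_zero {d : ℕ} {f : V → ℂ} (hf : f ∈ forms V d) :
    IsClosed {p : ℙ ℂ V | f p.rep = 0} :=
  ⟨TopologicalSpace.isOpen_generateFrom_of_mem ⟨d, f, hf, rfl⟩⟩

theorem isOpen_setOf_form_ne_zero {d : ℕ} {f : V → ℂ} (hf : f ∈ forms V d) :
    IsOpen {p : ℙ ℂ V | f p.rep ≠ 0} :=
  TopologicalSpace.isOpen_generateFrom_of_mem ⟨d, f, hf, rfl⟩

/-- Products of forms are forms, so the generating sets are stable under finite intersection and
already constitute a basis. -/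
theorem exists_form_ne_zero_of_mem_isOpen {O : Set (ℙ ℂ V)} (hO : IsOpen O) {p : ℙ ℂ V}
    (hp : p ∈ O) : ∃ d, ∃ f ∈ forms V d, f p.rep ≠ 0 ∧ ∀ q : ℙ ℂ V, f q.rep ≠ 0 → q ∈ O := by
  induction hO with
  | basic O h =>
    obtain ⟨d, f, hf, rfl⟩ := h
    exact ⟨d, f, hf, hp, fun q hq => hq⟩
  | univ => exact ⟨0, 1, one_mem_forms, one_ne_zero, fun q _ => trivial⟩
  | inter O O' _ _ ih ih' =>
    obtain ⟨d, f, hf, h1, h2⟩ := ih hp.1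
    obtain ⟨d', f', hf', h1', h2'⟩ := ih' hp.2
    exact ⟨d + d', f * f', mul_mem_forms hf hf', mul_ne_zero h1 h1', fun q hq =>
      ⟨h2 q (left_ne_zero_of_mul hq), h2' q (right_ne_zero_of_mul hq)⟩⟩
  | sUnion S _ ih =>
    obtain ⟨O, hO, hpO⟩ := hp
    obtain ⟨d, f, hf, h1, h2⟩ := ih O hO hpO
    exact ⟨d, f, hf, h1, fun q hq => ⟨O, hO, h2 q hq⟩⟩

end Zariski

/-! ### Pfaffian sections as smooth elliptic quintics. -/

section PfaffianCurve

open Matrix MvPolynomial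

variable {V : Type*} [AddCommGroup V] [Module ℂ V]

/-- The linear section by the image of `g` of the locus of zeros of the Pfaffians of `M`. -/
def pfaffianLocus {σ : Type*} (M : V →ₗ[ℂ] Matrix (Fin 5) (Fin 5) ℂ) (g : (σ → ℂ) →ₗ[ℂ] V) :
    Set (ℙ ℂ V) :=
  {p | p.rep ∈ LinearMap.range g ∧ pfaffians (M p.rep) = 0}

theorem mk_mem_pfaffianLocus_iff {σ : Type*} {M : V →ₗ[ℂ] Matrix (Fin 5) (Fin 5) ℂ}
    {g : (σ → ℂ) →ₗ[ℂ] V} {v : V} (hv : v ≠ 0) : Projectivization.mk ℂ v hv ∈ pfaffianLocus M g ↔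
      v ∈ LinearMap.range g ∧ pfaffians (M v) = 0 := by
  obtain ⟨a, ha, h⟩ := exists_mk_rep_eq_smul hv
  rw [pfaffianLocus, Set.mem_ofPred_eq, h, Submodule.smul_mem_iff _ ha, map_smul, pfaffians_smul,
    smul_eq_zero_iff_right (pow_ne_zero 2 ha)]

/-- The matrices of the restriction of `M` in the coordinates of `g`. -/
noncomputable def coordinateMatrices {σ : Type*} [DecidableEq σ] (M : V →ₗ[ℂ] Matrix (Fin 5) (Fin 5)
    ℂ)
    (g : (σ → ℂ) →ₗ[ℂ] V) (l : σ) : Matrix (Fin 5) (Fin 5) ℂ :=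
  M (g (Pi.single l 1))

theorem evalMatrix_coordinateMatrices {σ : Type*} [Fintype σ] [DecidableEq σ]
    (M : V →ₗ[ℂ] Matrix (Fin 5) (Fin 5) ℂ) (g : (σ → ℂ) →ₗ[ℂ] V) (y : σ → ℂ) :
    evalMatrix (coordinateMatrices M g) y = M (g y) := by
  have h1 : y = ∑ i, y i • Pi.single i (1 : ℂ) := by
    ext j; simp [Pi.single_apply]
  conv_rhs => rw [h1]
  simp [evalMatrix, coordinateMatrices]

theorem differentiable_eval_line {σ : Type*} (P : MvPolynomial σ ℂ) (y u : σ → ℂ) :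
    Differentiable ℂ fun t : ℂ => eval (y + t • u) P := by
  induction P using MvPolynomial.induction_on with
  | C a => simp
  | add p q hp hq => simpa using Differentiable.fun_add hp hq
  | mul_X p i hp =>
    simp only [map_mul, eval_X, Pi.add_apply, Pi.smul_apply, smul_eq_mul]
    exact hp.mul (by fun_prop)

/-- Along a tangent direction the generating Pfaffians are exactly `t²` times constants, so every
element of the ideal vanishes to second order. -/
theorem hasDerivAt_eval_line_of_mem_pfaffianIdeal {σ : Type*} [Fintype σ]
    {N : σ → Matrix (Fin 5) (Fin 5) ℂ} {P : MvPolynomial σ ℂ} (hP : P ∈ pfaffianIdeal N)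
    {y u : σ → ℂ} (hy : pfaffians (evalMatrix N y) = 0) (hu : pfaffianDifferential N y u = 0) :
    HasDerivAt (fun t : ℂ => eval (y + t • u) P) 0 0 := by
  obtain ⟨c, hc⟩ := (Ideal.mem_span_range_iff_exists_fun).mp hP
  have h1 (t : ℂ) (i : Fin 5) : eval (y + t • u) (pfaffians (linearMatrix N) i) =
      t ^ 2 * pfaffians (evalMatrix N u) i := by
    have h2 : evalMatrix N (y + t • u) = evalMatrix N y + t • evalMatrix N u := by
      simp [evalMatrix, add_smul, Finset.sum_add_distrib, Finset.smul_sum, smul_smul]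
    have h3 : pfaffianPolar (evalMatrix N y) (t • evalMatrix N u) = 0 := by
      rw [← pfaffianPolarₗ_apply, map_smul, pfaffianPolarₗ_apply, ← pfaffianDifferential_apply, hu,
        smul_zero]
    rw [eval_pfaffians_linearMatrix, h2, pfaffians_add, hy, h3, pfaffians_smul]
    simp
  have h4 : (fun t : ℂ => eval (y + t • u) P) = fun t : ℂ => t ^ 2 *
      ∑ i, pfaffians (evalMatrix N u) i * eval (y + t • u) (c i) := by
    funext t
    rw [← hc, map_sum, Finset.mul_sum]
    refine Finset.sum_congr rfl fun i _ => ?_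
    rw [map_mul, h1]
    ring
  rw [h4]
  have h5 : Differentiable ℂ fun t : ℂ => ∑ i, pfaffians (evalMatrix N u) i * eval (y + t • u) (c i)
      :=
    Differentiable.fun_sum fun i _ => (differentiable_eval_line _ _ _).const_mul _
  refine ((hasDerivAt_pow 2 (0 : ℂ)).mul (h5 0).hasDerivAt).congr_deriv ?_
  simp

variable (M : V →ₗ[ℂ] Matrix (Fin 5) (Fin 5) ℂ) (g : (Fin 3 ⊕ Fin 2 → ℂ) →ₗ[ℂ] V)

theorem isClosed_pfaffianLocus [FiniteDimensional ℂ V] : IsClosed (pfaffianLocus M g) := by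
  have h : pfaffianLocus M g =
      (⋂ φ ∈ (LinearMap.range g).dualAnnihilator, {p : ℙ ℂ V | φ p.rep = 0}) ∩
      ⋂ i, {p : ℙ ℂ V | pfaffianPolar (M p.rep) (M p.rep) i = 0} := by
    ext p
    simp only [Set.mem_inter_iff, Set.mem_iInter, Set.mem_ofPred_eq]
    refine and_congr ?_ ?_
    · rw [← Subspace.dualAnnihilator_dualCoannihilator_eq (W := LinearMap.range g),
        Submodule.mem_dualCoannihilator, Subspace.dualAnnihilator_dualCoannihilator_eq]
    · simp [pfaffianPolar_self, funext_iff]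
  rw [h]
  refine IsClosed.inter (isClosed_biInter fun φ _ => isClosed_setOf_form_eq_zero (dual_mem_forms φ))
    (isClosed_iInter fun i => isClosed_setOf_form_eq_zero (bilinForm_mem_forms
      ((pfaffianPolarₗ.compl₁₂ M M).compr₂ (LinearMap.proj i))))

variable {M g} (hN : ∀ l, (coordinateMatrices M g l).IsAlternating)
  (hbpf : ∀ x, pfaffians (evalMatrix (coordinateMatrices M g ∘ Sum.inl) x) = 0 → x = 0)
  (htan : ∀ x, pfaffians (evalMatrix (coordinateMatrices M g) x) = 0 → x ≠ 0 →
      finrank ℂ (LinearMap.ker (pfaffianDifferential (coordinateMatrices M g) x)) ≤ 2)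

include hN hbpf htan

theorem mem_pfaffianIdeal_of_eval_eq_zero (P : MvPolynomial (Fin 3 ⊕ Fin 2) ℂ)
    (h : ∀ y, y ≠ 0 → pfaffians (M (g y)) = 0 → eval y P = 0) :
    P ∈ pfaffianIdeal (coordinateMatrices M g) := by
  -- Projective points say nothing about the value of `P` at the origin. A factor vanishing there
  -- repairs this, and primality removes it again.
  have h1 : X (Sum.inr 0) * P ∈ pfaffianIdeal (coordinateMatrices M g) := by
    rw [mem_pfaffianIdeal_iff hN hbpf htan]
    intro y hy
    rw [evalMatrix_coordinateMatrices] at hy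
    by_cases hy0 : y = 0
    · simp [hy0]
    · rw [map_mul, h y hy0 hy, mul_zero]
  exact ((isPrime_pfaffianIdeal hN hbpf htan).mem_or_mem h1).resolve_left
    (X_inr_notMem_pfaffianIdeal hN hbpf 0)

theorem mem_pfaffianIdeal_of_forall_mem_pfaffianLocus (hg : Function.Injective g) {d : ℕ} {f : V →
    ℂ}
    (hf : f ∈ forms V d) (h : ∀ p ∈ pfaffianLocus M g, f p.rep = 0) {P : MvPolynomial (Fin 3 ⊕ Fin
        2) ℂ}
    (hP : ∀ y, f (g y) = eval y P) : P ∈ pfaffianIdeal (coordinateMatrices M g) := by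
  refine mem_pfaffianIdeal_of_eval_eq_zero hN hbpf htan P fun y hy hy' => ?_
  have hgy : g y ≠ 0 := fun h0 => hy (hg (h0.trans (map_zero g).symm))
  obtain ⟨a, ha, h1⟩ := exists_mk_rep_eq_smul hgy
  have h2 := h _ ((mk_mem_pfaffianLocus_iff hgy).mpr ⟨⟨y, rfl⟩, hy'⟩)
  rw [h1, forms_smul hf, hP] at h2
  exact (mul_eq_zero.mp h2).resolve_left (pow_ne_zero _ ha)

theorem isIrreducible_pfaffianLocus (hg : Function.Injective g) : IsIrreducible (pfaffianLocus M g)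
    := by
  have hprime := isPrime_pfaffianIdeal hN hbpf htan
  constructor
  · by_contra hne
    rw [Set.not_nonempty_iff_eq_empty] at hne
    refine hprime.ne_top ((Ideal.eq_top_iff_one _).mpr ?_)
    refine mem_pfaffianIdeal_of_forall_mem_pfaffianLocus hN hbpf htan hg one_mem_forms ?_ fun y =>
        ?_
    · simp [hne]
    · simp
  · rintro O O' hO hO' ⟨p, hp, hpO⟩ ⟨p', hp', hpO'⟩
    obtain ⟨d, f, hf, h1, h2⟩ := exists_form_ne_zero_of_mem_isOpen hO hpO
    obtain ⟨d', f', hf', h1', h2'⟩ := exists_form_ne_zero_of_mem_isOpen hO' hpO'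
    by_contra hemp
    have h3 : ∀ q ∈ pfaffianLocus M g, (f * f') q.rep = 0 := by
      intro q hq
      by_contra h0
      exact hemp ⟨q, hq, h2 q (left_ne_zero_of_mul h0), h2' q (right_ne_zero_of_mul h0)⟩
    obtain ⟨P, -, hP⟩ := exists_isHomogeneous_eval_eq g hf
    obtain ⟨P', -, hP'⟩ := exists_isHomogeneous_eval_eq g hf'
    have h4 : P * P' ∈ pfaffianIdeal (coordinateMatrices M g) :=
      mem_pfaffianIdeal_of_forall_mem_pfaffianLocus hN hbpf htan hg (mul_mem_forms hf hf') h3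
        fun y => by rw [Pi.mul_apply, hP, hP', map_mul]
    have h5 {d : ℕ} {f : V → ℂ} (hf : f ∈ forms V d) {P : MvPolynomial (Fin 3 ⊕ Fin 2) ℂ}
        (hP : ∀ y, f (g y) = eval y P) {p : ℙ ℂ V} (hp : p ∈ pfaffianLocus M g)
        (hPI : P ∈ pfaffianIdeal (coordinateMatrices M g)) : f p.rep = 0 := by
      obtain ⟨⟨y, hy⟩, h6⟩ := hp
      rw [← hy, hP]
      refine eval_eq_zero_of_mem_pfaffianIdeal ?_ hPI
      rw [evalMatrix_coordinateMatrices, hy, h6]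
    rcases hprime.mem_or_mem h4 with h | h
    · exact h1 (h5 hf hP hp h)
    · exact h1' (h5 hf' hP' hp' h)

/-- Since the Pfaffian ideal is the whole vanishing ideal, its quotient embeds in the functions on
the punctured cone, and forms on `V` restrict to the image of its graded pieces. -/
theorem hilbertFunction_pfaffianLocus (hg : Function.Injective g) (k : ℕ) :
    hilbertFunction (pfaffianLocus M g) (k + 2) = 5 * (k + 2) := by
  obtain ⟨r, hr⟩ := g.exists_leftInverse_of_injective (LinearMap.ker_eq_bot.mpr hg)
  have hrg : ∀ y, r (g y) = y := LinearMap.congr_fun hr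
  have hcone : ∀ v ∈ puncturedCone (pfaffianLocus M g), g (r v) = v ∧
      pfaffians (evalMatrix (coordinateMatrices M g) (r v)) = 0 := by
    rintro v ⟨hv, hv'⟩
    obtain ⟨⟨y, rfl⟩, h⟩ := (mk_mem_pfaffianLocus_iff hv).mp hv'
    rw [evalMatrix_coordinateMatrices, hrg]
    exact ⟨rfl, h⟩
  let ψ : MvPolynomial (Fin 3 ⊕ Fin 2) ℂ →ₐ[ℂ] (puncturedCone (pfaffianLocus M g) → ℂ) :=
    aeval fun i v => r v i
  have hψ : ∀ P v, ψ P v = eval (r v) P := by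
    intro P v
    have : (Pi.evalAlgHom ℂ _ v).comp ψ = aeval (r v) := by
      ext i
      simp [ψ]
    exact (AlgHom.congr_fun this P)
  let Θ : (MvPolynomial (Fin 3 ⊕ Fin 2) ℂ ⧸ pfaffianIdeal (coordinateMatrices M g)) →ₐ[ℂ]
      (puncturedCone (pfaffianLocus M g) → ℂ) :=
    Ideal.Quotient.liftₐ _ ψ fun P hP => by
      funext v
      rw [hψ]
      exact eval_eq_zero_of_mem_pfaffianIdeal (hcone v v.2).2 hP
  have hΘ : ∀ P, Θ (Ideal.Quotient.mkₐ ℂ _ P) = ψ P := fun P => rfl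
  have hinj : Function.Injective Θ.toLinearMap := by
    rw [← LinearMap.ker_eq_bot, LinearMap.ker_eq_bot']
    intro x hx
    obtain ⟨P, rfl⟩ := Ideal.Quotient.mkₐ_surjective ℂ _ x
    have h0 : ψ P = 0 := hx
    refine Ideal.Quotient.eq_zero_iff_mem.mpr ?_
    refine mem_pfaffianIdeal_of_eval_eq_zero hN hbpf htan P fun y hy hy' => ?_
    have hgy : g y ≠ 0 := fun h0 => hy (hg (h0.trans (map_zero g).symm))
    have := congrFun h0 ⟨g y, hgy, (mk_mem_pfaffianLocus_iff hgy).mpr ⟨⟨y, rfl⟩, hy'⟩⟩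
    rw [hψ, hrg] at this
    exact this
  have heq : (forms V (k + 2)).map (LinearMap.funLeft ℂ ℂ
      (Subtype.val : puncturedCone (pfaffianLocus M g) → V)) =
      ((homogeneousSubmodule (Fin 3 ⊕ Fin 2) ℂ (k + 2)).map
        (Ideal.Quotient.mkₐ ℂ (pfaffianIdeal (coordinateMatrices M g))).toLinearMap).map
          Θ.toLinearMap := by
    ext F
    constructor
    · rintro ⟨f, hf, rfl⟩
      obtain ⟨P, hP, hP'⟩ := exists_isHomogeneous_eval_eq g hf
      refine ⟨_, ⟨P, hP, rfl⟩, ?_⟩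
      funext v
      refine (hψ P v).trans ?_
      rw [← hP', (hcone v v.2).1]
      rfl
    · rintro ⟨_, ⟨P, hP, rfl⟩, rfl⟩
      refine ⟨_, eval_comp_mem_forms r hP, ?_⟩
      funext v
      exact (hψ P v).symm
  rw [hilbertFunction, heq, ← finrank_map_homogeneousSubmodule hN hbpf k,
    ← (Submodule.equivMapOfInjective _ hinj _).finrank_eq]

/-- The linear equations of the section and its Pfaffians already determine the tangent space, every
other vanishing form being in the ideal. The bound `≤ 2` is the hypothesis, `≥ 2` comes from depth
two. -/
theorem finrank_coneTangentSpace_pfaffianLocus [FiniteDimensional ℂ V] (hg : Function.Injective g)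
    {p : ℙ ℂ V} (hp : p ∈ pfaffianLocus M g) :
    finrank ℂ (coneTangentSpace (vanishingForms (pfaffianLocus M g)) p.rep) = 2 := by
  obtain ⟨⟨y, hy⟩, hpf⟩ := hp
  have hy0 : y ≠ 0 := by
    rintro rfl
    exact p.rep_nonzero (hy.symm.trans (map_zero g))
  rw [← hy] at hpf ⊢
  have hpf' : pfaffians (evalMatrix (coordinateMatrices M g) y) = 0 := by
    rw [evalMatrix_coordinateMatrices, hpf]
  have h : coneTangentSpace (vanishingForms (pfaffianLocus M g)) (g y) =
      (LinearMap.ker (pfaffianDifferential (coordinateMatrices M g) y)).map g := by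
    ext u
    rw [mem_coneTangentSpace_iff]
    constructor
    · intro hu
      have h1 : u ∈ LinearMap.range g := by
        rw [← Subspace.dualAnnihilator_dualCoannihilator_eq (W := LinearMap.range g),
          Submodule.mem_dualCoannihilator]
        intro φ hφ
        refine hu φ ⟨⟨1, dual_mem_forms φ⟩, fun q hq => (Submodule.mem_dualAnnihilator φ).mp hφ _
            hq.1⟩ φ fun w => ?_
        have : (fun t : ℂ => φ (g y + t • w)) = fun t => φ (g y) + t * φ w := by
          funext t; simp
        rw [HasLineDerivAt, this]
        simpa using ((hasDerivAt_id (0 : ℂ)).mul_const (φ w)).const_add (φ (g y))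
      obtain ⟨z, rfl⟩ := h1
      refine ⟨z, LinearMap.mem_ker.mpr (funext fun i => ?_), rfl⟩
      let B : LinearMap.BilinForm ℂ V := (pfaffianPolarₗ.compl₁₂ M M).compr₂ (LinearMap.proj i)
      have hB : ∀ x x', B x x' = B x' x := fun x x' =>
        congrFun (pfaffianPolar_comm (M x) (M x')) i
      have h2 := hu (fun x => B x x) ⟨⟨2, bilinForm_mem_forms B⟩, fun q hq => by
        change pfaffianPolar (M q.rep) (M q.rep) i = 0
        rw [pfaffianPolar_self, hq.2, smul_zero, Pi.zero_apply]⟩ _ (B.hasLineDerivAt hB (g y))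
      rw [LinearMap.smul_apply, smul_eq_mul] at h2
      rw [pfaffianDifferential_apply, evalMatrix_coordinateMatrices, evalMatrix_coordinateMatrices]
      exact (mul_eq_zero.mp h2).resolve_left two_ne_zero
    · rintro ⟨z, hz, rfl⟩ f ⟨⟨d, hf⟩, hf'⟩ D hD
      obtain ⟨P, -, hP⟩ := exists_isHomogeneous_eval_eq g hf
      have hPI := mem_pfaffianIdeal_of_forall_mem_pfaffianLocus hN hbpf htan hg hf hf' hP
      have h1 := hasDerivAt_eval_line_of_mem_pfaffianIdeal hPI hpf' hz
      have h2 : (fun t : ℂ => f (g y + t • g z)) = fun t => eval (y + t • z) P := by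
        funext t
        rw [← hP, map_add, map_smul]
      have h3 := hD (g z)
      rw [HasLineDerivAt, h2] at h3
      exact h3.unique h1
  rw [h, ← (Submodule.equivMapOfInjective _ hg _).finrank_eq]
  exact le_antisymm (htan y hpf' hy0) (two_le_finrank_ker_pfaffianDifferential hN hbpf hpf' hy0)

theorem isSmoothCurve_pfaffianLocus [FiniteDimensional ℂ V] (hg : Function.Injective g) :
    IsSmoothCurve (pfaffianLocus M g) 5 1 where
  isClosed := isClosed_pfaffianLocus M g
  isIrreducible := isIrreducible_pfaffianLocus hN hbpf htan hg
  degree_pos := by norm_num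
  hilbertPolynomial := by
    filter_upwards [Filter.eventually_ge_atTop 2] with n hn
    obtain ⟨k, rfl⟩ := Nat.exists_eq_add_of_le' hn
    rw [hilbertFunction_pfaffianLocus hN hbpf htan hg]
    push_cast
    ring
  smooth _ hp := finrank_coneTangentSpace_pfaffianLocus hN hbpf htan hg hp

end PfaffianCurve

/-! ### Coordinates on the projective line. -/

section ProjectiveLine

/-- The point `[t : 1]` of the projective line. -/
noncomputable def affinePoint (t : ℂ) : ℙ ℂ (Fin 2 → ℂ) :=
  Projectivization.mk ℂ ![t, 1] fun h => one_ne_zero (congrFun h 1)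

theorem mk_eq_affinePoint_iff {x : Fin 2 → ℂ} (hx : x ≠ 0) {t : ℂ} :
    Projectivization.mk ℂ x hx = affinePoint t ↔ x 0 = t * x 1 := by
  rw [affinePoint, Projectivization.mk_eq_mk_iff']
  constructor
  · rintro ⟨a, rfl⟩
    simp [mul_comm]
  · intro h
    refine ⟨x 1, ?_⟩
    ext i
    fin_cases i
    · simp [h, mul_comm]
    · simp

theorem mk_eq_mk_of_mul_eq {x y : Fin 2 → ℂ} (hx : x ≠ 0) (hy : y ≠ 0) (h : x 0 * y 1 = x 1 * y 0) :
    Projectivization.mk ℂ x hx = Projectivization.mk ℂ y hy := by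
  rw [Projectivization.mk_eq_mk_iff']
  by_cases hy1 : y 1 = 0
  · have hy0 : y 0 ≠ 0 := fun h0 => hy (by ext i; fin_cases i <;> assumption)
    have hx1 : x 1 = 0 := by
      rw [hy1, mul_zero] at h
      exact (mul_eq_zero.mp h.symm).resolve_right hy0
    refine ⟨x 0 / y 0, ?_⟩
    ext i
    fin_cases i
    · simp [hy0]
    · simp [hy1, hx1]
  · refine ⟨x 1 / y 1, ?_⟩
    ext i
    fin_cases i
    · simp only [Fin.zero_eta, Pi.smul_apply, smul_eq_mul]
      field_simp
      linear_combination -h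
    · simp [hy1]

theorem exists_eq_affinePoint {q : ℙ ℂ (Fin 2 → ℂ)}
    (hq : q ≠ Projectivization.mk ℂ ![1, 0] fun h => one_ne_zero (congrFun h 0)) :
    ∃ t, q = affinePoint t := by
  induction q with | h x hx => ?_
  by_cases h1 : x 1 = 0
  · exact absurd (mk_eq_mk_of_mul_eq hx _ (by simp [h1])) hq
  · exact ⟨x 0 / x 1, (mk_eq_affinePoint_iff hx).mpr (by field_simp)⟩

end ProjectiveLine

/-! ### The pencil of ℙ⁴'s on a rank four quadric. -/

section Pencil

open Matrix

variable {V : Type*} [AddCommGroup V] [Module ℂ V]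

/-- The member `{L₀ = t L₁, L₂ = t L₃}` of a pencil of subspaces of codimension two. -/
def pencilMember (L : V →ₗ[ℂ] (Fin 4 → ℂ)) (t : ℂ) : Submodule ℂ V where
  carrier := {w | L w 0 = t * L w 1 ∧ L w 2 = t * L w 3}
  add_mem' := by
    rintro x y ⟨h1, h2⟩ ⟨h3, h4⟩
    simp only [Set.mem_ofPred_eq, map_add, Pi.add_apply, h1, h2, h3, h4]
    constructor <;> ring
  zero_mem' := by simp
  smul_mem' := by
    rintro c x ⟨h1, h2⟩
    simp only [Set.mem_ofPred_eq, map_smul, Pi.smul_apply, h1, h2, smul_eq_mul]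
    constructor <;> ring

theorem mem_pencilMember_iff {L : V →ₗ[ℂ] (Fin 4 → ℂ)} {t : ℂ} {w : V} :
    w ∈ pencilMember L t ↔ L w 0 = t * L w 1 ∧ L w 2 = t * L w 3 := Iff.rfl

/-- Coordinates on the members of a pencil, the first three of which are coordinates on the base
locus of the pencil. -/
theorem exists_pencilMember_eq_range [FiniteDimensional ℂ V] {L : V →ₗ[ℂ] (Fin 4 → ℂ)}
    (hL : Function.Surjective L) (h3 : finrank ℂ (LinearMap.ker L) = 3) (t : ℂ) :
    ∃ g : (Fin 3 ⊕ Fin 2 → ℂ) →ₗ[ℂ] V, Function.Injective g ∧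
      LinearMap.range g = pencilMember L t ∧ ∀ x, g (Sum.elim x 0) ∈ LinearMap.ker L := by
  obtain ⟨s, hs⟩ := L.exists_rightInverse_of_surjective (LinearMap.range_eq_top.mpr hL)
  have hs' : ∀ x, L (s x) = x := LinearMap.congr_fun hs
  let b : Basis (Fin 3) ℂ (LinearMap.ker L) := Module.finBasisOfFinrankEq ℂ _ h3
  let j : (Fin 3 ⊕ Fin 2 → ℂ) →ₗ[ℂ] LinearMap.ker L :=
    b.equivFun.symm.toLinearMap ∘ₗ LinearMap.funLeft ℂ ℂ Sum.inl
  let m : (Fin 3 ⊕ Fin 2 → ℂ) →ₗ[ℂ] (Fin 4 → ℂ) := LinearMap.pi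
    ![t • LinearMap.proj (Sum.inr 0), LinearMap.proj (Sum.inr 0),
      t • LinearMap.proj (Sum.inr 1), LinearMap.proj (Sum.inr 1)]
  let g : (Fin 3 ⊕ Fin 2 → ℂ) →ₗ[ℂ] V := (LinearMap.ker L).subtype ∘ₗ j + s ∘ₗ m
  have hLg : ∀ x, L (g x) = m x := by
    intro x
    change L (j x + s (m x)) = m x
    rw [map_add, LinearMap.mem_ker.mp (j x).2, zero_add, hs']
  have hm (x : Fin 3 ⊕ Fin 2 → ℂ) : m x = ![t * x (Sum.inr 0), x (Sum.inr 0), t * x (Sum.inr 1), x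
      (Sum.inr 1)] := by
    ext i; fin_cases i <;> simp [m]
  refine ⟨g, ?_, ?_, ?_⟩
  · rw [← LinearMap.ker_eq_bot, LinearMap.ker_eq_bot']
    intro x hx
    have h0 : m x = 0 := by rw [← hLg, hx, map_zero]
    have h1 : j x = 0 := by
      have : (j x : V) + s (m x) = 0 := hx
      rw [h0, map_zero, add_zero] at this
      exact Subtype.ext this
    have h2 : (fun i => x (Sum.inl i)) = 0 := b.equivFun.symm.map_eq_zero_iff.mp h1
    rw [hm] at h0
    ext (i | i)
    · exact congrFun h2 i
    · fin_cases i
      · exact congrFun h0 1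
      · exact congrFun h0 3
  · ext w
    rw [mem_pencilMember_iff]
    constructor
    · rintro ⟨x, rfl⟩
      rw [hLg, hm]
      exact ⟨rfl, rfl⟩
    · rintro ⟨h1, h2⟩
      have hk : w - s (L w) ∈ LinearMap.ker L := by
        rw [LinearMap.mem_ker, map_sub, hs', sub_self]
      let x : Fin 3 ⊕ Fin 2 → ℂ := Sum.elim (b.equivFun ⟨_, hk⟩) ![L w 1, L w 3]
      have hmx : m x = L w := by
        rw [hm]
        ext i; fin_cases i <;> simp [x, h1, h2]
      have hjx : j x = ⟨_, hk⟩ := b.equivFun.symm_apply_apply _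
      refine ⟨x, ?_⟩
      change (j x : V) + s (m x) = w
      rw [hmx, hjx]
      simp
  · intro x
    rw [LinearMap.mem_ker, hLg, hm]
    ext i; fin_cases i <;> simp

variable [FiniteDimensional ℂ V] {M : V →ₗ[ℂ] Matrix (Fin 5) (Fin 5) ℂ}
  {γ B : LinearMap.BilinForm ℂ V} (hγ : ∀ x y, γ x y = γ y x) (hB : ∀ x y, B x y = B y x)
  (hBγ : ∀ x y, pfaffianPolar (M x) (M y) = 0 → B x y = γ x y)
  (hK : ∀ w ∈ LinearMap.ker B, pfaffians (M w) = 0 → w = 0)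
  (hsm : ∀ w, w ≠ 0 → pfaffians (M w) = 0 → γ w w = 0 →
    finrank ℂ (LinearMap.ker (γ w) ⊓ LinearMap.ker (pfaffianPolarₗ (M w) ∘ₗ M) : Submodule ℂ V) = 3)
  {L : V →ₗ[ℂ] (Fin 4 → ℂ)} (hL : Function.Surjective L) (hLB : LinearMap.ker L = LinearMap.ker B)
  (hBL : ∀ w, B w w = L w 0 * L w 3 - L w 1 * L w 2)

omit [FiniteDimensional ℂ V] in
include hB hBL in
-- On a member `L₀ L₃ - L₁ L₂` becomes `t L₁ L₃ - t L₁ L₃`; polarization makes the member totally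
-- isotropic.
theorem eq_zero_of_mem_pencilMember {t : ℂ} {x y : V} (hx : x ∈ pencilMember L t)
    (hy : y ∈ pencilMember L t) : B x y = 0 := by
  have h : ∀ z ∈ pencilMember L t, B z z = 0 := by
    rintro z ⟨h1, h2⟩
    rw [hBL, h1, h2]
    ring
  have h1 := h _ (add_mem hx hy)
  simp only [map_add, LinearMap.add_apply, h x hx, h y hy, hB y x] at h1
  linear_combination (1 / 2) * h1

include hγ hB hBγ hK hsm hLB hBL in
/-- The general member of the pencil is smooth. -/
theorem finite_setOf_singular_pencilMember :
    {t : ℂ | ∃ w ∈ pencilMember L t, w ≠ 0 ∧ pfaffians (M w) = 0 ∧ 2 <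
      finrank ℂ (pencilMember L t ⊓ LinearMap.ker (pfaffianPolarₗ (M w) ∘ₗ M) : Submodule ℂ
          V)}.Finite := by
  let Q : Option (Fin 5) → LinearMap.BilinForm ℂ V := fun o =>
    o.elim γ fun i => (pfaffianPolarₗ.compl₁₂ M M).compr₂ (LinearMap.proj i)
  have hQs : ∀ i x y, Q (some i) x y = pfaffianPolar (M x) (M y) i := fun i x y => rfl
  have hQ : ∀ o x y, Q o x y = Q o y x := by
    rintro (_ | i) x y
    · exact hγ x y
    · exact congrFun (pfaffianPolar_comm (M x) (M y)) i
  let l (i : Fin 4) : Dual ℂ V := LinearMap.proj i ∘ₗ L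
  refine ((finite_setOf_critical Q hQ (l 0) (l 1)).union
    (finite_setOf_critical Q hQ (l 2) (l 3))).subset ?_
  rintro t ⟨w, hw, hw0, hpf, hlt⟩
  have hpol : pfaffianPolar (M w) (M w) = 0 := by rw [pfaffianPolar_self, hpf, smul_zero]
  have hγ0 : ∀ u ∈ pencilMember L t, pfaffianPolar (M w) (M u) = 0 → γ w u = 0 := fun u hu h => by
    rw [← hBγ w u h, eq_zero_of_mem_pencilMember hB hBL hw hu]
  have hQw : ∀ o, Q o w w = 0 := by
    rintro (_ | i)
    · exact hγ0 w hw hpol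
    · rw [hQs, hpol, Pi.zero_apply]
  have hT := hsm w hw0 hpf (hγ0 w hw hpol)
  set T : Submodule ℂ V := LinearMap.ker (γ w) ⊓ LinearMap.ker (pfaffianPolarₗ (M w) ∘ₗ M)
  set E : Submodule ℂ V := pencilMember L t ⊓ LinearMap.ker (pfaffianPolarₗ (M w) ∘ₗ M)
  -- The tangent space `E` of the fibre lies in the three-dimensional tangent space `T` of the
  -- surface cone. If it is too large it equals `T`, so `L₀ - t L₁` and `L₂ - t L₃` vanish on `T`
  -- and `t` is a critical value.
  have hET : E ≤ T := fun u hu => ⟨hγ0 u hu.1 hu.2, hu.2⟩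
  have hE : E = T := Submodule.eq_of_le_of_finrank_le hET (by omega)
  have hTE : ∀ u, (∀ o, Q o w u = 0) → u ∈ pencilMember L t := by
    intro u hu
    have : u ∈ T := ⟨hu none, funext fun i => hu (some i)⟩
    rw [← hE] at this
    exact this.1
  -- The vertex misses the Grassmannian, so one of the denominators `L₁`, `L₃` is nonzero at `w`;
  -- this selects which of the two quotients is critical.
  have hLw : L w ≠ 0 := by
    intro h
    refine hw0 (hK w ?_ hpf)
    rw [← hLB]
    exact h
  by_cases h1 : L w 1 = 0
  · have h3 : L w 3 ≠ 0 := by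
      intro h3
      refine hLw ?_
      ext i
      fin_cases i
      · simp [hw.1, h1]
      · exact h1
      · simp [hw.2, h3]
      · exact h3
    exact Or.inr ⟨w, hQw, h3, hw.2, fun u hu => (hTE u hu).2⟩
  · exact Or.inl ⟨w, hQw, h1, hw.1, fun u hu => (hTE u hu).1⟩

include hL hLB hK in
-- In the coordinates chosen on the member, the last two variables vanish exactly on the vertex, so
-- disjointness of the vertex from the Grassmannian is the nonvanishing condition on the net.
theorem isSmoothCurve_pencilMember (hM : ∀ v, (M v).IsAlternating) (h3 : finrank ℂ (LinearMap.ker B)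
    = 3) {t : ℂ}
    (ht : ∀ w ∈ pencilMember L t, w ≠ 0 → pfaffians (M w) = 0 →
      finrank ℂ (pencilMember L t ⊓ LinearMap.ker (pfaffianPolarₗ (M w) ∘ₗ M) : Submodule ℂ V) ≤ 2)
          :
    IsSmoothCurve {p : ℙ ℂ V | p.rep ∈ pencilMember L t ∧ pfaffians (M p.rep) = 0} 5 1 := by
  rw [← hLB] at h3
  obtain ⟨g, hg, hgr, hgk⟩ := exists_pencilMember_eq_range hL h3 t
  rw [← hgr] at ht ⊢
  refine isSmoothCurve_pfaffianLocus (M := M) (g := g) (fun l => hM _) ?_ ?_ hg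
  · intro x hx
    have h1 : evalMatrix (coordinateMatrices M g ∘ Sum.inl) x = M (g (Sum.elim x 0)) := by
      rw [← evalMatrix_coordinateMatrices]
      simp [evalMatrix]
    rw [h1] at hx
    have h2 := hg ((hK _ (hLB ▸ hgk x) hx).trans (map_zero g).symm)
    ext i
    exact congrFun h2 (Sum.inl i)
  · intro y hy hy0
    rw [evalMatrix_coordinateMatrices] at hy
    have hgy : g y ≠ 0 := fun h0 => hy0 (hg (h0.trans (map_zero g).symm))
    refine le_trans ?_ (ht _ ⟨y, rfl⟩ hgy hy)
    rw [(Submodule.equivMapOfInjective _ hg _).finrank_eq]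
    refine Submodule.finrank_mono ?_
    rintro _ ⟨z, hz, rfl⟩
    refine ⟨⟨z, rfl⟩, ?_⟩
    have : pfaffianDifferential (coordinateMatrices M g) y z = 0 := hz
    rwa [pfaffianDifferential_apply, evalMatrix_coordinateMatrices,
      evalMatrix_coordinateMatrices] at this

include hγ hB hBγ hK hsm in
-- On `X` the relation `L₀ L₃ = L₁ L₂` glues `[L₀ : L₁]` and `[L₂ : L₃]` to one morphism, defined
-- everywhere because `X` misses the vertex. Isotropy of the members makes the equation `γ = 0`
-- redundant on the Pfaffian locus in each fibre.
theorem containsEllipticPencil_of_quadric_of_rank_four (hM : ∀ v, (M v).IsAlternating)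
    (hV : finrank ℂ V = 7) (h3 : finrank ℂ (LinearMap.ker B) = 3) :
    ContainsEllipticPencil {p : ℙ ℂ V | pfaffians (M p.rep) = 0 ∧ γ p.rep p.rep = 0} 5 := by
  obtain ⟨L, hL, hLB, hBL⟩ := B.exists_eq_mul_sub_mul hB (by omega)
  set X : Set (ℙ ℂ V) := {p | pfaffians (M p.rep) = 0 ∧ γ p.rep p.rep = 0}
  have hpol : ∀ w, pfaffians (M w) = 0 → pfaffianPolar (M w) (M w) = 0 := fun w h => by
    rw [pfaffianPolar_self, h, smul_zero]
  have hX : ∀ p ∈ X, L p.rep 0 * L p.rep 3 = L p.rep 1 * L p.rep 2 := by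
    rintro p ⟨h1, h2⟩
    rw [← sub_eq_zero, ← hBL, hBγ _ _ (hpol _ h1), h2]
  let L₁ : V →ₗ[ℂ] (Fin 2 → ℂ) := LinearMap.pi ![LinearMap.proj 0 ∘ₗ L, LinearMap.proj 1 ∘ₗ L]
  let L₂ : V →ₗ[ℂ] (Fin 2 → ℂ) := LinearMap.pi ![LinearMap.proj 2 ∘ₗ L, LinearMap.proj 3 ∘ₗ L]
  have hne : ∀ p ∈ X, L₁ p.rep ≠ 0 ∨ L₂ p.rep ≠ 0 := by
    rintro p ⟨h1, h2⟩
    by_contra! h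
    refine p.rep_nonzero (hK _ ?_ h1)
    rw [← hLB, LinearMap.mem_ker]
    ext i
    fin_cases i
    · exact congrFun h.1 0
    · exact congrFun h.1 1
    · exact congrFun h.2 0
    · exact congrFun h.2 1
  have hf : ∀ p : X, ∃ q : ℙ ℂ (Fin 2 → ℂ),
      (∀ h : L₁ p.1.rep ≠ 0, q = Projectivization.mk ℂ _ h) ∧
      (∀ h : L₂ p.1.rep ≠ 0, q = Projectivization.mk ℂ _ h) := by
    intro p
    by_cases h1 : L₁ p.1.rep = 0
    · exact ⟨Projectivization.mk ℂ _ ((hne p p.2).resolve_left (not_not.mpr h1)),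
        fun h => absurd h1 h, fun h => rfl⟩
    · exact ⟨Projectivization.mk ℂ _ h1, fun h => rfl, fun h => mk_eq_mk_of_mul_eq h1 h (hX p p.2)⟩
  choose f hf₁ hf₂ using hf
  have hreg (l : V →ₗ[ℂ] (Fin 2 → ℂ)) (hl : ∀ p : X, ∀ h : l p.1.rep ≠ 0,
      f p = Projectivization.mk ℂ _ h) (p : X) (hp : l p.1.rep ≠ 0) :
      ∃ U : Set (ℙ ℂ V), IsOpen U ∧ (p : ℙ ℂ V) ∈ U ∧
        ∃ (d : ℕ) (g : V → (Fin 2 → ℂ)), (∀ φ : Dual ℂ (Fin 2 → ℂ), (fun v => φ (g v)) ∈ forms V d)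
            ∧
          ∀ q : X, (q : ℙ ℂ V) ∈ U →
            ∃ h : g (q : ℙ ℂ V).rep ≠ 0, f q = Projectivization.mk ℂ (g (q : ℙ ℂ V).rep) h := by
    obtain ⟨i, hi⟩ := Function.ne_iff.mp hp
    refine ⟨{q | (LinearMap.proj i ∘ₗ l) q.rep ≠ 0}, isOpen_setOf_form_ne_zero (dual_mem_forms _),
        hi, 1, l,
      fun φ => dual_mem_forms (φ ∘ₗ l), fun q hq => ?_⟩
    have h : l q.1.rep ≠ 0 := fun h0 => hq (congrFun h0 i)
    exact ⟨h, hl q h⟩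
  refine ⟨f, fun p => (hne p p.2).elim (hreg L₁ hf₁ p) (hreg L₂ hf₂ p), ?_⟩
  have hfibre : ∀ t, Subtype.val '' (f ⁻¹' {affinePoint t}) =
      {p : ℙ ℂ V | p.rep ∈ pencilMember L t ∧ pfaffians (M p.rep) = 0} := by
    intro t
    ext p
    constructor
    · rintro ⟨p, hp, rfl⟩
      have hp' : f p = affinePoint t := hp
      refine ⟨⟨?_, ?_⟩, p.2.1⟩
      · by_cases h : L₁ p.1.rep = 0
        · have h0 : L p.1.rep 0 = 0 := congrFun h 0
          have h1 : L p.1.rep 1 = 0 := congrFun h 1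
          rw [h0, h1, mul_zero]
        · exact (mk_eq_affinePoint_iff h).mp ((hf₁ p h).symm.trans hp')
      · by_cases h : L₂ p.1.rep = 0
        · have h0 : L p.1.rep 2 = 0 := congrFun h 0
          have h1 : L p.1.rep 3 = 0 := congrFun h 1
          rw [h0, h1, mul_zero]
        · exact (mk_eq_affinePoint_iff h).mp ((hf₂ p h).symm.trans hp')
    · rintro ⟨hp, hpf⟩
      have hpX : p ∈ X := ⟨hpf, by
        rw [← hBγ _ _ (hpol _ hpf), eq_zero_of_mem_pencilMember hB hBL hp hp]⟩
      refine ⟨⟨p, hpX⟩, ?_, rfl⟩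
      rcases hne p hpX with h | h
      · exact (hf₁ ⟨p, hpX⟩ h).trans ((mk_eq_affinePoint_iff h).mpr hp.1)
      · exact (hf₂ ⟨p, hpX⟩ h).trans ((mk_eq_affinePoint_iff h).mpr hp.2)
  have hfin := finite_setOf_singular_pencilMember hγ hB hBγ hK hsm hLB hBL
  -- The excluded parameters are the finitely many singular ones and the point `[1 : 0]` at
  -- infinity, where the fibre is not examined.
  refine ((hfin.image affinePoint).insert
    (Projectivization.mk ℂ ![1, 0] fun h => one_ne_zero (congrFun h 0))).subset ?_
  intro q hq
  rw [Set.mem_insert_iff, or_iff_not_imp_left]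
  intro hq1
  obtain ⟨t, rfl⟩ := exists_eq_affinePoint hq1
  refine ⟨t, ?_, rfl⟩
  by_contra ht
  refine hq ?_
  change IsSmoothCurve _ 5 1
  rw [hfibre]
  refine isSmoothCurve_pencilMember hK hL hLB hM h3 fun w hw hw0 hpf => ?_
  by_contra! hlt
  exact ht ⟨w, hw, hw0, hpf, hlt⟩

include hγ hB hBγ in
/-- `containsEllipticPencil_of_quadric_of_rank_four`, with all subspaces described by their
elements. -/
theorem containsEllipticPencil_of_forall_mem_iff
    (hK : ∀ w, B w = 0 → pfaffians (M w) = 0 → w = 0)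
    (hsm : ∀ w, w ≠ 0 → pfaffians (M w) = 0 → γ w w = 0 → ∃ T : Submodule ℂ V,
      (∀ u, u ∈ T ↔ γ w u = 0 ∧ pfaffianPolar (M w) (M u) = 0) ∧ finrank ℂ T = 3)
    (hM : ∀ v, (M v).IsAlternating) (hV : finrank ℂ V = 7) {K : Submodule ℂ V} (hKB : ∀ w, w ∈ K ↔ B
        w = 0) (h3 : finrank ℂ K = 3) {X : Set (ℙ ℂ V)}
    (hX : ∀ p : ℙ ℂ V, p ∈ X ↔ pfaffians (M p.rep) = 0 ∧ γ p.rep p.rep = 0) :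
    ContainsEllipticPencil X 5 := by
  have h1 : X = {p : ℙ ℂ V | pfaffians (M p.rep) = 0 ∧ γ p.rep p.rep = 0} := Set.ext hX
  have h2 : K = LinearMap.ker B := Submodule.ext hKB
  rw [h1]
  subst h2
  refine containsEllipticPencil_of_quadric_of_rank_four hγ hB hBγ hK ?_ hM hV h3
  intro w hw h h'
  obtain ⟨T, hT, hT3⟩ := hsm w hw h h'
  rw [← hT3]
  have hT' : LinearMap.ker (γ w) ⊓ LinearMap.ker (pfaffianPolarₗ (M w) ∘ₗ M) = T :=
    Submodule.ext fun u => (hT u).symm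
  rw [hT']

end Pencil

/-! ### Application to the Gushel-Mukai surface. -/

section GushelMukai

open Matrix

variable {V₅ : Type*} [AddCommGroup V₅] [Module ℂ V₅]

theorem pfaffianPolar_plucker_eq_zero_iff (e : Basis (Fin 5) ℂ V₅) (vol : ⋀[ℂ]^5 V₅ ≃ₗ[ℂ] ℂ)
    (x y : ⋀[ℂ]^2 V₅) :
    pfaffianPolar (plucker e x) (plucker e y) = 0 ↔ ∀ v, pfaffian vol v x y = 0 := by
  constructor
  · intro h v
    simp [pfaffian_eq e, h]
  · intro h
    ext i
    have h1 := h (e i)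
    rw [pfaffian_eq e] at h1
    simpa [Finsupp.single_apply] using (mul_eq_zero.mp h1).resolve_left (vol_basis_ne_zero e vol)

theorem pfaffians_plucker_eq_zero_iff_pfaffian (e : Basis (Fin 5) ℂ V₅) (vol : ⋀[ℂ]^5 V₅ ≃ₗ[ℂ] ℂ)
    (x : ⋀[ℂ]^2 V₅) : pfaffians (plucker e x) = 0 ↔ ∀ v, pfaffian vol v x x = 0 := by
  rw [pfaffians_plucker_eq_zero_iff, pfaffian_self_eq_zero_iff e]

/-- `containsEllipticPencil_of_forall_mem_iff`, for a space with two definitionally but not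
syntactically equal structures. -/
theorem containsEllipticPencil_of_instances_eq {V : Type*} {instM : AddCommMonoid V}
    {instMod : Module ℂ V} {G : AddCommGroup V} {instModG : @Module ℂ V _ G.toAddCommMonoid}
    (hG : G.toAddCommMonoid = instM) (hmod : HEq instModG instMod) (hfin : Module.Finite ℂ V)
    {M : V →ₗ[ℂ] Matrix (Fin 5) (Fin 5) ℂ} {γ B : LinearMap.BilinForm ℂ V} {K : Submodule ℂ V}
    {X : Set (ℙ ℂ V)} (hγ : ∀ x y, γ x y = γ y x) (hB : ∀ x y, B x y = B y x)
    (hBγ : ∀ x y, pfaffianPolar (M x) (M y) = 0 → B x y = γ x y)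
    (hK : ∀ w, B w = 0 → pfaffians (M w) = 0 → w = 0)
    (hsm : ∀ w, w ≠ 0 → pfaffians (M w) = 0 → γ w w = 0 → ∃ T : Submodule ℂ V,
      (∀ u, u ∈ T ↔ γ w u = 0 ∧ pfaffianPolar (M w) (M u) = 0) ∧ finrank ℂ T = 3)
    (hM : ∀ v, (M v).IsAlternating) (hV : finrank ℂ V = 7) (hKB : ∀ w, w ∈ K ↔ B w = 0)
    (h3 : finrank ℂ K = 3)
    (hX : ∀ p : ℙ ℂ V, p ∈ X ↔ pfaffians (M p.rep) = 0 ∧ γ p.rep p.rep = 0) :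
    ContainsEllipticPencil X 5 := by
  subst hG
  obtain rfl := eq_of_heq hmod
  exact containsEllipticPencil_of_forall_mem_iff hγ hB hBγ hK hsm hM hV hKB h3 hX

/-- Here `M` is the matrix of Plücker coordinates on `W` and `B` is `γ + P_{v₀}`; smoothness of the
surface yields both the disjoint vertex and the three-dimensional tangent spaces. -/
theorem containsEllipticPencil_gmLocus (e : Basis (Fin 5) ℂ V₅) (vol : ⋀[ℂ]^5 V₅ ≃ₗ[ℂ] ℂ)
    (W : Submodule ℂ (⋀[ℂ]^2 V₅)) (γ : LinearMap.BilinForm ℂ W) (hγ : γ.IsSymm)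
    (hS : IsSmoothGM vol W γ 2) {v₀ : V₅} {K : Submodule ℂ W}
    (hK : ∀ w, w ∈ K ↔ gmForm vol γ v₀ w = 0) (h3 : finrank ℂ K = 3) :
    ContainsEllipticPencil (gmLocus W γ) 5 := by
  have hW : FiniteDimensional ℂ W := by
    have := Module.Finite.of_basis e
    have h1 : Module.Finite ℂ (⋀[ℂ]^2 V₅) := inferInstance
    have h2 : IsNoetherian ℂ (⋀[ℂ]^2 V₅) := isNoetherian_of_isNoetherianRing_of_finite _ _
    exact Module.IsNoetherian.finite _ _
  obtain ⟨M, hM⟩ : ∃ M : W →ₗ[ℂ] Matrix (Fin 5) (Fin 5) ℂ, ∀ w : W, M w = plucker e w :=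
    ⟨plucker e ∘ₗ W.subtype, fun _ => rfl⟩
  have hpol : ∀ x y : W, pfaffianPolar (M x) (M y) = 0 ↔ ∀ v, pfaffian vol v x y = 0 := by
    intro x y
    rw [hM, hM, pfaffianPolar_plucker_eq_zero_iff e vol]
  have hpf : ∀ x : W, pfaffians (M x) = 0 ↔ ∀ v, pfaffian vol v x x = 0 := by
    intro x
    rw [hM, pfaffians_plucker_eq_zero_iff_pfaffian e vol]
  refine containsEllipticPencil_of_instances_eq rfl HEq.rfl hW (M := M) (γ := γ)
    (B := gmForm vol γ v₀) (fun x y => hγ.eq x y) ?_ ?_ ?_ ?_ ?_ hS.finrank_eq hK h3 ?_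
  · intro x y
    rw [gmForm_apply, gmForm_apply, pfaffian_comm e vol v₀ x y]
    exact congrArg (· + _) (hγ.eq x y)
  · intro x y h
    rw [gmForm_apply, (hpol x y).mp h, add_zero]
  · intro w hw h
    exact eq_zero_of_mem_ker_gmForm e vol hγ hS hw ((hpf w).mp h)
  · intro w hw h h'
    refine ⟨coneTangentSpace (gmEquations vol W γ) w, fun u => ?_,
      finrank_coneTangentSpace_gmEquations e vol hγ hS hw ((hpf w).mp h) h'⟩
    rw [mem_coneTangentSpace_gmEquations_iff e vol hγ, hpol]
  · intro v
    rw [hM]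
    exact isAlternating_plucker e _
  · intro p
    rw [hpf, pfaffian_self_eq_zero_iff e]
    exact Iff.rfl

end GushelMukai

theorem mainTheorem4 {V₅ : Type*} [AddCommGroup V₅] [Module ℂ V₅]
    (hV₅ : Module.finrank ℂ V₅ = 5) (vol : ⋀[ℂ]^5 V₅ ≃ₗ[ℂ] ℂ)
    (W : Submodule ℂ (⋀[ℂ]^2 V₅)) (γ : LinearMap.BilinForm ℂ W) (hγ : γ.IsSymm)
    (hS : IsSmoothGM vol W γ 2)
    (hY : (epwStratum (gmLagrangian vol W γ) 3 \ pluckerHyperplane V₅).Nonempty) :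
    ContainsEllipticPencil (gmLocus W γ) 5 := by
  have := Module.finite_of_finrank_pos (R := ℂ) (M := V₅) (by omega)
  let e : Basis (Fin 5) ℂ V₅ := Module.finBasisOfFinrankEq ℂ V₅ hV₅
  obtain ⟨p, hp, hp'⟩ := hY
  -- Being off `ℙ(V₅)` means a nonzero `x`-coordinate, so the point can be normalized to `[v₀ + x]`.
  have hc : p.rep.2 ≠ 0 := fun h => hp' ⟨p.rep.1, Prod.ext rfl h.symm⟩
  refine containsEllipticPencil_gmLocus e vol W γ hγ hS (v₀ := p.rep.2⁻¹ • p.rep.1)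
    (K := LinearMap.ker (gmForm vol γ (p.rep.2⁻¹ • p.rep.1))) (fun _ => LinearMap.mem_ker) ?_
  rw [finrank_ker_gmForm e vol W γ hc]
  exact hp
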